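/- Let $s,u,v\in\mathbb C\setminus\{0\}$, fix square roots $\sqrt u,\sqrt v$ and put $\alpha=(\sqrt u-\sqrt v)^2$, $\beta=(\sqrt u+\sqrt v)^2$. Let $F_g=\sum_\Gamma \frac{1}{|\mathrm{Aut}\,\Gamma|}\,s^{e(\Gamma)}u^{b(\Gamma)}v^{w(\Gamma)}\prod_{f}p_{\deg f}$ be the genus $g$ dessin free energy. The sum runs over isomorphism classes of connected genus $g$ dessins d'enfants $\Gamma$ (bicoloured ribbon graphs) with $e\ge 1$ edges, $b$ black and $w$ white vertices; the product is over the faces $f$ of $\Gamma$, and a face bounded by $2m$ edge sides has degree $m$. For $n\ge1$ define $$G_{g,n}(x_1,\dots,x_n)=\sum_{a_1,\dots,a_n\ge 1} a_1\cdots a_n\left.\frac{\partial^nF_g}{\partial p_{a_1}\cdots\partial p_{a_n}}\right|_{p=0}\frac{1}{x_1^{a_1+1}\cdots x_n^{a_n+1}} .$$ The dessin spectral curve $y^2=\frac1{4s^2}-\frac{u+v}{2sx}+\frac{(u-v)^2}{4x^2}$ has the global coordinate $z=\sqrt{(x-s\beta)/(x-s\alpha)}$, with the branch $z\to1$ as $x\to\infty$,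 and the parametrization $$x(z)=\frac{s(\alpha z^2-\beta)}{z^2-1},\qquad y(z)=-\frac{(\alpha-\beta)z}{2s(\alpha z^2-\beta)} .$$ Let $\sigma(z)=-z$, $B(z_1,z_2)=\frac{dz_1dz_2}{(z_1-z_2)^2}$ and $K(z_0,z)=\dfrac{\frac12\int_{q=\sigma(z)}^{z}B(z_0,q)}{(y(z)-y(\sigma(z)))\,dx(z)}$. Define the Eynard–Orantin differentials $\omega_{g,n}$, $n\ge 1$, by $\omega_{0,1}=y\,dx$, $\omega_{0,2}=B$ and, for $2g-2+(n+1)>0$, $$\omega_{g,n+1}(z_0,z_{[n]})=\Big(\operatorname*{Res}_{z\to0}+\operatorname*{Res}_{z\to\infty}\Big)K(z_0,z)\Big[\omega_{g-1,n+2}(z,\sigma(z),z_{[n]})+\sum_{h=0}^{g}\ \sideset{}{'}\sum_{I\subset[n]}\omega_{h,|I|+1}(z,z_I)\,\omega_{g-h,n-|I|+1}(\sigma(z),z_{[n]\setminus I})\Big],$$ where $[n]=\{1,\dots,n\}$, the first term is absent for $g=0$, and $\sum'$ omits the terms containing $\omega_{0,1}$. Theorem. Let $g\ge 0$, $n\ge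 1$ and $2g-2+n>0$. For $|x_i|>\max(|s\alpha|,|s\beta|)$, $i=1,\dots,n$, the series $G_{g,n}(x_1,\dots,x_n)$ converges absolutely, and the differential $W_{g,n}=G_{g,n}(x_1,\dots,x_n)\,dx_1\cdots dx_n$ has the form $$W_{g,n}=w_{g,n}(z_1,\dots,z_n)\,dz_1\cdots dz_n=\tilde w_{g,n}(\tilde z_1,\dots,\tilde z_n)\,d\tilde z_1\cdots d\tilde z_n,\qquad \tilde z_i=1/z_i,$$ where $w_{g,n}$ and $\tilde w_{g,n}$ are Laurent polynomials with only terms of even degree in each variable. Moreover the $W_{g,n}$ are given by the Eynard–Orantin topological recursion of the dessin spectral curve: $W_{g,n}=\omega_{g,n}$, i.e. $\omega_{g,n}=w_{g,n}(z_1,\dots,z_n)\,dz_1\cdots dz_n$ for all $z_1,\dots,z_n\in\mathbb C\setminus\{0\}$. -/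

import Mathlib

/-! ### Counting dessins d'enfants -/

/-- The number of cycles of a permutation, fixed points included. -/
def numCycles {d : ℕ} (σ : Equiv.Perm (Fin d)) : ℕ :=
  Multiset.card σ.partition.parts

/-- The pair `(σ₀, σ₁)` is a connected dessin with `d ≥ 1` labelled edges: the black vertices
are the cycles of `σ₀`, the white vertices those of `σ₁`, the faces those of `σ₀ * σ₁`, and
connectedness is transitivity of the group generated by `σ₀` and `σ₁`. -/
def IsDessin {d : ℕ} (σ₀ σ₁ : Equiv.Perm (Fin d)) : Prop :=
  0 < d ∧ MulAction.IsPretransitive (Subgroup.closure {σ₀, σ₁}) (Fin d)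

/-- The dessin has genus `g`: Euler's formula `2 - 2g = (#black + #white) - #edges + #faces`. -/
def HasGenus {d : ℕ} (σ₀ σ₁ : Equiv.Perm (Fin d)) (g : ℕ) : Prop :=
  d + 2 = numCycles σ₀ + numCycles σ₁ + numCycles (σ₀ * σ₁) + 2 * g

/-- The exponent of the monomial `∏ p_m ^ #(faces of degree m)`. -/
noncomputable def faceExponent {d : ℕ} (σ₀ σ₁ : Equiv.Perm (Fin d)) : ℕ →₀ ℕ :=
  Multiset.toFinsupp (σ₀ * σ₁).partition.parts

open scoped Classical in
/-- The sum over isomorphism classes of connected genus `g` dessins with `d` edges and with face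
degrees recorded by `μ`, of `|Aut|⁻¹ s ^ #edges u ^ #black v ^ #white`. A sum over isomorphism
classes weighted by `|Aut|⁻¹` is the sum over edge-labelled dessins divided by `d!`. -/
noncomputable def dessinSum (s u v : ℂ) (g d : ℕ) (μ : ℕ →₀ ℕ) : ℂ :=
  (d.factorial : ℂ)⁻¹ *
    ∑ σ : Equiv.Perm (Fin d) × Equiv.Perm (Fin d),
      if IsDessin σ.1 σ.2 ∧ HasGenus σ.1 σ.2 g ∧ faceExponent σ.1 σ.2 = μ then
        s ^ d * u ^ numCycles σ.1 * v ^ numCycles σ.2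
      else 0

/-- The genus `g` part of the dessin free energy, a power series in `p₁, p₂, …` (the variable
with index `0` does not occur). A dessin with `μ m` faces of degree `m` contributes to the
monomial `∏ p_m ^ μ m` and has `∑ m * μ m` edges. -/
noncomputable def dessinFreeEnergy (s u v : ℂ) (g : ℕ) : MvPowerSeries ℕ ℂ := fun μ =>
  dessinSum s u v g (μ.sum fun m k => m * k) μ

/-- The correlator `⟨p_{a₁} ⋯ p_{aₙ}⟩_g = a₁ ⋯ aₙ ∂ⁿF_g / ∂p_{a₁} ⋯ ∂p_{aₙ}` at `p = 0`. -/
noncomputable def dessinCorrelator (s u v : ℂ) (g : ℕ) {n : ℕ} (a : Fin n → ℕ) : ℂ :=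
  (∏ i, (a i : ℂ)) *
    MvPowerSeries.constantCoeff
      ((List.ofFn a).foldr (fun m F => MvPowerSeries.pderiv ℂ m F) (dessinFreeEnergy s u v g))

/-- The term with index `(a₁, …, aₙ)` of the series defining `G_{g,n}(x₁, …, xₙ)`. -/
noncomputable def dessinGTerm (s u v : ℂ) (g : ℕ) {n : ℕ} (x : Fin n → ℂ) (a : Fin n → ℕ) : ℂ :=
  dessinCorrelator s u v g a * ∏ i, ((x i) ^ (a i + 1))⁻¹

/-- The `n`-point function `G_{g,n}(x₁, …, xₙ)`. -/
noncomputable def dessinG (s u v : ℂ) (g : ℕ) {n : ℕ} (x : Fin n → ℂ) : ℂ :=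
  ∑' a : Fin n → ℕ, dessinGTerm s u v g x a

/-! ### The dessin spectral curve -/

/-- The function `x` on the spectral curve, in the global coordinate `z`. -/
noncomputable def curveX (s α β : ℂ) (z : ℂ) : ℂ :=
  s * (α * z ^ 2 - β) / (z ^ 2 - 1)

/-- The function `y` on the spectral curve, in the global coordinate `z`. -/
noncomputable def curveY (s α β : ℂ) (z : ℂ) : ℂ :=
  -((α - β) * z) / (2 * s * (α * z ^ 2 - β))

/-- The functions `curveX` and `curveY` parametrize the dessin spectral curve. -/
theorem curveY_sq {s u v a b α β z : ℂ} (hs : s ≠ 0) (hu : a ^ 2 = u) (hv : b ^ 2 = v)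
    (hα : α = (a - b) ^ 2) (hβ : β = (a + b) ^ 2) (hz : z ^ 2 ≠ 1) (hx : α * z ^ 2 ≠ β) :
    curveY s α β z ^ 2 = 1 / (4 * s ^ 2) - (u + v) / (2 * s * curveX s α β z)
      + (u - v) ^ 2 / (4 * curveX s α β z ^ 2) := by
  have h1 : z ^ 2 - 1 ≠ 0 := sub_ne_zero.mpr hz
  have h2 : α * z ^ 2 - β ≠ 0 := sub_ne_zero.mpr hx
  have e1 : u + v = (α + β) / 2 := by subst hu hv hα hβ; ring
  have e2 : (u - v) ^ 2 = α * β := by subst hu hv hα hβ; ring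
  rw [e1, e2]
  unfold curveY curveX
  field_simp
  ring

/-- The coordinate `z = √((1 - sβ/x) / (1 - sα/x))`, with the branch that tends to `1` as
`x → ∞`. For `|x| > max(|sα|, |sβ|)` that branch is given by the principal square root. -/
noncomputable def curveZ (s α β : ℂ) (x : ℂ) : ℂ :=
  Complex.sqrt ((1 - s * β / x) / (1 - s * α / x))

/-! ### Eynard–Orantin topological recursion on the Riemann sphere

The curve is the Riemann sphere with coordinate `z`, functions `x`, `y`, hyperelliptic
involution `σ(z) = -z`, ramification points `z = 0` and `z = ∞`, and Bergman kernel
`dz₁ dz₂ / (z₁ - z₂)²`. Multilinear differentials are given by their coefficient functions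
with respect to `dz₁ ⋯ dzₙ`. -/

/-- The residue at `0` of `f(z) dz`, for `f` holomorphic in a punctured neighbourhood of `0`:
the contour integral over small circles (eventually independent of the radius). -/
noncomputable def residueZero (f : ℂ → ℂ) : ℂ :=
  Filter.limUnder (nhdsWithin (0 : ℝ) (Set.Ioi 0)) fun r : ℝ =>
    (2 * (Real.pi : ℂ) * Complex.I)⁻¹ * circleIntegral f 0 r

/-- The residue at `∞` of `f(z) dz`, computed in the coordinate `t = 1/z`, where
`dz = -t⁻² dt`. -/
noncomputable def residueInfinity (f : ℂ → ℂ) : ℂ :=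
  residueZero fun t => f t⁻¹ * (-(t ^ 2)⁻¹)

/-- The recursion kernel
`K(z₀, z) = ½ ∫_{q = σ(z)}^{z} B(z₀, q) / ((y(z) - y(σ z)) dx(z))`, as the coefficient of
`dz₀ / dz`; the integral of `B(z₀, q) = dz₀ dq / (z₀ - q)²` is evaluated with the primitive
`1 / (z₀ - q)`. -/
noncomputable def eoKernel (x y : ℂ → ℂ) (z₀ z : ℂ) : ℂ :=
  1 / 2 * (1 / (z₀ - z) - 1 / (z₀ - (-z))) / ((y z - y (-z)) * deriv x z)

/-- The Eynard–Orantin differentials `ω_{g,n}` (for `n ≥ 1`; the value for `n = 0` is not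
meaningful): `ω_{0,1} = y dx`, `ω_{0,2} = B` and, for `2g - 2 + (n + 1) > 0`,
`ω_{g,n+1}(z₀, z_[n]) = (Res_{z → 0} + Res_{z → ∞}) K(z₀, z)
  [ω_{g-1,n+2}(z, σz, z_[n]) + ∑' ω_{h,|I|+1}(z, z_I) ω_{g-h,n-|I|+1}(σz, z_{[n] - I})]`,
where the primed sum omits the terms that contain `ω_{0,1}`. The bracket is a multiple of
`dz d(σz) = -dz dz`, whence the minus sign. -/
noncomputable def eoOmega (x y : ℂ → ℂ) : (g n : ℕ) → (Fin n → ℂ) → ℂ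
  | _, 0, _ => 0
  | 0, 1, z => y (z 0) * deriv x (z 0)
  | 0, 2, z => 1 / (z 0 - z 1) ^ 2
  | g, n + 1, z =>
    let zs : Fin n → ℂ := Fin.tail z
    let integrand : ℂ → ℂ := fun q =>
      eoKernel x y (z 0) q *
        (-((if _hg : g = 0 then 0
            else eoOmega x y (g - 1) (n + 2) (Fin.cons q (Fin.cons (-q) zs))) +
          ∑ h : Fin (g + 1), ∑ I : Finset (Fin n),
            if _hI : (h.val = 0 ∧ I = ∅) ∨ (h.val = g ∧ I = Finset.univ) then 0
            else
              eoOmega x y h.val (I.card + 1) (Fin.cons q (zs ∘ I.orderEmbOfFin rfl)) *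
              eoOmega x y (g - h.val) (Iᶜ.card + 1)
                (Fin.cons (-q) (zs ∘ Iᶜ.orderEmbOfFin rfl))))
    residueZero integrand + residueInfinity integrand
termination_by g n => 2 * g + n
decreasing_by
  · omega
  · have h1 : I.card ≤ n := by simpa using Finset.card_le_univ I
    have h2 := h.isLt
    have h3 : I.card = n → I = Finset.univ := fun e =>
      Finset.eq_univ_of_card I (by simpa using e)
    by_contra hc
    exact _hI (Or.inr ⟨by omega, h3 (by omega)⟩)
  · have h0 : Iᶜ.card = n - I.card := by simp [Finset.card_compl]
    have h2 := h.isLt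
    have h3 : I.card = 0 → I = ∅ := Finset.card_eq_zero.mp
    have h1 : I.card ≤ n := by simpa using Finset.card_le_univ I
    by_contra hc
    exact _hI (Or.inl ⟨by omega, h3 (by omega)⟩)

/-! ### Laurent polynomials in several variables -/

/-- Laurent polynomials in `n` variables over `ℂ`, as finitely supported families of
coefficients indexed by the exponents. -/
abbrev LaurentPoly (n : ℕ) : Type := (Fin n → ℤ) →₀ ℂ

/-- The value of a Laurent polynomial at a point with non-zero coordinates. -/
noncomputable def LaurentPoly.eval {n : ℕ} (w : LaurentPoly n) (z : Fin n → ℂ) : ℂ :=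
  w.sum fun k c => c * ∏ i, z i ^ k i

/-- Only terms of even degree in each variable occur. -/
def LaurentPoly.EvenDegrees {n : ℕ} (w : LaurentPoly n) : Prop :=
  ∀ k ∈ w.support, ∀ i, Even (k i)

/-! A dessin with labelled edges is a factorization φ = στ. The factor a₁⋯aₙ and the factorials from
the derivatives cancel d! against the size of a conjugacy class, so the correlator is the weighted
number of connected genus g factorizations of one fixed φ with cycle lengths a₁, …, aₙ
(`dessinCorrelator_eq`).

Removing one edge shortens, cuts or joins cycles of φ (`factSumOf_succ_cons`). Connected counts are
the logarithm of all counts, and dividing the recursion by the partition function adds a quadratic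
term (`connSumOf_succ_cons`). A variable that records the Euler characteristic separates the genera
(`genusSum_succ_cons`). With one degree made into a power series in X = 1/x and the other degrees
fixed, this is the loop equation (`genusSer_eq`). Its case (0,1) is quadratic, and completing the
square gives the spectral curve. In all other cases the terms with the (0,1) series move to the left
and become multiplication by y, up to a constant (`ySer_mul_genusSer`).

Dividing by y is what the recursion kernel does. Division by y sends the product of the expansions
of z^(2k) dz/dx and z^(2l) dz/dx to a combination of four such expansions, with coefficients
`kerCoeff`. The kernel is, up to sign, q/(z₀² - q²) times the Laurent polynomial with the same
coefficients, and the residues of q/(z₀² - q²) f(q) at 0 and ∞ add up to f(z₀) for every even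
Laurent polynomial f (`hasTotalRes_even`). Hence both recursions agree on monomials
(`resMatches_kernel_mono`), without deformation of contours.

The factors ω_{0,2} are not Laurent polynomials. In the loop equation their role is played by the
two-point series together with the shift terms. That combination and the residue with the Bergman
kernel obey the same recursion in the exponent and both vanish at exponent 0 (`insertSer_add_one`,
`HasTotalRes.even_bergman_add_one`, `resMatches_insert`). The initial cases (0,3) and (1,1) involve
only two-point terms and are computed explicitly. Induction on 2g + n then gives `matches_genusSer`:
one finite family of coefficients describes both the series and ω_{g,n}.

For the analytic part, z is holomorphic in X on the disc |X| < 1/max(|sα|, |sβ|), so its powers have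
absolutely convergent expansions there. The series G_{g,n} is a finite combination of products of
such expansions. -/

/-! ### Cycle lengths of permutations -/

section CycleLengths

open Equiv Equiv.Perm

variable {α β : Type*} [Fintype α] [DecidableEq α] [Fintype β] [DecidableEq β]

/-- The multiset of the lengths of the cycles of a permutation, fixed points included. -/
def cycleLengths (φ : Perm α) : Multiset ℕ := φ.partition.parts

theorem cycleLengths_eq (φ : Perm α) : cycleLengths φ =
    φ.cycleType + Multiset.replicate (Fintype.card α - φ.support.card) 1 := rfl

theorem zero_notMem_cycleLengths (φ : Perm α) : 0 ∉ cycleLengths φ := fun h =>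
  lt_irrefl 0 (φ.partition.parts_pos h)

theorem sum_cycleLengths (φ : Perm α) : (cycleLengths φ).sum = Fintype.card α :=
  φ.partition.parts_sum

theorem filter_cycleLengths (φ : Perm α) :
    (cycleLengths φ).filter (2 ≤ ·) = φ.cycleType :=
  filter_parts_partition_eq_cycleType

theorem filter_two_le_add_replicate {μ : Multiset ℕ} (h0 : 0 ∉ μ) :
    μ = μ.filter (2 ≤ ·) + Multiset.replicate (μ.sum - (μ.filter (2 ≤ ·)).sum) 1 := by
  have h1 : μ.filter (¬ 2 ≤ ·) = Multiset.replicate (μ.filter (¬ 2 ≤ ·)).card 1 := by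
    refine Multiset.eq_replicate_card.mpr fun b hb => ?_
    have h2 := Multiset.mem_filter.mp hb
    have : b ≠ 0 := fun h => h0 (h ▸ h2.1)
    omega
  have h2 := Multiset.filter_add_not (2 ≤ ·) μ
  have h3 : μ.sum = (μ.filter (2 ≤ ·)).sum + (μ.filter (¬ 2 ≤ ·)).card := by
    conv_lhs => rw [← h2, Multiset.sum_add, h1]
    simp
  rw [h3, Nat.add_sub_cancel_left, ← h1, h2]

/-- `cycleType` forgets the fixed points, but the size of the set restores them: whatever is missing
from the sum consists of ones. -/
theorem cycleLengths_eq_of_cycleType (φ : Perm α) {μ : Multiset ℕ} (h0 : 0 ∉ μ)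
    (hs : μ.sum = Fintype.card α) (hc : φ.cycleType = μ.filter (2 ≤ ·)) :
    cycleLengths φ = μ := by
  rw [filter_two_le_add_replicate h0, cycleLengths_eq, ← sum_cycleType, hs, hc]

theorem cycleType_permCongr (e : α ≃ β) (φ : Perm α) :
    (e.permCongr φ).cycleType = φ.cycleType := by
  have := cycleType_extendDomain (e.trans (Equiv.Set.univ β).symm) (g := φ)
  rw [← this]
  congr 1

theorem cycleLengths_permCongr (e : α ≃ β) (φ : Perm α) :
    cycleLengths (e.permCongr φ) = cycleLengths φ :=
  cycleLengths_eq_of_cycleType _ (zero_notMem_cycleLengths φ)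
    ((sum_cycleLengths φ).trans (Fintype.card_congr e))
    ((cycleType_permCongr e φ).trans (filter_cycleLengths φ).symm)

theorem exists_permCongr_eq {φ : Perm α} {ψ : Perm β} (h : cycleLengths φ = cycleLengths ψ) :
    ∃ e : α ≃ β, e.permCongr φ = ψ := by
  have hc : Fintype.card α = Fintype.card β := by
    rw [← sum_cycleLengths φ, h, sum_cycleLengths]
  let e := Fintype.equivOfCardEq hc
  have h1 : (e.permCongr φ).cycleType = ψ.cycleType := by
    rw [cycleType_permCongr, ← filter_cycleLengths, h, filter_cycleLengths]
  obtain ⟨c, hc⟩ := isConj_iff.mp (isConj_of_cycleType_eq h1)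
  refine ⟨e.trans c, ?_⟩
  rw [← hc]
  ext x
  simp [Equiv.permCongr_apply, Perm.mul_apply, Perm.inv_def]

theorem cycleLengths_mul_comm (φ ψ : Perm α) : cycleLengths (φ * ψ) = cycleLengths (ψ * φ) := by
  have : φ * ψ = φ * (ψ * φ) * φ⁻¹ := by group
  have h : (φ * ψ).cycleType = (ψ * φ).cycleType := by rw [this, cycleType_conj]
  exact cycleLengths_eq_of_cycleType _ (zero_notMem_cycleLengths _) (sum_cycleLengths _)
    (h.trans (filter_cycleLengths _).symm)

theorem cycleType_formPerm_mul {l : List α} (hl : l.Nodup) {ψ : Perm α} (h : ∀ x ∈ l, ψ x = x) :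
    (l.formPerm * ψ).cycleType = ({l.length} : Multiset ℕ).filter (2 ≤ ·) + ψ.cycleType := by
  have hd : Disjoint l.formPerm ψ := fun x => by
    by_cases hx : x ∈ l
    · exact Or.inr (h x hx)
    · exact Or.inl (List.formPerm_apply_of_notMem hx)
  rw [hd.cycleType_mul]
  congr 1
  by_cases h2 : 2 ≤ l.length
  · rw [Multiset.filter_singleton, if_pos h2,
      Perm.IsCycle.cycleType (List.isCycle_formPerm hl h2), List.support_formPerm_of_nodup l hl
        (by rintro x rfl; simp at h2), List.toFinset_card_of_nodup hl]
  · rw [Multiset.filter_singleton, if_neg h2, (List.formPerm_eq_one_iff l hl).mpr (by omega)]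
    simp

/-- The multiset `μ` collects the cycles of `ψ` away from `l`. Expressing both permutations through
one `μ` makes it possible to replace the cycle on `l` by other cycles on the same points. -/
theorem cycleLengths_formPerm_mul {l : List α} (hl : l.Nodup) (hne : l ≠ []) {ψ : Perm α}
    (h : ∀ x ∈ l, ψ x = x) : ∃ μ : Multiset ℕ, 0 ∉ μ ∧ ψ.cycleType = μ.filter (2 ≤ ·) ∧
      cycleLengths (l.formPerm * ψ) = l.length ::ₘ μ ∧
      cycleLengths ψ = Multiset.replicate l.length 1 + μ := by
  have hsupp : ψ.support.card + l.length ≤ Fintype.card α := by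
    rw [← List.toFinset_card_of_nodup hl, ← Finset.card_union_of_disjoint]
    · exact Finset.card_le_univ _
    · rw [Finset.disjoint_left]
      intro x hx hx'
      exact (mem_support.mp hx) (h x (List.mem_toFinset.mp hx'))
  have hpos : l.length ≠ 0 := by simpa using hne
  have hf : ψ.cycleType.filter (2 ≤ ·) = ψ.cycleType :=
    Multiset.filter_eq_self.mpr fun _ => two_le_of_mem_cycleType
  refine ⟨ψ.cycleType + Multiset.replicate (Fintype.card α - ψ.support.card - l.length) 1,
    ?_, ?_, ?_, ?_⟩
  · intro h0
    rcases Multiset.mem_add.mp h0 with h0 | h0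
    · exact absurd (two_le_of_mem_cycleType h0) (by norm_num)
    · exact absurd (Multiset.eq_of_mem_replicate h0) (by norm_num)
  · simp +contextual [Multiset.filter_add, hf, Multiset.filter_eq_nil, Multiset.mem_replicate]
  · refine cycleLengths_eq_of_cycleType _ ?_ ?_ ?_
    · intro h0
      rcases Multiset.mem_cons.mp h0 with h0 | h0
      · exact hpos h0.symm
      rcases Multiset.mem_add.mp h0 with h0 | h0
      · exact absurd (two_le_of_mem_cycleType h0) (by norm_num)
      · exact absurd (Multiset.eq_of_mem_replicate h0) (by norm_num)
    · simp [sum_cycleType]; omega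
    · rw [cycleType_formPerm_mul hl h, ← Multiset.singleton_add, Multiset.filter_add,
        Multiset.filter_add, hf]
      simp +contextual [Multiset.filter_eq_nil, Multiset.mem_replicate]
  · rw [cycleLengths_eq, add_left_comm, ← Multiset.replicate_add]
    congr 2; omega

/-- The length of the cycle of `x`. -/
def cycleLengthAt (φ : Perm α) (x : α) : ℕ := if φ x = x then 1 else (φ.cycleOf x).support.card

/-- A cycle of length a has a points. This is the source of the factor a in the join term. -/
theorem sum_cycleLengthAt {A : Type*} [AddCommMonoid A] (φ : Perm α) (G : ℕ → A) :
    ∑ x, G (cycleLengthAt φ x) = ((cycleLengths φ).map fun a => a • G a).sum := by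
  rw [cycleLengths_eq, Multiset.map_add, Multiset.sum_add, Multiset.map_replicate,
    Multiset.sum_replicate, one_smul, ← Finset.sum_add_sum_compl φ.support]
  congr 1
  · have hm : ∀ x ∈ φ.support, φ.cycleOf x ∈ φ.cycleFactorsFinset := fun x hx =>
      cycleOf_mem_cycleFactorsFinset_iff.mpr hx
    rw [← Finset.sum_fiberwise_of_maps_to hm, cycleType_def, Multiset.map_map]
    refine Finset.sum_congr rfl fun c hc => ?_
    have : φ.support.filter (fun x => φ.cycleOf x = c) = c.support := by
      ext x
      rw [Finset.mem_filter]
      constructor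
      · rintro ⟨hx, rfl⟩
        exact (mem_support_cycleOf_iff.mpr ⟨SameCycle.refl _ _, hx⟩)
      · intro hx
        have := cycle_is_cycleOf hx hc
        refine ⟨mem_cycleFactorsFinset_support_le hc hx, this.symm⟩
    rw [Finset.sum_congr this (g := fun _ => G c.support.card)]
    · simp
    · intro x hx
      rw [cycleLengthAt, ← cycle_is_cycleOf hx hc,
        if_neg (mem_support.mp (mem_cycleFactorsFinset_support_le hc hx))]
  · rw [← Finset.card_compl, ← Finset.sum_const]
    refine Finset.sum_congr rfl fun x hx => ?_
    rw [cycleLengthAt, if_pos (by simpa using hx)]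

theorem exists_formPerm_mul (φ : Perm α) (x : α) : ∃ (l : List α) (ψ : Perm α),
    (x :: l).Nodup ∧ φ = (x :: l).formPerm * ψ ∧ (∀ y ∈ x :: l, ψ y = y) ∧
    cycleLengthAt φ x = l.length + 1 ∧ (∀ y ∈ l, φ y ≠ y) ∧ (∀ y, φ y = y → ψ y = y) := by
  by_cases hx : φ x = x
  · exact ⟨[], φ, by simp, by simp, by simpa using hx, by simp [cycleLengthAt, hx], by simp,
      fun y h => h⟩
  · have hs : x ∈ φ.support := mem_support.mpr hx
    have h2 : 2 ≤ (φ.toList x).length := two_le_length_toList_iff_mem_support.mpr hs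
    have hmem : ∀ y, y ∈ φ.toList x ↔ y ∈ (φ.cycleOf x).support := fun y => by
      rw [mem_toList_iff, mem_support_cycleOf_iff]
    obtain ⟨x', l, hl⟩ : ∃ x' l, φ.toList x = x' :: l := by
      cases h : φ.toList x with
      | nil => simp [h] at h2
      | cons a l => exact ⟨a, l, rfl⟩
    have hx' : x' = x := by
      have := toList_getElem_zero φ x hs
      simpa [hl] using this
    subst hx'
    have hd := disjoint_mul_inv_of_mem_cycleFactorsFinset
      (cycleOf_mem_cycleFactorsFinset_iff.mpr hs)
    have hfix : ∀ y ∈ x' :: l, (φ * (φ.cycleOf x')⁻¹) y = y := by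
      intro y hy
      rw [← hl, hmem, mem_support] at hy
      exact (hd y).resolve_right hy
    refine ⟨l, φ * (φ.cycleOf x')⁻¹, hl ▸ nodup_toList φ x', ?_, hfix, ?_, ?_, ?_⟩
    · rw [← hl, formPerm_toList, hd.commute.symm.eq]; group
    · rw [cycleLengthAt, if_neg hx, ← length_toList, hl, List.length_cons]
    · intro y hy
      have : y ∈ φ.toList x' := by rw [hl]; exact List.mem_cons_of_mem _ hy
      rw [hmem] at this
      exact mem_support.mp (support_cycleOf_le φ x' this)
    · intro y hy
      have h1 : (φ.cycleOf x') y = y := by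
        by_contra h
        exact mem_support.mp (support_cycleOf_le φ x' (mem_support.mpr h)) hy
      rw [Perm.mul_apply, Perm.inv_eq_iff_eq.mpr h1.symm, hy]

/-- A transposition of two points of one cycle cuts it; read backwards, a transposition joins two
cycles. Both halves of cut-and-join rest on this identity. -/
theorem formPerm_cons_append_cons {α : Type*} [DecidableEq α] {x y : α} {l₁ l₂ : List α} (h : (x :: (l₁ ++ y :: l₂)).Nodup) :
    (x :: (l₁ ++ y :: l₂)).formPerm = swap x y * ((x :: l₁).formPerm * (y :: l₂).formPerm) := by
  induction l₁ generalizing x with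
  | nil => simp
  | cons w l₁ ih =>
    have h1 : x ≠ w ∧ x ≠ y ∧ w ≠ y := by
      simp only [List.cons_append, List.nodup_cons, List.mem_cons, List.mem_append, not_or] at h
      tauto
    rw [List.cons_append, List.formPerm_cons_cons, ih (by
      rw [List.cons_append] at h; exact (List.nodup_cons.mp h).2), List.formPerm_cons_cons]
    rw [← mul_assoc, ← mul_assoc, ← mul_assoc, mul_assoc (swap x y)]
    have : swap x w * swap w y * (swap x w)⁻¹ = swap x y := by
      rw [← Equiv.swap_apply_apply]
      simp [swap_apply_of_ne_of_ne h1.2.1.symm h1.2.2.symm]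
    rw [← this]; simp [← mul_assoc]

theorem cycleLengths_sumCongr (φ : Perm α) (ψ : Perm β) :
    cycleLengths (Perm.sumCongr φ ψ) = cycleLengths φ + cycleLengths ψ := by
  classical
  have h1 : (Perm.sumCongr φ (1 : Perm β)).cycleType = φ.cycleType := by
    rw [← cycleType_extendDomain (Equiv.ofInjective (Sum.inl : α → α ⊕ β) Sum.inl_injective)]
    congr 1
    ext x
    rcases x with x | x
    · exact (extendDomain_apply_image φ (Equiv.ofInjective (Sum.inl : α → α ⊕ β)
        Sum.inl_injective) x).symm
    · rw [extendDomain_apply_not_subtype _ _ (by simp)]; rfl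
  have h2 : (Perm.sumCongr (1 : Perm α) ψ).cycleType = ψ.cycleType := by
    rw [← cycleType_extendDomain (Equiv.ofInjective (Sum.inr : β → α ⊕ β) Sum.inr_injective)]
    congr 1
    ext x
    rcases x with x | x
    · rw [extendDomain_apply_not_subtype _ _ (by simp)]; rfl
    · exact (extendDomain_apply_image ψ (Equiv.ofInjective (Sum.inr : β → α ⊕ β)
        Sum.inr_injective) x).symm
  have hd : Disjoint (Perm.sumCongr φ (1 : Perm β)) (Perm.sumCongr (1 : Perm α) ψ) := by
    rintro (x | x)
    · exact Or.inr rfl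
    · exact Or.inl rfl
  have h3 : Perm.sumCongr φ ψ = Perm.sumCongr φ 1 * Perm.sumCongr 1 ψ := by
    rw [Perm.sumCongr_mul]; simp
  refine cycleLengths_eq_of_cycleType _ ?_ ?_ ?_
  · simp [zero_notMem_cycleLengths]
  · simp [sum_cycleLengths]
  · rw [h3, hd.cycleType_mul, h1, h2, Multiset.filter_add, filter_cycleLengths,
      filter_cycleLengths]

theorem cycleLengths_one : cycleLengths (1 : Perm α) = Multiset.replicate (Fintype.card α) 1 := by
  simp [cycleLengths_eq]

theorem cycleLengths_optionCongr (τ : Perm α) :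
    cycleLengths (optionCongr τ : Perm (Option α)) = 1 ::ₘ cycleLengths τ := by
  have : (optionCongr τ : Perm (Option α)) = (optionEquivSumPUnit.{0} α).symm.permCongr
      (Perm.sumCongr τ 1) := by
    ext x; rcases x with _ | x <;> simp [Equiv.permCongr_apply]
  rw [this, cycleLengths_permCongr, cycleLengths_sumCongr, cycleLengths_one, add_comm]
  rfl

end CycleLengths

/-! ### Deletion of an edge from a factorization -/

section CutJoin

open Equiv Equiv.Perm

set_option linter.unusedSectionVars false

variable {α β : Type*} [Fintype α] [DecidableEq α] [Fintype β] [DecidableEq β]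

/-- The transposition inserts `none` into the cycle of `j`, just before `j`. Only for `j = none` is
a new cycle created. -/
theorem card_cycleLengths_swap_mul (j : Option β) (τ : Perm β) :
    (cycleLengths (swap none j * optionCongr τ : Perm (Option β))).card =
      (cycleLengths τ).card + if j = none then 1 else 0 := by
  rcases j with _ | j
  · rw [swap_self, if_pos rfl]
    exact (congrArg Multiset.card (cycleLengths_optionCongr τ)).trans (by simp)
  · obtain ⟨l, ψ, hnd, hφ, hfix, -, hmv, hfix'⟩ :=
      exists_formPerm_mul (optionCongr τ : Perm (Option β)) (some j)
    have hnl : none ∉ some j :: l := by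
      intro hn
      have h1 : none ∈ l := by simpa using hn
      exact hmv none h1 rfl
    have h1 : (swap none (some j) * optionCongr τ : Perm (Option β)) =
        (none :: some j :: l).formPerm * ψ := by
      rw [hφ, List.formPerm_cons_cons, mul_assoc]
    have hnd' : (none :: some j :: l).Nodup := List.nodup_cons.mpr ⟨hnl, hnd⟩
    obtain ⟨μ, h0, hψ, hμ, hψ1⟩ := cycleLengths_formPerm_mul hnd' (by simp) (ψ := ψ) (by
      intro y hy
      rcases List.mem_cons.mp hy with rfl | hy
      · exact hfix' none rfl
      · exact hfix y hy)
    obtain ⟨μ', h0', hψ', hμ', hψ1'⟩ := cycleLengths_formPerm_mul hnd (by simp) hfix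
    have h2 := cycleLengths_optionCongr τ
    rw [hφ, hμ'] at h2
    rw [h1, hμ, if_neg (by simp)]
    have h3 := congrArg Multiset.card h2
    have h4 := congrArg Multiset.card (hψ1.symm.trans hψ1')
    simp at h3 h4 ⊢
    omega

variable {A : Type*} [CommRing A]

/-- The weighted number of factorizations `φ = σ * (σ⁻¹ * φ)`. -/
def factSum (s u v : A) (φ : Perm α) : A :=
  ∑ σ : Perm α, s ^ Fintype.card α *
    (u ^ (cycleLengths σ).card * v ^ (cycleLengths (σ⁻¹ * φ)).card)

/-- Deletion of the point `none` from `φ`, with `i` the image of `none` under the first factor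
of a factorization of `φ`. -/
def deleteNone (φ : Perm (Option β)) (i : Option β) : Perm β :=
  removeNone (swap none i * swap (φ none) i * φ : Perm (Option β))

theorem optionCongr_deleteNone (φ : Perm (Option β)) (i : Option β) :
    (optionCongr (deleteNone φ i) : Perm (Option β)) = swap none i * swap (φ none) i * φ := by
  have h : (swap none i * swap (φ none) i * φ : Perm (Option β)) none = none := by simp
  have := map_equiv_removeNone (swap none i * swap (φ none) i * φ : Perm (Option β))
  rw [h, swap_self] at this
  exact this

/-- A permutation of `Option β` is determined by the image `i` of `none` and by what remains when
`none` is removed. Removing `none` from both factors leaves a factorization of `deleteNone φ i`,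
which depends on the first factor only through `i`. A black vertex is lost when `i = none`, a white
one when `i = φ none`. -/
theorem factSum_option (s u v : A) (φ : Perm (Option β)) : factSum s u v φ =
    ∑ i : Option β, s * ((if i = none then u else 1) * (if i = φ none then v else 1)) *
      factSum s u v (deleteNone φ i) := by
  unfold factSum
  rw [← Equiv.sum_comp (decomposeOption (α := β)).symm, Fintype.sum_prod_type]
  refine Finset.sum_congr rfl fun i _ => ?_
  rw [Finset.mul_sum]
  refine Finset.sum_congr rfl fun σ _ => ?_
  have h1 : decomposeOption.symm (i, σ) = swap none i * optionCongr σ := rfl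
  -- Up to conjugation the second factor is that of the smaller factorization with `none` inserted
  -- before the point `swap none i (φ none)`.
  have h2 : cycleLengths ((swap none i * optionCongr σ : Perm (Option β))⁻¹ * φ) =
      cycleLengths (swap none (swap none i (φ none)) *
        optionCongr (deleteNone φ i * σ⁻¹) : Perm (Option β)) := by
    have e1 : (optionCongr (deleteNone φ i * σ⁻¹) : Perm (Option β)) =
        optionCongr (deleteNone φ i) * (optionCongr σ : Perm (Option β))⁻¹ := by
      ext x; rcases x with _ | x <;> rfl
    have e2 : φ = swap (φ none) i * swap none i * optionCongr (deleteNone φ i) := by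
      rw [optionCongr_deleteNone]; simp [mul_assoc]
    have e3 : swap none (swap none i (φ none)) =
        swap none i * swap (φ none) i * swap none i := by
      have := Equiv.swap_apply_apply (swap none i) (φ none) i
      rw [swap_apply_right, swap_inv] at this
      rw [← this, swap_comm]
    rw [e1, e3, ← mul_assoc, cycleLengths_mul_comm _ (optionCongr σ : Perm (Option β))⁻¹]
    conv_lhs => rw [e2]
    simp [mul_assoc]
  have h3 : swap none i (φ none) = none ↔ i = φ none := by
    rw [← Equiv.eq_symm_apply, symm_swap, swap_apply_left]
    exact eq_comm
  rw [h1, card_cycleLengths_swap_mul, h2, card_cycleLengths_swap_mul, Fintype.card_option,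
    cycleLengths_mul_comm]
  simp only [h3]
  split_ifs <;> ring

theorem factSum_permCongr (s u v : A) (e : α ≃ β) (φ : Perm α) :
    factSum s u v (e.permCongr φ) = factSum s u v φ := by
  unfold factSum
  rw [← Equiv.sum_comp e.permCongr, Fintype.card_congr e]
  refine Finset.sum_congr rfl fun σ _ => ?_
  have : (e.permCongr σ)⁻¹ * e.permCongr φ = e.permCongr (σ⁻¹ * φ) := by
    rw [inv_mul_eq_iff_eq_mul]
    ext x; simp [Equiv.permCongr_apply, Perm.mul_apply]
  rw [this, cycleLengths_permCongr, cycleLengths_permCongr]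

theorem factSum_eq_of_cycleLengths_eq (s u v : A) {φ : Perm α} {ψ : Perm β}
    (h : cycleLengths φ = cycleLengths ψ) : factSum s u v φ = factSum s u v ψ := by
  obtain ⟨e, rfl⟩ := exists_permCongr_eq h
  exact (factSum_permCongr s u v e φ).symm

theorem exists_cycleLengths_eq {μ : Multiset ℕ} (h0 : 0 ∉ μ) :
    ∃ φ : Perm (Fin μ.sum), cycleLengths φ = μ := by
  have hle : (μ.filter (2 ≤ ·)).sum ≤ μ.sum := by
    conv_rhs => rw [← Multiset.filter_add_not (2 ≤ ·) μ, Multiset.sum_add]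
    exact Nat.le_add_right _ _
  obtain ⟨φ, hφ⟩ := (exists_with_cycleType_iff (Fin μ.sum) (m := μ.filter (2 ≤ ·))).mpr
    ⟨by simpa using hle, fun a ha => (Multiset.mem_filter.mp ha).2⟩
  exact ⟨φ, cycleLengths_eq_of_cycleType φ h0 (by simp) hφ⟩

open scoped Classical in
/-- `factSum` as a function of the cycle lengths. -/
noncomputable def factSumOf (s u v : A) (μ : Multiset ℕ) : A :=
  if h : ∃ φ : Perm (Fin μ.sum), cycleLengths φ = μ then factSum s u v h.choose else 0

theorem factSumOf_cycleLengths (s u v : A) (φ : Perm α) :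
    factSumOf s u v (cycleLengths φ) = factSum s u v φ := by
  have h := exists_cycleLengths_eq (zero_notMem_cycleLengths φ)
  rw [factSumOf, dif_pos h]
  exact factSum_eq_of_cycleLengths_eq s u v h.choose_spec

/-- This default value lets the recursion be written without boundary cases: terms with a cycle of
length 0 vanish. -/
theorem factSumOf_of_zero_mem (s u v : A) {μ : Multiset ℕ} (h : 0 ∈ μ) :
    factSumOf s u v μ = 0 := by
  rw [factSumOf, dif_neg]
  rintro ⟨φ, hφ⟩
  exact zero_notMem_cycleLengths φ (by rw [hφ]; exact h)

theorem factSumOf_zero (s u v : A) : factSumOf s u v 0 = 1 := by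
  have h : cycleLengths (1 : Perm (Fin 0)) = 0 := by simp [cycleLengths_one]
  rw [← h, factSumOf_cycleLengths, factSum]
  simp [cycleLengths_eq]

end CutJoin

/-! ### Cut-and-join recursion for all factorizations -/

section CutJoinMultiset

open Equiv Equiv.Perm

set_option linter.unusedSectionVars false

variable {β : Type*} [Fintype β] [DecidableEq β] {A : Type*} [CommRing A]

theorem cycleLengths_deleteNone {φ : Perm (Option β)} {i : Option β} {ν : Multiset ℕ}
    (h0 : 0 ∉ ν) (hs : ν.sum = Fintype.card β)
    (hc : (swap none i * swap (φ none) i * φ).cycleType = ν.filter (2 ≤ ·)) :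
    cycleLengths (deleteNone φ i) = ν := by
  refine cycleLengths_eq_of_cycleType _ h0 hs ?_
  rw [← hc, ← optionCongr_deleteNone, ← filter_cycleLengths, ← filter_cycleLengths,
    cycleLengths_optionCongr]
  simp

theorem filter_cons_two_le (a : ℕ) (μ : Multiset ℕ) : (a ::ₘ μ).filter (2 ≤ ·) =
    ({a} : Multiset ℕ).filter (2 ≤ ·) + μ.filter (2 ≤ ·) := by
  rw [← Multiset.singleton_add, Multiset.filter_add]

section Delete

variable {l : List (Option β)} {ψ : Perm (Option β)} {μ : Multiset ℕ}

theorem filter_eq_of_cycleLengths_eq {k : ℕ} (hμ : cycleLengths ψ = Multiset.replicate k 1 + μ) :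
    ψ.cycleType = μ.filter (2 ≤ ·) := by
  rw [← filter_cycleLengths, hμ, Multiset.filter_add, Multiset.filter_eq_nil.mpr, zero_add]
  intro a ha
  rw [Multiset.eq_of_mem_replicate ha]; norm_num

theorem sum_eq_of_cycleLengths_eq {k : ℕ}
    (hμ : cycleLengths ψ = Multiset.replicate (k + 1) 1 + μ) : k + μ.sum = Fintype.card β := by
  have := sum_cycleLengths ψ
  rw [hμ] at this
  simp at this
  omega

theorem zero_notMem_of_cycleLengths_eq {k : ℕ}
    (hμ : cycleLengths ψ = Multiset.replicate k 1 + μ) : 0 ∉ μ := fun h =>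
  zero_notMem_cycleLengths ψ (hμ ▸ Multiset.mem_add.mpr (Or.inr h))

/-- For these two values of `i` the transpositions only take `none` out of its cycle. -/
theorem cycleLengths_deleteNone_shorten {f : Option β} (hnd : (none :: f :: l).Nodup)
    (hfix : ∀ y ∈ none :: f :: l, ψ y = y)
    (hμ : cycleLengths ψ = Multiset.replicate (l.length + 2) 1 + μ) {i : Option β}
    (hi : i = none ∨ i = f) :
    cycleLengths (deleteNone ((none :: f :: l).formPerm * ψ) i) = (l.length + 1) ::ₘ μ := by
  have hf : ((none :: f :: l).formPerm * ψ) none = f := by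
    rw [Perm.mul_apply, hfix none (by simp), List.formPerm_apply_head _ _ _ hnd]
  have hχ : swap none i * swap (((none :: f :: l).formPerm * ψ) none) i *
      ((none :: f :: l).formPerm * ψ) = (f :: l).formPerm * ψ := by
    rw [hf, List.formPerm_cons_cons]
    rcases hi with rfl | rfl
    · rw [swap_self, swap_comm f none, ← mul_assoc, ← mul_assoc]
      ext x; simp [Perm.mul_apply]
    · rw [swap_self, ← mul_assoc, ← mul_assoc]
      ext x; simp [Perm.mul_apply]
  refine cycleLengths_deleteNone ?_ ?_ ?_
  · simpa using zero_notMem_of_cycleLengths_eq hμ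
  · simpa using sum_eq_of_cycleLengths_eq hμ
  · rw [hχ, cycleType_formPerm_mul (List.nodup_cons.mp hnd).2
      (fun y hy => hfix y (List.mem_cons_of_mem _ hy)), filter_eq_of_cycleLengths_eq hμ,
      filter_cons_two_le, List.length_cons]

theorem swap_mul_swap_mul_swap_eq {α : Type*} [DecidableEq α] {e f i : α} (h1 : e ≠ f) (h2 : e ≠ i) :
    swap e i * swap f i * swap e f = swap f i := by
  have := Equiv.swap_apply_apply (swap f i) e i
  rw [swap_apply_right, swap_apply_of_ne_of_ne h1 h2, swap_inv] at this
  have h3 := Equiv.swap_apply_apply (swap f i) e f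
  rw [swap_apply_left, swap_apply_of_ne_of_ne h1 h2, swap_inv] at h3
  rw [h3]
  simp only [mul_assoc, swap_mul_self, mul_one]

/-- Here `i` lies on the cycle of `none`, away from `none` and its image. Once `none` is taken out,
the remaining transposition cuts the rest of the cycle in two. -/
theorem cycleLengths_deleteNone_cut {f i : Option β} {l₁ l₂ : List (Option β)}
    (hnd : (none :: f :: (l₁ ++ i :: l₂)).Nodup)
    (hfix : ∀ y ∈ none :: f :: (l₁ ++ i :: l₂), ψ y = y)
    (hμ : cycleLengths ψ = Multiset.replicate (l₁.length + l₂.length + 3) 1 + μ) :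
    cycleLengths (deleteNone ((none :: f :: (l₁ ++ i :: l₂)).formPerm * ψ) i) =
      (l₁.length + 1) ::ₘ (l₂.length + 1) ::ₘ μ := by
  have hf : ((none :: f :: (l₁ ++ i :: l₂)).formPerm * ψ) none = f := by
    rw [Perm.mul_apply, hfix none (by simp), List.formPerm_apply_head _ _ _ hnd]
  have hnd2 := (List.nodup_cons.mp hnd).2
  have hnd3 : (f :: l₁).Nodup ∧ (i :: l₂).Nodup ∧ (f :: l₁).Disjoint (i :: l₂) := by
    rw [← List.cons_append] at hnd2
    exact List.nodup_append'.mp hnd2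
  have hne : none ≠ f ∧ none ≠ i := by
    have := (List.nodup_cons.mp hnd).1
    simp only [List.mem_cons, List.mem_append, not_or] at this
    tauto
  have hχ : swap none i * swap (((none :: f :: (l₁ ++ i :: l₂)).formPerm * ψ) none) i *
      ((none :: f :: (l₁ ++ i :: l₂)).formPerm * ψ) =
        (f :: l₁).formPerm * ((i :: l₂).formPerm * ψ) := by
    rw [hf, List.formPerm_cons_cons, formPerm_cons_append_cons hnd2]
    have : swap none i * swap f i * (swap none f * (swap f i *
        ((f :: l₁).formPerm * (i :: l₂).formPerm)) * ψ) = (swap none i * swap f i * swap none f) *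
        swap f i * ((f :: l₁).formPerm * ((i :: l₂).formPerm * ψ)) := by simp only [mul_assoc]
    rw [this, swap_mul_swap_mul_swap_eq hne.1 hne.2, swap_mul_self, one_mul]
  refine cycleLengths_deleteNone ?_ ?_ ?_
  · simpa using zero_notMem_of_cycleLengths_eq hμ
  · have := sum_eq_of_cycleLengths_eq hμ
    simp; omega
  · rw [hχ, cycleType_formPerm_mul hnd3.1, cycleType_formPerm_mul hnd3.2.1,
      filter_eq_of_cycleLengths_eq hμ, filter_cons_two_le, filter_cons_two_le _ μ,
      List.length_cons, List.length_cons]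
    · intro y hy; exact hfix y (by simp at hy ⊢; tauto)
    · intro y hy
      rw [Perm.mul_apply, hfix y (by simp at hy ⊢; tauto)]
      exact List.formPerm_apply_of_notMem (fun h => hnd3.2.2 hy h)

/-- Here `i` lies on another cycle, which is merged with what remains of the cycle of `none`. -/
theorem cycleLengths_deleteNone_join (hnd : (none :: l).Nodup)
    (hfix : ∀ y ∈ none :: l, ψ y = y)
    (hμ : cycleLengths ψ = Multiset.replicate (l.length + 1) 1 + μ) {i : Option β}
    (hi : i ∉ none :: l) :
    cycleLengthAt ψ i ∈ μ ∧ cycleLengths (deleteNone ((none :: l).formPerm * ψ) i) =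
      (l.length + cycleLengthAt ψ i) ::ₘ μ.erase (cycleLengthAt ψ i) := by
  obtain ⟨l', ψ', hnd', hψ, hfix', hlen, hmv, hfix2⟩ := exists_formPerm_mul ψ i
  have h0 := zero_notMem_of_cycleLengths_eq hμ
  have hsum := sum_eq_of_cycleLengths_eq hμ
  have hdisj : (none :: l).Disjoint (i :: l') := by
    intro y hy hy'
    rcases List.mem_cons.mp hy' with rfl | hy'
    · exact hi hy
    · exact hmv y hy' (hfix y hy)
  have hall : ∀ y ∈ (none :: l) ++ (i :: l'), ψ' y = y := by
    intro y hy
    rcases List.mem_append.mp hy with hy | hy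
    · exact hfix2 y (hfix y hy)
    · exact hfix' y hy
  have hndall : ((none :: l) ++ (i :: l')).Nodup := List.nodup_append'.mpr ⟨hnd, hnd', hdisj⟩
  obtain ⟨ν', hν0', -, -, hν2'⟩ := cycleLengths_formPerm_mul hndall (by simp) hall
  obtain ⟨ν, hν0, hν1, hν, hν2⟩ := cycleLengths_formPerm_mul hnd' (by simp) hfix'
  have hνν : ν = Multiset.replicate (l.length + 1) 1 + ν' := by
    have := hν2.symm.trans hν2'
    rw [List.length_append, add_comm (none :: l).length, Multiset.replicate_add, add_assoc] at this
    exact add_left_cancel this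
  rw [← hψ, hμ, hνν, List.length_cons] at hν
  have hμν : μ = (l'.length + 1) ::ₘ ν' := by
    rw [← Multiset.singleton_add, add_left_comm, Multiset.singleton_add] at hν
    exact add_left_cancel hν
  have hct : ψ'.cycleType = ν'.filter (2 ≤ ·) := by
    rw [hν1, hνν, Multiset.filter_add, Multiset.filter_eq_nil.mpr, zero_add]
    intro a ha
    rw [Multiset.eq_of_mem_replicate ha]; norm_num
  subst hμν
  rw [hlen]
  refine ⟨Multiset.mem_cons_self _ _, ?_⟩
  rw [Multiset.erase_cons_head]
  have h0' : 0 ∉ ν' := fun h => h0 (Multiset.mem_cons_of_mem h)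
  refine cycleLengths_deleteNone ?_ ?_ ?_
  · simpa using h0'
  · rw [← hsum]; simp [add_assoc]
  cases l with
  | nil =>
    have : swap none i * swap ((([none] : List (Option β)).formPerm * ψ) none) i *
      (([none] : List (Option β)).formPerm * ψ) = ψ := by
      rw [List.formPerm_singleton, one_mul, hfix none (by simp), swap_mul_self, one_mul]
    rw [this, hψ, cycleType_formPerm_mul hnd' hfix', hct, filter_cons_two_le]
    simp
  | cons f l =>
    have hf : ((none :: f :: l).formPerm * ψ) none = f := by
      rw [Perm.mul_apply, hfix none (by simp), List.formPerm_apply_head _ _ _ hnd]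
    have hne : none ≠ f ∧ none ≠ i := by
      have := (List.nodup_cons.mp hnd).1
      simp only [List.mem_cons, not_or] at this hi
      exact ⟨this.1, Ne.symm hi.1⟩
    have hnd2 : (f :: (l ++ i :: l')).Nodup := by
      simpa using (List.nodup_cons.mp hndall).2
    have hχ : swap none i * swap (((none :: f :: l).formPerm * ψ) none) i *
        ((none :: f :: l).formPerm * ψ) = (f :: (l ++ i :: l')).formPerm * ψ' := by
      rw [hf, List.formPerm_cons_cons, formPerm_cons_append_cons hnd2, hψ]
      conv_rhs => rw [← swap_mul_swap_mul_swap_eq hne.1 hne.2]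
      simp only [mul_assoc]
    rw [hχ, cycleType_formPerm_mul hnd2, hct, filter_cons_two_le]
    · simp [add_comm, add_left_comm]
    · intro y hy
      exact hall y (by simp at hy ⊢; tauto)

end Delete

/-- Since `factSumOf` depends only on the cycle lengths, the recursion can be checked on this model,
where the point `none` to be deleted lies on the distinguished cycle. -/
theorem exists_formPerm_mul_with_cycleLengths (m : ℕ) {μ : Multiset ℕ} (h0 : 0 ∉ μ) :
    ∃ (l : List (Option (Fin m ⊕ Fin μ.sum))) (ψ : Perm (Option (Fin m ⊕ Fin μ.sum))),
      l.length = m ∧ (none :: l).Nodup ∧ (∀ y ∈ none :: l, ψ y = y) ∧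
      cycleLengths ψ = Multiset.replicate (m + 1) 1 + μ ∧
      cycleLengths ((none :: l).formPerm * ψ) = (m + 1) ::ₘ μ := by
  obtain ⟨ψ₀, hψ₀⟩ := exists_cycleLengths_eq h0
  let l : List (Option (Fin m ⊕ Fin μ.sum)) := (List.finRange m).map (some ∘ Sum.inl)
  let ψ : Perm (Option (Fin m ⊕ Fin μ.sum)) := optionCongr (Perm.sumCongr 1 ψ₀)
  have hlen : l.length = m := by simp [l]
  have hnd : (none :: l).Nodup := by
    refine List.nodup_cons.mpr ⟨by simp [l], ?_⟩
    exact (List.nodup_finRange m).map ((Option.some_injective _).comp Sum.inl_injective)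
  have hfix : ∀ y ∈ none :: l, ψ y = y := by
    intro y hy
    rcases List.mem_cons.mp hy with rfl | hy
    · rfl
    · obtain ⟨k, -, rfl⟩ := List.mem_map.mp hy
      rfl
  have hψ : cycleLengths ψ = Multiset.replicate (m + 1) 1 + μ := by
    rw [cycleLengths_optionCongr, cycleLengths_sumCongr, hψ₀, cycleLengths_one]
    simp
  refine ⟨l, ψ, hlen, hnd, hfix, hψ, ?_⟩
  obtain ⟨ν, -, -, h1, h2⟩ := cycleLengths_formPerm_mul hnd (by simp) hfix
  rw [hψ, List.length_cons, hlen] at h2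
  rw [h1, List.length_cons, hlen, add_left_cancel h2]

theorem List.sum_map_eq_sum_range_split {α A : Type*} [AddCommMonoid A] (l : List α) (F : α → A)
    (G : ℕ → ℕ → A) (h : ∀ l₁ i l₂, l = l₁ ++ i :: l₂ → F i = G l₁.length l₂.length) :
    (l.map F).sum = ∑ k ∈ Finset.range l.length, G k (l.length - 1 - k) := by
  induction l generalizing G with
  | nil => simp
  | cons a l ih =>
    rw [List.map_cons, List.sum_cons, ih (fun j k => G (j + 1) k), List.length_cons,
      Finset.sum_range_succ', h [] a l rfl, add_comm]
    · congr 1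
      refine Finset.sum_congr rfl fun k hk => ?_
      congr 1
      omega
    · intro l₁ i l₂ hl
      simpa using h (a :: l₁) i l₂ (by rw [hl]; rfl)

/-- The terms come from the possible positions of `i` in `factSum_option`. The points `none` and `φ
none` give the weights u and v (both at once if `m = 0`), the other points of the distinguished
cycle cut it, and the a points of any other cycle of length a join it. -/
theorem factSumOf_succ_cons_of_notMem (s u v : A) (m : ℕ) {μ : Multiset ℕ} (h0 : 0 ∉ μ) :
    factSumOf s u v ((m + 1) ::ₘ μ) = s * ((if m = 0 then u * v * factSumOf s u v μ else 0) +
      (u + v) * factSumOf s u v (m ::ₘ μ) +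
      (μ.map fun a => a • factSumOf s u v ((m + a) ::ₘ μ.erase a)).sum +
      ∑ p ∈ Finset.HasAntidiagonal.antidiagonal m, factSumOf s u v (p.1 ::ₘ p.2 ::ₘ μ)) := by
  obtain ⟨l, ψ, hlen, hnd, hfix, hψ, hφ⟩ := exists_formPerm_mul_with_cycleLengths m h0
  rw [← hφ, factSumOf_cycleLengths, factSum_option]
  have hdel : ∀ i, factSum s u v (deleteNone ((none :: l).formPerm * ψ) i) =
      factSumOf s u v (cycleLengths (deleteNone ((none :: l).formPerm * ψ) i)) := fun i =>
    (factSumOf_cycleLengths s u v _).symm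
  simp only [hdel]
  have hφn : ∀ i ∉ none :: l, i ≠ none ∧ i ≠ ((none :: l).formPerm * ψ) none := by
    intro i hi
    refine ⟨fun h => hi (by simp [h]), fun h => hi ?_⟩
    rw [h, Perm.mul_apply, hfix none (by simp)]
    exact List.formPerm_apply_mem_of_mem (by simp)
  let G : ℕ → A := fun a => s * factSumOf s u v ((m + a) ::ₘ μ.erase a)
  have hcompl : ∑ i ∈ (none :: l).toFinsetᶜ, s * ((if i = none then u else 1) *
      (if i = ((none :: l).formPerm * ψ) none then v else 1)) *
      factSumOf s u v (cycleLengths (deleteNone ((none :: l).formPerm * ψ) i)) =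
        s * (μ.map fun a => a • factSumOf s u v ((m + a) ::ₘ μ.erase a)).sum := by
    have h1 : ∀ i ∈ (none :: l).toFinsetᶜ, s * ((if i = none then u else 1) *
      (if i = ((none :: l).formPerm * ψ) none then v else 1)) *
      factSumOf s u v (cycleLengths (deleteNone ((none :: l).formPerm * ψ) i)) =
        G (cycleLengthAt ψ i) := by
      intro i hi
      rw [Finset.mem_compl, List.mem_toFinset] at hi
      rw [if_neg (hφn i hi).1, if_neg (hφn i hi).2,
        (cycleLengths_deleteNone_join hnd hfix (by rw [hlen]; exact hψ) hi).2, hlen]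
      simp [G]
    rw [Finset.sum_congr rfl h1]
    -- The points of `none :: l` are fixed by `ψ`. They give `m + 1` equal terms on both sides, and
    -- cancelling these leaves the sum over `μ`.
    have h2 := sum_cycleLengthAt ψ G
    rw [hψ, Multiset.map_add, Multiset.sum_add, ← Finset.sum_add_sum_compl (none :: l).toFinset]
      at h2
    have h3 : ∑ i ∈ (none :: l).toFinset, G (cycleLengthAt ψ i) = (m + 1) • G 1 := by
      rw [Finset.sum_congr rfl (g := fun _ => G 1), Finset.sum_const,
        List.toFinset_card_of_nodup hnd, List.length_cons, hlen]
      intro i hi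
      rw [cycleLengthAt, if_pos (hfix i (List.mem_toFinset.mp hi))]
    rw [h3] at h2
    simp only [Multiset.map_replicate, one_smul, Multiset.sum_replicate] at h2
    rw [add_left_cancel h2, ← Multiset.sum_map_mul_left]
    simp only [G, mul_smul_comm]
  rw [← Finset.sum_add_sum_compl (none :: l).toFinset, hcompl, List.sum_toFinset _ hnd]
  cases l with
  | nil =>
    obtain rfl : m = 0 := hlen.symm
    have : cycleLengths (deleteNone ψ none) = μ := by
      refine cycleLengths_deleteNone h0 ?_ ?_
      · simp
      · rw [hfix none (by simp), swap_mul_self, one_mul]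
        exact filter_eq_of_cycleLengths_eq hψ
    simp [this, factSumOf_of_zero_mem, hfix none]
    ring
  | cons f l =>
    have hf : ((none :: f :: l).formPerm * ψ) none = f := by
      rw [Perm.mul_apply, hfix none (by simp), List.formPerm_apply_head _ _ _ hnd]
    have hne : none ≠ f := by
      have := (List.nodup_cons.mp hnd).1
      simp only [List.mem_cons, not_or] at this
      exact this.1
    obtain ⟨k, rfl⟩ : ∃ k, m = k + 1 := ⟨l.length, hlen.symm⟩
    have hk : l.length = k := by simpa using hlen
    have hψ' : cycleLengths ψ = Multiset.replicate (l.length + 2) 1 + μ := by rw [hψ, hk]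
    rw [hf, List.map_cons, List.sum_cons, List.map_cons, List.sum_cons,
      cycleLengths_deleteNone_shorten hnd hfix hψ' (Or.inl rfl),
      cycleLengths_deleteNone_shorten hnd hfix hψ' (Or.inr rfl),
      List.sum_map_eq_sum_range_split l _
        (fun i j => s * factSumOf s u v ((i + 1) ::ₘ (j + 1) ::ₘ μ)), hk]
    -- The two ends of the antidiagonal contain a cycle of length 0 and vanish.
    · rw [Finset.Nat.sum_antidiagonal_eq_sum_range_succ_mk, Finset.sum_range_succ,
        Finset.sum_range_succ', factSumOf_of_zero_mem (μ := _ ::ₘ _ ::ₘ μ) _ _ _ (by simp),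
        factSumOf_of_zero_mem (μ := _ ::ₘ _ ::ₘ μ) _ _ _ (by simp),
        if_pos rfl, if_neg hne, if_neg hne.symm, if_pos rfl, if_neg (by omega)]
      have : ∑ i ∈ Finset.range k,
          s * factSumOf s u v ((i + 1) ::ₘ (k - 1 - i + 1) ::ₘ μ) =
          s * ∑ i ∈ Finset.range k,
            factSumOf s u v ((i + 1) ::ₘ (k + 1 - (i + 1)) ::ₘ μ) := by
        rw [Finset.mul_sum]
        refine Finset.sum_congr rfl fun i hi => ?_
        rw [Finset.mem_range] at hi
        congr 4
        omega
      rw [this]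
      ring
    · intro l₁ i l₂ hl
      subst hl
      have hi : i ≠ none ∧ i ≠ f := by
        simp only [List.nodup_cons, List.mem_cons, List.mem_append, not_or] at hnd
        tauto
      have e : l₁.length + l₂.length + 3 = k + 1 + 1 := by simp at hk; omega
      rw [if_neg hi.1, if_neg hi.2, cycleLengths_deleteNone_cut (μ := μ) hnd hfix (by rw [hψ, e])]
      ring

theorem factSumOf_succ_cons (s u v : A) (m : ℕ) (μ : Multiset ℕ) :
    factSumOf s u v ((m + 1) ::ₘ μ) = s * ((if m = 0 then u * v * factSumOf s u v μ else 0) +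
      (u + v) * factSumOf s u v (m ::ₘ μ) +
      (μ.map fun a => a • factSumOf s u v ((m + a) ::ₘ μ.erase a)).sum +
      ∑ p ∈ Finset.HasAntidiagonal.antidiagonal m, factSumOf s u v (p.1 ::ₘ p.2 ::ₘ μ)) := by
  by_cases h0 : 0 ∈ μ
  · have h1 : (μ.map fun a => a • factSumOf s u v ((m + a) ::ₘ μ.erase a)).sum = 0 := by
      refine Multiset.sum_eq_zero fun x hx => ?_
      obtain ⟨a, -, rfl⟩ := Multiset.mem_map.mp hx
      rcases Nat.eq_zero_or_pos a with rfl | ha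
      · simp
      · rw [factSumOf_of_zero_mem, smul_zero]
        exact Multiset.mem_cons_of_mem ((Multiset.mem_erase_of_ne ha.ne).mpr h0)
    rw [h1, Finset.sum_eq_zero, factSumOf_of_zero_mem _ _ _ h0, factSumOf_of_zero_mem,
      factSumOf_of_zero_mem]
    · simp
    · exact Multiset.mem_cons_of_mem h0
    · exact Multiset.mem_cons_of_mem h0
    · intro p _
      exact factSumOf_of_zero_mem _ _ _ (Multiset.mem_cons_of_mem (Multiset.mem_cons_of_mem h0))
  · exact factSumOf_succ_cons_of_notMem s u v m h0

end CutJoinMultiset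

/-! ### Decomposition of a factorization into connected components -/

section Connected

open Equiv Equiv.Perm

set_option linter.unusedSectionVars false

variable {α β : Type*} [Fintype α] [DecidableEq α] [Fintype β] [DecidableEq β]
  {A : Type*} [CommRing A]

/-- The permutations `φ` and `σ` have no proper nonempty common invariant set. -/
def JointlyTransitive (φ σ : Perm α) : Prop :=
  ∀ O : Finset α, O.Nonempty → (∀ x, φ x ∈ O ↔ x ∈ O) → (∀ x, σ x ∈ O ↔ x ∈ O) → O = Finset.univ

theorem jointlyTransitive_permCongr (e : α ≃ β) (φ σ : Perm α) :
    JointlyTransitive (e.permCongr φ) (e.permCongr σ) ↔ JointlyTransitive φ σ := by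
  constructor
  · intro h O hO h1 h2
    have h3 := h (O.map e.toEmbedding) (hO.map)
      (fun x => by simpa [Finset.mem_map_equiv, Equiv.permCongr_apply] using h1 (e.symm x))
      (fun x => by simpa [Finset.mem_map_equiv, Equiv.permCongr_apply] using h2 (e.symm x))
    ext x
    have : e x ∈ O.map e.toEmbedding := h3 ▸ Finset.mem_univ _
    simpa using this
  · intro h O hO h1 h2
    have h3 := h (O.map e.symm.toEmbedding) (hO.map)
      (fun x => by simpa [Finset.mem_map_equiv, Equiv.permCongr_apply] using h1 (e x))
      (fun x => by simpa [Finset.mem_map_equiv, Equiv.permCongr_apply] using h2 (e x))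
    ext x
    have : e.symm x ∈ O.map e.symm.toEmbedding := h3 ▸ Finset.mem_univ _
    simpa using this

open scoped Classical in
/-- The weighted number of factorizations `φ = σ * (σ⁻¹ * φ)` with transitive `⟨φ, σ⟩`. -/
noncomputable def connSum (s u v : A) (φ : Perm α) : A :=
  ∑ σ : Perm α, if JointlyTransitive φ σ then s ^ Fintype.card α *
    (u ^ (cycleLengths σ).card * v ^ (cycleLengths (σ⁻¹ * φ)).card) else 0

theorem permCongr_inv_mul (e : α ≃ β) (σ φ : Perm α) :
    (e.permCongr σ)⁻¹ * e.permCongr φ = e.permCongr (σ⁻¹ * φ) := by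
  rw [inv_mul_eq_iff_eq_mul]
  ext x; simp [Equiv.permCongr_apply, Perm.mul_apply]

theorem permCongr_eq_of_semiconj {α β : Type*} {e : α ≃ β} {φ : Perm α} {ψ : Perm β}
    (h : ∀ x, e (φ x) = ψ (e x)) : e.permCongr φ = ψ := by
  ext1 x
  rw [Equiv.permCongr_apply, h, Equiv.apply_symm_apply]

theorem connSum_permCongr (s u v : A) (e : α ≃ β) (φ : Perm α) :
    connSum s u v (e.permCongr φ) = connSum s u v φ := by
  unfold connSum
  rw [← Equiv.sum_comp e.permCongr, Fintype.card_congr e]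
  refine Finset.sum_congr rfl fun σ _ => ?_
  rw [permCongr_inv_mul, cycleLengths_permCongr, cycleLengths_permCongr,
    jointlyTransitive_permCongr]

theorem connSum_eq_of_cycleLengths_eq (s u v : A) {φ : Perm α} {ψ : Perm β}
    (h : cycleLengths φ = cycleLengths ψ) : connSum s u v φ = connSum s u v ψ := by
  obtain ⟨e, rfl⟩ := exists_permCongr_eq h
  exact (connSum_permCongr s u v e φ).symm

open scoped Classical in
/-- `connSum` as a function of the cycle lengths. -/
noncomputable def connSumOf (s u v : A) (μ : Multiset ℕ) : A :=
  if h : ∃ φ : Perm (Fin μ.sum), cycleLengths φ = μ then connSum s u v h.choose else 0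

theorem connSumOf_cycleLengths (s u v : A) (φ : Perm α) :
    connSumOf s u v (cycleLengths φ) = connSum s u v φ := by
  have h := exists_cycleLengths_eq (zero_notMem_cycleLengths φ)
  rw [connSumOf, dif_pos h]
  exact connSum_eq_of_cycleLengths_eq s u v h.choose_spec

theorem connSumOf_of_zero_mem (s u v : A) {μ : Multiset ℕ} (h : 0 ∈ μ) :
    connSumOf s u v μ = 0 := by
  rw [connSumOf, dif_neg]
  rintro ⟨φ, hφ⟩
  exact zero_notMem_cycleLengths φ (by rw [hφ]; exact h)

/-- The permutation that rotates each block `Fin (a i)`. -/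
def blockRotate {ι : Type*} (a : ι → ℕ) : Perm (Σ i, Fin (a i)) :=
  Perm.sigmaCongrRight fun i => finRotate (a i)

/-- A rotation is transitive on its block, so sets invariant under `blockRotate` are unions of
blocks. -/
theorem forall_of_finRotate_iff {n : ℕ} {P : Fin n → Prop} (h : ∀ x, P (finRotate n x) ↔ P x)
    (x y : Fin n) (hx : P x) : P y := by
  cases n with
  | zero => exact x.elim0
  | succ n =>
    have h0 : ∀ z, P z ↔ P 0 := by
      intro z
      induction z using Fin.induction with
      | zero => rfl
      | succ i ih =>
        rw [← ih, ← h i.castSucc, finRotate_apply, Fin.coeSucc_eq_succ]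
    exact (h0 y).mpr ((h0 x).mp hx)

theorem cycleLengths_finRotate {n : ℕ} (hn : 0 < n) : cycleLengths (finRotate n) = {n} := by
  refine cycleLengths_eq_of_cycleType _ ?_ ?_ ?_
  · simpa using hn.ne
  · simp
  · obtain _ | _ | n := n
    · omega
    · have : finRotate (0 + 1) = 1 := Equiv.ext fun x => Fin.ext (by omega)
      rw [this]; simp [Multiset.filter_singleton]
    · rw [cycleType_finRotate, Multiset.filter_singleton, if_pos (by omega)]

theorem cycleLengths_blockRotate {ι : Type*} [Fintype ι] [DecidableEq ι] {a : ι → ℕ}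
    (ha : ∀ i, 0 < a i) : cycleLengths (blockRotate a) = Finset.univ.val.map a := by
  have key : ∀ (n : ℕ) (a : Fin n → ℕ), (∀ i, 0 < a i) →
      cycleLengths (blockRotate a) = Finset.univ.val.map a := by
    intro n
    induction n with
    | zero => intro a _; simp [cycleLengths_eq, Subsingleton.elim (blockRotate a) 1]
    | succ n ih =>
      intro a ha
      let e : (Σ i, Fin (a i)) ≃ Fin (a 0) ⊕ Σ i : Fin n, Fin (a i.succ) :=
        { toFun := fun x => Fin.cases (motive := fun i => Fin (a i) → _) (fun y => Sum.inl y)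
            (fun i y => Sum.inr ⟨i, y⟩) x.1 x.2
          invFun := Sum.elim (fun y => ⟨0, y⟩) (fun y => ⟨y.1.succ, y.2⟩)
          left_inv := by rintro ⟨i, y⟩; induction i using Fin.cases <;> rfl
          right_inv := by rintro (y | ⟨i, y⟩) <;> rfl }
      have : blockRotate a = e.symm.permCongr (Perm.sumCongr (finRotate (a 0))
          (blockRotate fun i : Fin n => a i.succ)) := by
        ext1 ⟨i, y⟩
        induction i using Fin.cases <;> rfl
      rw [this, cycleLengths_permCongr, cycleLengths_sumCongr, ih _ fun i => ha i.succ,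
        cycleLengths_finRotate (ha 0), Fin.univ_succ]
      simp
      rfl
  let e := Fintype.equivFin ι
  have h := key _ (a ∘ e.symm) fun i => ha _
  have h2 : (Equiv.sigmaCongrLeft (β := fun i => Fin (a i)) e.symm).permCongr
      (blockRotate (a ∘ e.symm)) = blockRotate a := permCongr_eq_of_semiconj fun ⟨j, y⟩ => rfl
  rw [← h2, cycleLengths_permCongr, h, ← Multiset.map_map]
  congr 1
  have := congrArg Finset.val (Finset.map_univ_equiv e.symm)
  simp

section Decomposition

variable {ι : Type*} [Fintype ι] [DecidableEq ι] {a : ι → ℕ}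

/-- Splitting of the blocks along a set of indices. -/
def blockSplit (a : ι → ℕ) (S : Finset ι) :
    (Σ i : {i // i ∈ S}, Fin (a i)) ⊕ (Σ i : {i // i ∉ S}, Fin (a i)) ≃ Σ i, Fin (a i) where
  toFun := Sum.elim (fun x => ⟨x.1, x.2⟩) (fun x => ⟨x.1, x.2⟩)
  invFun x := if h : x.1 ∈ S then Sum.inl ⟨⟨x.1, h⟩, x.2⟩ else Sum.inr ⟨⟨x.1, h⟩, x.2⟩
  left_inv := by rintro (⟨⟨i, hi⟩, x⟩ | ⟨⟨i, hi⟩, x⟩) <;> simp [hi]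
  right_inv := by
    rintro ⟨i, x⟩
    by_cases h : i ∈ S <;> simp [h]

theorem blockSplit_permCongr_blockRotate (S : Finset ι) :
    (blockSplit a S).permCongr (Perm.sumCongr (blockRotate fun i : {i // i ∈ S} => a i)
      (blockRotate fun i : {i // i ∉ S} => a i)) = blockRotate a :=
  permCongr_eq_of_semiconj fun x => by rcases x with x | x <;> rfl

/-- The permutation preserves the union of the blocks with index in `S`. -/
def PreservesBlocks (a : ι → ℕ) (σ : Perm (Σ i, Fin (a i))) (S : Finset ι) : Prop :=
  ∀ x, (σ x).1 ∈ S ↔ x.1 ∈ S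

open scoped Classical in
/-- The smallest set of blocks that contains the block `i₀` and is preserved by `σ`. -/
noncomputable def blockComponent (a : ι → ℕ) (i₀ : ι) (σ : Perm (Σ i, Fin (a i))) : Finset ι :=
  Finset.univ.filter fun i => ∀ S : Finset ι, i₀ ∈ S → PreservesBlocks a σ S → i ∈ S

theorem mem_blockComponent {i₀ i : ι} {σ : Perm (Σ i, Fin (a i))} : i ∈ blockComponent a i₀ σ ↔
    ∀ S : Finset ι, i₀ ∈ S → PreservesBlocks a σ S → i ∈ S := by
  simp [blockComponent]

theorem preservesBlocks_blockComponent (i₀ : ι) (σ : Perm (Σ i, Fin (a i))) :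
    PreservesBlocks a σ (blockComponent a i₀ σ) := fun x => by
  rw [mem_blockComponent, mem_blockComponent]
  exact forall_congr' fun S => forall_congr' fun _ => forall_congr' fun hS => hS x

theorem self_mem_blockComponent (i₀ : ι) (σ : Perm (Σ i, Fin (a i))) :
    i₀ ∈ blockComponent a i₀ σ := mem_blockComponent.mpr fun _ h _ => h

theorem preservesBlocks_iff_exists (S : Finset ι) (σ : Perm (Σ i, Fin (a i))) :
    PreservesBlocks a σ S ↔ ∃ (σ₁ : Perm (Σ i : {i // i ∈ S}, Fin (a i)))
      (σ₂ : Perm (Σ i : {i // i ∉ S}, Fin (a i))),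
      σ = (blockSplit a S).permCongr (Perm.sumCongr σ₁ σ₂) := by
  constructor
  · intro h
    have h1 : Set.MapsTo ((blockSplit a S).symm.permCongr σ) (Set.range Sum.inl)
        (Set.range Sum.inl) := by
      rintro _ ⟨x, rfl⟩
      have h2 : (σ (blockSplit a S (Sum.inl x))).1 ∈ S := (h _).mpr x.1.2
      exact ⟨⟨⟨_, h2⟩, _⟩, ((blockSplit a S).symm_apply_eq.mpr rfl).symm⟩
    obtain ⟨⟨σ₁, σ₂⟩, hσ⟩ := Perm.mem_sumCongrHom_range_of_perm_mapsTo_inl h1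
    refine ⟨σ₁, σ₂, ?_⟩
    have : Perm.sumCongr σ₁ σ₂ = (blockSplit a S).symm.permCongr σ := hσ
    rw [this]
    ext1 x
    simp [Equiv.permCongr_apply]
  · rintro ⟨σ₁, σ₂, rfl⟩ x
    obtain ⟨y, rfl⟩ := (blockSplit a S).surjective x
    rw [Equiv.permCongr_apply, Equiv.symm_apply_apply]
    rcases y with y | y
    · exact iff_of_true (σ₁ y).1.2 y.1.2
    · exact iff_of_false (σ₂ y).1.2 y.1.2

/-- Common invariant sets are unions of blocks, so transitivity on `S` means that no proper nonempty
subset of `S` is preserved. The definition of the component only tests sets that contain `i₀`; a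
preserved subset that avoids `i₀` is replaced by its complement in `S`. -/
theorem blockComponent_eq_iff (ha : ∀ i, 0 < a i) {i₀ : ι} {S : Finset ι} (hi : i₀ ∈ S)
    (σ₁ : Perm (Σ i : {i // i ∈ S}, Fin (a i))) (σ₂ : Perm (Σ i : {i // i ∉ S}, Fin (a i))) :
    blockComponent a i₀ ((blockSplit a S).permCongr (Perm.sumCongr σ₁ σ₂)) = S ↔
      JointlyTransitive (blockRotate fun i : {i // i ∈ S} => a i) σ₁ := by
  set σ := (blockSplit a S).permCongr (Perm.sumCongr σ₁ σ₂) with hσ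
  have hS : PreservesBlocks a σ S := (preservesBlocks_iff_exists S σ).mpr ⟨σ₁, σ₂, rfl⟩
  have happ : ∀ x : Σ i : {i // i ∈ S}, Fin (a i),
      σ ⟨x.1, x.2⟩ = ⟨(σ₁ x).1, (σ₁ x).2⟩ := fun x => by
    have : (⟨x.1, x.2⟩ : Σ i, Fin (a i)) = blockSplit a S (Sum.inl x) := rfl
    rw [this, hσ, Equiv.permCongr_apply, Equiv.symm_apply_apply]
    rfl
  constructor
  · intro h O hO h1 h2
    have hblock : ∀ i x y, (⟨i, x⟩ : Σ i : {i // i ∈ S}, Fin (a i)) ∈ O → ⟨i, y⟩ ∈ O :=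
      fun i x y => forall_of_finRotate_iff (P := fun x => ⟨i, x⟩ ∈ O) (fun x => h1 ⟨i, x⟩) x y
    let T : Finset ι := S.filter fun i => ∃ (h : i ∈ S) (x : Fin (a i)), ⟨⟨i, h⟩, x⟩ ∈ O
    have hT : ∀ x : Σ i : {i // i ∈ S}, Fin (a i), x.1.1 ∈ T ↔ x ∈ O := by
      rintro ⟨⟨i, hi⟩, x⟩
      simp only [T, Finset.mem_filter]
      constructor
      · rintro ⟨-, _, y, hy⟩
        exact hblock _ y x hy
      · intro hx
        exact ⟨hi, hi, x, hx⟩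
    have hTσ : ∀ x : Σ i : {i // i ∈ S}, Fin (a i), (σ₁ x).1.1 ∈ T ↔ x.1.1 ∈ T := fun x => by
      rw [hT, hT, h2]
    have hTS : ∀ i ∈ T, i ∈ S := fun i hi => (Finset.mem_filter.mp hi).1
    by_cases hi0 : i₀ ∈ T
    · have hp : PreservesBlocks a σ T := by
        rintro ⟨i, x⟩
        by_cases hiS : i ∈ S
        · have := hTσ ⟨⟨i, hiS⟩, x⟩
          rw [← this]
          have h3 := happ ⟨⟨i, hiS⟩, x⟩
          dsimp only at h3
          rw [h3]
        · exact iff_of_false (fun h' => hiS ((hS ⟨i, x⟩).mp (hTS _ h'))) (fun h' => hiS (hTS _ h'))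
      ext x
      refine iff_of_true ((hT x).mp ?_) (Finset.mem_univ _)
      have h3 : x.1.1 ∈ blockComponent a i₀ σ := by rw [h]; exact x.1.2
      exact mem_blockComponent.mp h3 T hi0 hp
    · exfalso
      have hp : PreservesBlocks a σ (S \ T) := by
        rintro ⟨i, x⟩
        rw [Finset.mem_sdiff, Finset.mem_sdiff]
        by_cases hiS : i ∈ S
        · have := hTσ ⟨⟨i, hiS⟩, x⟩
          have h3 := happ ⟨⟨i, hiS⟩, x⟩
          dsimp only at h3 this
          rw [hS, h3, ← this]
        · exact iff_of_false (fun h' => hiS ((hS ⟨i, x⟩).mp h'.1)) (fun h' => hiS h'.1)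
      obtain ⟨x, hx⟩ := hO
      have h3 : x.1.1 ∈ blockComponent a i₀ σ := by rw [h]; exact x.1.2
      have h4 := mem_blockComponent.mp h3 _ (Finset.mem_sdiff.mpr ⟨hi, hi0⟩) hp
      exact (Finset.mem_sdiff.mp h4).2 ((hT x).mpr hx)
  · intro h
    refine Finset.Subset.antisymm (fun i hi' => mem_blockComponent.mp hi' S hi hS) ?_
    intro i hiS
    rw [mem_blockComponent]
    intro T hT hTσ
    obtain ⟨O, hO⟩ : ∃ O : Finset (Σ i : {i // i ∈ S}, Fin (a i)), ∀ x, x ∈ O ↔ x.1.1 ∈ T :=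
      ⟨Finset.univ.filter fun x => x.1.1 ∈ T, by simp⟩
    have := h O ⟨⟨⟨i₀, hi⟩, ⟨0, ha i₀⟩⟩, (hO _).mpr hT⟩
      (fun x => by rw [hO, hO]; rfl) (fun x => by
        rw [hO, hO]
        have h3 := hTσ ⟨x.1, x.2⟩
        rwa [happ] at h3)
    have h4 : (⟨⟨i, hiS⟩, ⟨0, ha i⟩⟩ : Σ i : {i // i ∈ S}, Fin (a i)) ∈ O := by
      rw [this]; exact Finset.mem_univ _
    exact (hO _).mp h4

/-- Factorizations are sorted by the component of the block `i₀`: connected on that component,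
arbitrary on the other blocks. -/
theorem factSum_blockRotate (s u v : A) (ha : ∀ i, 0 < a i) (i₀ : ι) :
    factSum s u v (blockRotate a) = ∑ S ∈ Finset.univ.filter (fun S : Finset ι => i₀ ∈ S),
      connSum s u v (blockRotate fun i : {i // i ∈ S} => a i) *
        factSum s u v (blockRotate fun i : {i // i ∉ S} => a i) := by
  classical
  rw [factSum, ← Finset.sum_fiberwise_of_maps_to (g := blockComponent a i₀)
    (t := Finset.univ.filter (fun S : Finset ι => i₀ ∈ S))
    (fun σ _ => by simpa using self_mem_blockComponent i₀ σ)]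
  refine Finset.sum_congr rfl fun S hS => ?_
  have hi : i₀ ∈ S := by simpa using hS
  rw [connSum, factSum, Finset.sum_mul_sum, ← Finset.sum_product', Finset.univ_product_univ]
  simp only [ite_mul, zero_mul]
  rw [← Finset.sum_filter]
  symm
  refine Finset.sum_bij (fun p _ => (blockSplit a S).permCongr (Perm.sumCongr p.1 p.2)) ?_ ?_ ?_ ?_
  · intro p hp
    simp only [Finset.mem_filter, Finset.mem_univ, true_and] at hp ⊢
    exact (blockComponent_eq_iff ha hi p.1 p.2).mpr hp
  · intro p _ q _ h
    exact Perm.sumCongrHom_injective ((blockSplit a S).permCongr.injective h)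
  · intro σ hσ
    simp only [Finset.mem_filter, Finset.mem_univ, true_and] at hσ
    obtain ⟨σ₁, σ₂, rfl⟩ := (preservesBlocks_iff_exists S σ).mp
      (hσ ▸ preservesBlocks_blockComponent i₀ σ)
    refine ⟨(σ₁, σ₂), ?_, rfl⟩
    simp only [Finset.mem_filter, Finset.mem_univ, true_and]
    exact (blockComponent_eq_iff ha hi σ₁ σ₂).mp hσ
  · intro p _
    have h1 : ((blockSplit a S).permCongr (Perm.sumCongr p.1 p.2))⁻¹ * blockRotate a =
        (blockSplit a S).permCongr (Perm.sumCongr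
          (p.1⁻¹ * blockRotate fun i : {i // i ∈ S} => a i)
          (p.2⁻¹ * blockRotate fun i : {i // i ∉ S} => a i)) := by
      rw [← blockSplit_permCongr_blockRotate S, permCongr_inv_mul, Perm.sumCongr_inv,
        Perm.sumCongr_mul]
    rw [h1, cycleLengths_permCongr, cycleLengths_permCongr, cycleLengths_sumCongr,
      cycleLengths_sumCongr, ← Fintype.card_congr (blockSplit a S), Fintype.card_sum]
    simp only [Multiset.card_add, pow_add]
    ring

end Decomposition

end Connected

/-! ### Calculus of exponential generating functions, on multisets -/

section MultisetConvolution

variable {A : Type*} [CommRing A]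

/-- The product of functions on multisets dual to the union of labelled sets. -/
def multisetConv (f g : Multiset ℕ → A) (μ : Multiset ℕ) : A :=
  (μ.antidiagonal.map fun p => f p.1 * g p.2).sum

theorem multisetConv_zero (f g : Multiset ℕ → A) : multisetConv f g 0 = f 0 * g 0 := by
  simp [multisetConv]

/-- The Leibniz rule: adding an element to the argument is a partial derivative.
`Multiset.antidiagonal` counts splittings with multiplicity, so equal elements behave as labelled
ones. The algebra of the convolution follows from this rule by induction. -/
theorem multisetConv_cons (f g : Multiset ℕ → A) (a : ℕ) (μ : Multiset ℕ) :
    multisetConv f g (a ::ₘ μ) = multisetConv f (fun ν => g (a ::ₘ ν)) μ +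
      multisetConv (fun ν => f (a ::ₘ ν)) g μ := by
  simp [multisetConv, Multiset.antidiagonal_cons, Multiset.map_add]

theorem multisetConv_add_left (f₁ f₂ g : Multiset ℕ → A) :
    multisetConv (fun μ => f₁ μ + f₂ μ) g = fun μ => multisetConv f₁ g μ + multisetConv f₂ g μ := by
  funext μ
  simp [multisetConv, add_mul, Multiset.sum_map_add]

theorem multisetConv_add_right (f g₁ g₂ : Multiset ℕ → A) (μ : Multiset ℕ) :
    multisetConv f (fun μ => g₁ μ + g₂ μ) μ = multisetConv f g₁ μ + multisetConv f g₂ μ := by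
  simp [multisetConv, mul_add, Multiset.sum_map_add]

theorem multisetConv_smul_left (c : A) (f g : Multiset ℕ → A) :
    multisetConv (fun μ => c * f μ) g = fun μ => c * multisetConv f g μ := by
  funext μ
  simp [multisetConv, mul_assoc, Multiset.sum_map_mul_left]

theorem multisetConv_sum_left {ι : Type*} (t : Finset ι) (f : ι → Multiset ℕ → A)
    (g : Multiset ℕ → A) :
    multisetConv (fun μ => ∑ i ∈ t, f i μ) g = fun μ => ∑ i ∈ t, multisetConv (f i) g μ := by
  classical
  induction t using Finset.induction_on with
  | empty => funext μ; simp [multisetConv]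
  | insert i t hi ih => simp only [Finset.sum_insert hi, multisetConv_add_left, ih]

theorem multisetConv_assoc (f g h : Multiset ℕ → A) (μ : Multiset ℕ) :
    multisetConv (multisetConv f g) h μ = multisetConv f (multisetConv g h) μ := by
  induction μ using Multiset.induction_on generalizing f g h with
  | empty => simp [multisetConv_zero, mul_assoc]
  | cons a μ ih =>
    rw [multisetConv_cons, multisetConv_cons, ih]
    simp only [multisetConv_cons, multisetConv_add_left, multisetConv_add_right, ih]
    ring

theorem multisetConv_comm (f g : Multiset ℕ → A) (μ : Multiset ℕ) :
    multisetConv f g μ = multisetConv g f μ := by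
  induction μ using Multiset.induction_on generalizing f g with
  | empty => simp [multisetConv_zero, mul_comm]
  | cons a μ ih => rw [multisetConv_cons, multisetConv_cons, ih f, ih _ g, add_comm]

theorem multisetConv_congr_left {f₁ f₂ g : Multiset ℕ → A} {μ : Multiset ℕ}
    (h : ∀ ν ≤ μ, f₁ ν = f₂ ν) : multisetConv f₁ g μ = multisetConv f₂ g μ := by
  unfold multisetConv
  congr 1
  refine Multiset.map_congr rfl fun p hp => ?_
  rw [Multiset.mem_antidiagonal] at hp
  rw [h p.1 (hp ▸ Multiset.le_add_right _ _)]

/-- Convolution is triangular in its first argument, with `T` independent of `f`. Hence a factor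
with `g 0 = 1` can be cancelled. -/
theorem multisetConv_eq_add (g : Multiset ℕ → A) (μ : Multiset ℕ) :
    ∃ T : Multiset (Multiset ℕ × Multiset ℕ), (∀ p ∈ T, p.1 < μ) ∧ ∀ f : Multiset ℕ → A,
      multisetConv f g μ = f μ * g 0 + (T.map fun p => f p.1 * g p.2).sum := by
  induction μ using Multiset.induction_on with
  | empty => exact ⟨0, by simp, fun f => by simp [multisetConv_zero]⟩
  | cons a μ ih =>
    obtain ⟨T, hT, h⟩ := ih
    refine ⟨T.map (fun p => (a ::ₘ p.1, p.2)) + μ.antidiagonal.map (fun p => (p.1, a ::ₘ p.2)),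
      ?_, fun f => ?_⟩
    · intro p hp
      rcases Multiset.mem_add.mp hp with hp | hp
      · obtain ⟨q, hq, rfl⟩ := Multiset.mem_map.mp hp
        exact Multiset.cons_lt_cons_iff.mpr (hT q hq)
      · obtain ⟨q, hq, rfl⟩ := Multiset.mem_map.mp hp
        rw [Multiset.mem_antidiagonal] at hq
        exact lt_of_le_of_lt (hq ▸ Multiset.le_add_right _ _) (Multiset.lt_cons_self μ a)
    · rw [multisetConv_cons, h]
      simp [multisetConv, Multiset.map_add]
      ring

theorem multisetConv_right_cancel {f₁ f₂ g : Multiset ℕ → A} (hg : g 0 = 1)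
    (h : ∀ μ, multisetConv f₁ g μ = multisetConv f₂ g μ) : f₁ = f₂ := by
  funext μ
  induction μ using Multiset.strongInductionOn with
  | ih μ ih =>
    obtain ⟨T, hT, h'⟩ := multisetConv_eq_add g μ
    have := h μ
    rw [h', h', hg] at this
    have h2 : (T.map fun p => f₁ p.1 * g p.2) = (T.map fun p => f₂ p.1 * g p.2) :=
      Multiset.map_congr rfl fun p hp => by rw [ih p.1 (hT p hp)]
    rw [h2] at this
    simpa using this

/-- The operator `∑ⱼ pⱼ · (j + m) ∂_{j + m}`, in terms of functions on multisets. -/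
def joinOp (m : ℕ) (f : Multiset ℕ → A) (μ : Multiset ℕ) : A :=
  (μ.map fun a => a • f ((m + a) ::ₘ μ.erase a)).sum

theorem joinOp_cons (m : ℕ) (f : Multiset ℕ → A) (b : ℕ) (μ : Multiset ℕ) :
    joinOp m f (b ::ₘ μ) = b • f ((m + b) ::ₘ μ) + joinOp m (fun ν => f (b ::ₘ ν)) μ := by
  unfold joinOp
  rw [Multiset.map_cons, Multiset.sum_cons, Multiset.erase_cons_head]
  congr 2
  refine Multiset.map_congr rfl fun a ha => ?_
  rw [Multiset.erase_cons_tail_of_mem ha, Multiset.cons_swap]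

theorem joinOp_add (m : ℕ) (f g : Multiset ℕ → A) (μ : Multiset ℕ) :
    joinOp m (fun ν => f ν + g ν) μ = joinOp m f μ + joinOp m g μ := by
  simp [joinOp, Multiset.sum_map_add]

/-- A first order differential operator is a derivation. -/
theorem joinOp_conv_left (m : ℕ) (f g : Multiset ℕ → A) (μ : Multiset ℕ) :
    joinOp m (multisetConv f g) μ =
      multisetConv (joinOp m f) g μ + multisetConv f (joinOp m g) μ := by
  induction μ using Multiset.induction_on generalizing f g with
  | empty => simp [joinOp, multisetConv_zero]
  | cons b μ ih =>
    rw [joinOp_cons, multisetConv_cons]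
    have h1 : (fun ν => multisetConv f g (b ::ₘ ν)) = fun ν =>
      multisetConv f (fun ν => g (b ::ₘ ν)) ν + multisetConv (fun ν => f (b ::ₘ ν)) g ν := by
      funext ν; exact multisetConv_cons f g b ν
    rw [h1, joinOp_add, ih, ih, multisetConv_cons, multisetConv_cons]
    have h2 : ∀ F : Multiset ℕ → A, (fun ν => joinOp m F (b ::ₘ ν)) = fun ν =>
        (b : A) * F ((m + b) ::ₘ ν) + joinOp m (fun ν => F (b ::ₘ ν)) ν := by
      intro F; funext ν; rw [joinOp_cons, nsmul_eq_mul]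
    have h3 : ∀ F G : Multiset ℕ → A, multisetConv F (fun ν => (b : A) * G ν) μ =
        b * multisetConv F G μ := fun F G => by
      rw [multisetConv_comm, multisetConv_smul_left, multisetConv_comm]
    rw [h2, h2, multisetConv_add_left, multisetConv_add_right, multisetConv_smul_left, h3,
      nsmul_eq_mul]
    ring

theorem multisetConv_congr_right {f g₁ g₂ : Multiset ℕ → A} {μ : Multiset ℕ}
    (h : ∀ ν ≤ μ, g₁ ν = g₂ ν) : multisetConv f g₁ μ = multisetConv f g₂ μ := by
  rw [multisetConv_comm, multisetConv_congr_left h, multisetConv_comm]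

theorem multisetConv_left_comm (f g h : Multiset ℕ → A) (μ : Multiset ℕ) :
    multisetConv f (multisetConv g h) μ = multisetConv g (multisetConv f h) μ := by
  rw [← multisetConv_assoc, ← multisetConv_assoc]
  exact multisetConv_congr_left fun ν _ => multisetConv_comm f g ν

open scoped Classical in
theorem multisetConv_one_left (c : A) (g : Multiset ℕ → A) (μ : Multiset ℕ) :
    multisetConv (fun ν => if ν = 0 then c else 0) g μ = c * g μ := by
  induction μ using Multiset.induction_on generalizing g with
  | empty => simp [multisetConv_zero]
  | cons b μ ih =>
    rw [multisetConv_cons, ih]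
    simp [multisetConv]

/-- Passage to subsets of a labelled set, the form in which the decomposition into components is
available. -/
theorem multisetConv_map {ι : Type*} [DecidableEq ι] (f g : Multiset ℕ → A) (a : ι → ℕ)
    (t : Finset ι) : multisetConv f g (t.val.map a) =
      ∑ S ∈ t.powerset, f (S.val.map a) * g ((t \ S).val.map a) := by
  induction t using Finset.induction_on generalizing f g with
  | empty => simp [multisetConv_zero]
  | insert i t hi ih =>
    rw [Finset.insert_val_of_notMem hi, Multiset.map_cons, multisetConv_cons, ih, ih,
      Finset.sum_powerset_insert hi]
    congr 1
    · refine Finset.sum_congr rfl fun S hS => ?_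
      have hS' : i ∉ S := fun h => hi (Finset.mem_powerset.mp hS h)
      rw [Finset.insert_sdiff_of_notMem _ hS', Finset.insert_val_of_notMem, Multiset.map_cons]
      simp [hi]
    · refine Finset.sum_congr rfl fun S hS => ?_
      have hS' : i ∉ S := fun h => hi (Finset.mem_powerset.mp hS h)
      rw [Finset.insert_val_of_notMem hS', Multiset.map_cons, Finset.insert_sdiff_insert,
        Finset.sdiff_insert_of_notMem hi]

end MultisetConvolution

/-! ### The recursion for connected factorizations -/

section ConnectedRecursion

variable {A : Type*} [CommRing A]

theorem map_univ_subtype_val {ι : Type*} [Fintype ι] (p : ι → Prop) [DecidablePred p]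
    [Fintype {i // p i}] (a : ι → ℕ) :
    (Finset.univ.val.map fun i : {i // p i} => a i) = (Finset.univ.filter p).val.map a := by
  have : Finset.univ.map (Function.Embedding.subtype p) = Finset.univ.filter p := by
    ext; simp
  rw [← this, Finset.map_val, Multiset.map_map]
  rfl

/-- This is ∂Z = (∂F) Z for Z = exp F: the component of the distinguished cycle is connected and the
rest is arbitrary. -/
theorem factSumOf_cons_eq_multisetConv (s u v : A) (m : ℕ) (μ : Multiset ℕ) :
    factSumOf s u v (m ::ₘ μ) =
      multisetConv (fun ν => connSumOf s u v (m ::ₘ ν)) (factSumOf s u v) μ := by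
  by_cases h0 : 0 ∈ m ::ₘ μ
  · rw [factSumOf_of_zero_mem _ _ _ h0, multisetConv, eq_comm]
    refine Multiset.sum_eq_zero fun x hx => ?_
    obtain ⟨p, hp, rfl⟩ := Multiset.mem_map.mp hx
    rw [Multiset.mem_antidiagonal] at hp
    rw [← hp, Multiset.mem_cons, Multiset.mem_add] at h0
    by_cases h1 : 0 ∈ p.2
    · rw [factSumOf_of_zero_mem _ _ _ h1, mul_zero]
    · rw [connSumOf_of_zero_mem _ _ _ (by rw [Multiset.mem_cons]; tauto), zero_mul]
  · obtain ⟨n, b, rfl⟩ : ∃ (n : ℕ) (b : Fin n → ℕ), μ = Finset.univ.val.map b := by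
      refine ⟨μ.toList.length, μ.toList.get, ?_⟩
      conv_lhs => rw [← Multiset.coe_toList μ, ← List.ofFn_get μ.toList]
      simp
    let a : Fin (n + 1) → ℕ := Fin.cons m b
    have hab : Finset.univ.val.map b = (Finset.univ.erase (0 : Fin (n + 1))).val.map a := by
      have : Finset.univ.erase (0 : Fin (n + 1)) = Finset.univ.map (Fin.succEmb n) := by
        ext i
        induction i using Fin.cases <;> simp
      rw [this, Finset.map_val, Multiset.map_map]
      rfl
    have hcons : ∀ S : Finset (Fin (n + 1)), 0 ∉ S →
        (insert 0 S).val.map a = m ::ₘ S.val.map a := fun S hS => by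
      rw [Finset.insert_val_of_notMem hS, Multiset.map_cons]
      rfl
    have hins : insert 0 ((Finset.univ : Finset (Fin (n + 1))).erase 0) = Finset.univ := by simp
    have hall : Finset.univ.val.map a = m ::ₘ Finset.univ.val.map b := by
      rw [hab, ← hcons _ (by simp), hins]
    have hsum : ∀ F : Finset (Fin (n + 1)) → A, ∑ S, F S =
        ∑ S ∈ (Finset.univ.erase 0).powerset, F S +
          ∑ S ∈ (Finset.univ.erase 0).powerset, F (insert 0 S) := fun F => by
      rw [← Finset.sum_powerset_insert (by simp), hins, Finset.powerset_univ]
    have ha : ∀ i, 0 < a i := fun i => Nat.pos_of_ne_zero fun hi => h0 (by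
      rw [← hall, ← hi]; exact Multiset.mem_map_of_mem a (Finset.mem_univ i))
    rw [← hall, ← cycleLengths_blockRotate ha, factSumOf_cycleLengths, factSum_blockRotate s u v ha 0,
      hab, multisetConv_map, Finset.sum_filter, hsum, Finset.sum_eq_zero, zero_add]
    · refine Finset.sum_congr rfl fun S hS => ?_
      have hS0 : 0 ∉ S := fun h => by simpa using Finset.mem_powerset.mp hS h
      rw [if_pos (by simp), ← connSumOf_cycleLengths, ← factSumOf_cycleLengths,
        cycleLengths_blockRotate (fun i => ha _), cycleLengths_blockRotate (fun i => ha _),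
        map_univ_subtype_val, map_univ_subtype_val, ← hcons S hS0]
      congr 3
      · congr 1; ext i; simp
      · congr 1; ext i; simp [not_or]
    · intro S hS
      rw [if_neg]
      intro h; simpa using Finset.mem_powerset.mp hS h

/-- The relation DZ = (DF) Z for the derivation D = `joinOp m`. It is obtained by induction from the
relations for the partial derivatives. -/
theorem joinOp_factSumOf (s u v : A) (m : ℕ) (μ : Multiset ℕ) :
    joinOp m (factSumOf s u v) μ =
      multisetConv (joinOp m (connSumOf s u v)) (factSumOf s u v) μ := by
  induction μ using Multiset.strongInductionOn with
  | ih μ ih =>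
    induction μ using Multiset.induction_on with
    | empty => simp [joinOp, multisetConv_zero]
    | cons b μ _ =>
      have h1 : (fun ν => factSumOf s u v (b ::ₘ ν)) =
          multisetConv (fun ν => connSumOf s u v (b ::ₘ ν)) (factSumOf s u v) := by
        funext ν; exact factSumOf_cons_eq_multisetConv s u v b ν
      have h2 : (fun ν => joinOp m (connSumOf s u v) (b ::ₘ ν)) = fun ν =>
          (b : A) * connSumOf s u v ((m + b) ::ₘ ν) +
            joinOp m (fun ν => connSumOf s u v (b ::ₘ ν)) ν := by
        funext ν; rw [joinOp_cons, nsmul_eq_mul]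
      rw [joinOp_cons, h1, joinOp_conv_left, multisetConv_cons, h2, h1, multisetConv_add_left,
        multisetConv_smul_left, factSumOf_cons_eq_multisetConv,
        multisetConv_left_comm (joinOp m (connSumOf s u v)), nsmul_eq_mul,
        multisetConv_congr_right (f := fun ν => connSumOf s u v (b ::ₘ ν)) (fun ν hν =>
          ih ν (lt_of_le_of_lt hν (Multiset.lt_cons_self μ b)))]
      ring

open scoped Classical in
-- The recursion for Z is divided by Z, which is possible because Z has constant term 1. The cut
-- term becomes ∂ᵢ∂ⱼZ / Z = ∂ᵢ∂ⱼF + ∂ᵢF ∂ⱼF, whence the convolution.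
theorem connSumOf_succ_cons (s u v : A) (m : ℕ) (μ : Multiset ℕ) :
    connSumOf s u v ((m + 1) ::ₘ μ) = s * ((if μ = 0 then if m = 0 then u * v else 0 else 0) +
      (u + v) * connSumOf s u v (m ::ₘ μ) + joinOp m (connSumOf s u v) μ +
      ∑ p ∈ Finset.HasAntidiagonal.antidiagonal m, (connSumOf s u v (p.1 ::ₘ p.2 ::ₘ μ) +
        multisetConv (fun ν => connSumOf s u v (p.1 ::ₘ ν))
          (fun ν => connSumOf s u v (p.2 ::ₘ ν)) μ)) := by
  revert μ
  rw [← funext_iff]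
  refine multisetConv_right_cancel (g := factSumOf s u v) (factSumOf_zero s u v) fun μ => ?_
  rw [← factSumOf_cons_eq_multisetConv, factSumOf_succ_cons, multisetConv_smul_left,
    multisetConv_add_left, multisetConv_add_left, multisetConv_add_left,
    multisetConv_smul_left, multisetConv_sum_left]
  beta_reduce
  rw [multisetConv_one_left, ← factSumOf_cons_eq_multisetConv]
  have h1 := joinOp_factSumOf s u v m μ
  have h2 : ∀ p : ℕ × ℕ, factSumOf s u v (p.1 ::ₘ p.2 ::ₘ μ) = multisetConv (fun μ =>
      connSumOf s u v (p.1 ::ₘ p.2 ::ₘ μ) + multisetConv (fun ν => connSumOf s u v (p.1 ::ₘ ν))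
          (fun ν => connSumOf s u v (p.2 ::ₘ ν)) μ) (factSumOf s u v) μ := fun p => by
    have h3 : (fun ν => factSumOf s u v (p.2 ::ₘ ν)) =
        multisetConv (fun ν => connSumOf s u v (p.2 ::ₘ ν)) (factSumOf s u v) := by
      funext ν; exact factSumOf_cons_eq_multisetConv s u v p.2 ν
    rw [factSumOf_cons_eq_multisetConv, multisetConv_cons, h3, multisetConv_add_left, add_comm]
    congr 1
    exact (multisetConv_assoc _ _ _ _).symm
  rw [← h1, joinOp, Finset.sum_congr rfl fun p _ => h2 p]
  split_ifs <;> ring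

end ConnectedRecursion

/-! ### Separation of the genera -/

section Genus

theorem multisetConv_mul_mul {A : Type*} [CommRing A] {c d : Multiset ℕ → A} {k : A}
    (f g : Multiset ℕ → A) {μ : Multiset ℕ} (h : ∀ κ ν, κ + ν = μ → c κ * d ν = k) :
    multisetConv (fun ν => c ν * f ν) (fun ν => d ν * g ν) μ = k * multisetConv f g μ := by
  unfold multisetConv
  rw [← Multiset.sum_map_mul_left]
  refine congrArg Multiset.sum (Multiset.map_congr rfl fun p hp => ?_)
  rw [mul_mul_mul_comm, h _ _ (Multiset.mem_antidiagonal.mp hp)]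

open LaurentPolynomial
open scoped Polynomial

variable (s u v : ℂ)

/-- `connSumOf` with an additional variable that records the Euler characteristic. -/
noncomputable def connSumGraded (μ : Multiset ℕ) : ℂ[T;T⁻¹] :=
  T (2 - μ.card) * connSumOf (C s * T 1) (C u * T (-1)) (C v * T (-1)) μ

theorem connSumGraded_of_zero_mem {μ : Multiset ℕ} (h : 0 ∈ μ) : connSumGraded s u v μ = 0 := by
  rw [connSumGraded, connSumOf_of_zero_mem _ _ _ h, mul_zero]

open scoped Classical in
-- The exponent of T is 2 - #faces + #edges - #black - #white, that is 2g. All terms of the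
-- recursion are homogeneous for it, except that a cut which leaves the dessin connected lowers g by
-- one.
theorem connSumGraded_succ_cons (m : ℕ) (μ : Multiset ℕ) :
    connSumGraded s u v ((m + 1) ::ₘ μ) = C s *
      ((if μ = 0 then if m = 0 then C u * C v else 0 else 0) +
      (C u + C v) * connSumGraded s u v (m ::ₘ μ) + joinOp m (connSumGraded s u v) μ +
      ∑ p ∈ Finset.HasAntidiagonal.antidiagonal m, (T 2 * connSumGraded s u v (p.1 ::ₘ p.2 ::ₘ μ) +
        multisetConv (fun ν => connSumGraded s u v (p.1 ::ₘ ν))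
          (fun ν => connSumGraded s u v (p.2 ::ₘ ν)) μ)) := by
  have hN := connSumOf_succ_cons (C s * T 1) (C u * T (-1)) (C v * T (-1)) m μ
  have hG : ∀ μ, connSumGraded s u v μ =
      T (2 - μ.card) * connSumOf (C s * T 1) (C u * T (-1)) (C v * T (-1)) μ := fun _ => rfl
  generalize connSumOf (C s * T 1) (C u * T (-1)) (C v * T (-1)) = N at hN hG
  have hT : ∀ a b c : ℤ, a + b = c → (T a * T b : ℂ[T;T⁻¹]) = T c := fun a b c h => by
    rw [← T_add, h]
  obtain ⟨k, hk⟩ : ∃ k : ℤ, (2 - μ.card : ℤ) = k := ⟨_, rfl⟩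
  have h1 : joinOp m (connSumGraded s u v) μ = T k * joinOp m N μ := by
    unfold joinOp
    rw [← Multiset.sum_map_mul_left]
    congr 1
    refine Multiset.map_congr rfl fun a ha => ?_
    rw [hG, Multiset.card_cons, Multiset.card_erase_add_one ha, mul_smul_comm, hk]
  have h2 : ∀ p : ℕ × ℕ, multisetConv (fun ν => connSumGraded s u v (p.1 ::ₘ ν))
      (fun ν => connSumGraded s u v (p.2 ::ₘ ν)) μ =
      T k * multisetConv (fun ν => N (p.1 ::ₘ ν)) (fun ν => N (p.2 ::ₘ ν)) μ := fun p => by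
    simp only [hG]
    refine multisetConv_mul_mul _ _ fun κ ν hκ => hT _ _ k ?_
    rw [← hk, ← hκ, Multiset.card_cons, Multiset.card_cons, Multiset.card_add]
    push_cast
    ring
  have h3 : ∀ p : ℕ × ℕ, T 2 * connSumGraded s u v (p.1 ::ₘ p.2 ::ₘ μ) =
      T k * N (p.1 ::ₘ p.2 ::ₘ μ) := fun p => by
    rw [hG, ← mul_assoc, hT 2 _ k (by rw [← hk]; simp; ring)]
  have h4 : connSumGraded s u v (m ::ₘ μ) = T k * (T (-1) * N (m ::ₘ μ)) := by
    rw [hG, ← mul_assoc, hT k (-1) _ rfl]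
    congr 2
    rw [← hk]; simp; ring
  have h5 : (if μ = 0 then if m = 0 then C u * C v else 0 else 0 : ℂ[T;T⁻¹]) = T k *
      (if μ = 0 then if m = 0 then C u * T (-1) * (C v * T (-1)) else 0 else 0) := by
    split_ifs with h h'
    · have : (T k * (T (-1) * T (-1)) : ℂ[T;T⁻¹]) = 1 := by
        rw [← T_add, ← T_add, ← hk, h, ← T_zero]; congr 1
      linear_combination (- C u * C v) * this
    · simp
    · simp
  rw [h1, Finset.sum_congr rfl fun p _ => congrArg₂ _ (h3 p) (h2 p), h4, h5, hG, hN]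
  simp only [← mul_add, ← Finset.mul_sum]
  rw [← hT (2 - (((m + 1) ::ₘ μ).card : ℤ)) 1 k (by rw [← hk]; simp; ring)]
  ring

/-- Laurent polynomials that are polynomials in `T²`. -/
noncomputable def toLaurentSq : ℂ[X] →+* ℂ[T;T⁻¹] :=
  (Polynomial.toLaurent (R := ℂ)).comp (Polynomial.expand ℂ 2 : ℂ[X] →+* ℂ[X])

theorem toLaurentSq_injective : Function.Injective toLaurentSq :=
  (Polynomial.toLaurent_injective (R := ℂ)).comp (Polynomial.expand_injective (by norm_num))

theorem toLaurentSq_C (c : ℂ) : toLaurentSq (Polynomial.C c) = C c := by simp [toLaurentSq]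

theorem toLaurentSq_X : toLaurentSq Polynomial.X = T 2 := by simp [toLaurentSq]

theorem toLaurentSq_apply (P : ℂ[X]) (g : ℕ) : (toLaurentSq P).coeff (2 * g) = P.coeff g := by
  have h : (toLaurentSq P).coeff (Nat.castEmbedding (g * 2) : ℤ) =
      (Polynomial.expand ℂ 2 P).coeff (g * 2) := by
    simp only [toLaurentSq, RingHom.comp_apply, LaurentPolynomial.coeff_toLaurent]
    exact Finsupp.mapDomain_apply Nat.castEmbedding.injective _ _
  rw [Polynomial.coeff_expand_mul (by norm_num)] at h
  rw [← h]
  simp [mul_comm]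

theorem multisetConv_mem {A : Type*} [CommRing A] (R : Subring A) {f g : Multiset ℕ → A}
    {μ : Multiset ℕ} (hf : ∀ ν ≤ μ, f ν ∈ R) (hg : ∀ ν ≤ μ, g ν ∈ R) : multisetConv f g μ ∈ R := by
  refine multiset_sum_mem _ fun x hx => ?_
  obtain ⟨p, hp, rfl⟩ := Multiset.mem_map.mp hx
  rw [Multiset.mem_antidiagonal] at hp
  exact R.mul_mem (hf _ (hp ▸ Multiset.le_add_right _ _)) (hg _ (hp ▸ Multiset.le_add_left _ _))

theorem sum_le_sum_of_le {μ ν : Multiset ℕ} (h : μ ≤ ν) : μ.sum ≤ ν.sum := by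
  obtain ⟨κ, rfl⟩ := Multiset.le_iff_exists_add.mp h
  simp

/-- That g is a non-negative integer is not shown by topology: the recursion involves only
non-negative even powers of T, so the claim follows by induction on the number of edges. -/
theorem connSumGraded_mem_range (μ : Multiset ℕ) : connSumGraded s u v μ ∈ toLaurentSq.range := by
  classical
  induction h : μ.sum using Nat.strong_induction_on generalizing μ with
  | _ N ih =>
  subst h
  have hC : ∀ c : ℂ, (C c : ℂ[T;T⁻¹]) ∈ toLaurentSq.range := fun c => ⟨_, toLaurentSq_C c⟩
  by_cases h0 : 0 ∈ μ
  · rw [connSumGraded_of_zero_mem _ _ _ h0]; exact zero_mem _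
  · induction μ using Multiset.induction_on with
    | empty =>
      have : connSumGraded s u v 0 = T 2 := by
        have h : cycleLengths (1 : Equiv.Perm (Fin 0)) = 0 := by simp [cycleLengths_one]
        rw [connSumGraded, ← h, connSumOf_cycleLengths, connSum]
        have : JointlyTransitive (1 : Equiv.Perm (Fin 0)) 1 := fun O hO => by
          obtain ⟨x, -⟩ := hO; exact x.elim0
        simp [this, cycleLengths_eq]
      rw [this]
      exact ⟨Polynomial.X, toLaurentSq_X⟩
    | cons m μ _ =>
      obtain _ | m := m
      · simp at h0
      rw [connSumGraded_succ_cons]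
      refine mul_mem (hC s) (add_mem (add_mem (add_mem ?_ (mul_mem (add_mem (hC u) (hC v)) ?_)) ?_)
        (sum_mem fun p hp => add_mem (mul_mem ⟨Polynomial.X, toLaurentSq_X⟩ ?_) (multisetConv_mem _ ?_ ?_)))
      · split_ifs
        · exact mul_mem (hC u) (hC v)
        · exact zero_mem _
        · exact zero_mem _
      · exact ih _ (by simp) _ rfl
      · refine multiset_sum_mem _ fun x hx => ?_
        obtain ⟨a, ha, rfl⟩ := Multiset.mem_map.mp hx
        refine nsmul_mem (ih _ ?_ _ rfl) a
        have := Multiset.sum_erase ha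
        simp; omega
      · have := Finset.HasAntidiagonal.mem_antidiagonal.mp hp
        exact ih _ (by simp; omega) _ rfl
      · intro ν hν
        have := Finset.HasAntidiagonal.mem_antidiagonal.mp hp
        have := sum_le_sum_of_le hν
        exact ih _ (by simp; omega) _ rfl
      · intro ν hν
        have := Finset.HasAntidiagonal.mem_antidiagonal.mp hp
        have := sum_le_sum_of_le hν
        exact ih _ (by simp; omega) _ rfl

/-- The generating polynomial of `connSumOf` by the genus. -/
noncomputable def genusPoly (μ : Multiset ℕ) : ℂ[X] := (connSumGraded_mem_range s u v μ).choose

theorem toLaurentSq_genusPoly (μ : Multiset ℕ) :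
    toLaurentSq (genusPoly s u v μ) = connSumGraded s u v μ :=
  (connSumGraded_mem_range s u v μ).choose_spec

/-- The genus `g` part of `connSumOf`. -/
noncomputable def genusSum (g : ℕ) (μ : Multiset ℕ) : ℂ := (genusPoly s u v μ).coeff g

theorem map_multisetConv {A B : Type*} [CommRing A] [CommRing B] (f : A →+* B)
    (F G : Multiset ℕ → A) (μ : Multiset ℕ) :
    f (multisetConv F G μ) = multisetConv (fun ν => f (F ν)) (fun ν => f (G ν)) μ := by
  simp [multisetConv, map_multiset_sum, Multiset.map_map]

theorem map_joinOp {A B : Type*} [CommRing A] [CommRing B] (f : A →+ B)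
    (m : ℕ) (F : Multiset ℕ → A) (μ : Multiset ℕ) :
    f (joinOp m F μ) = joinOp m (fun ν => f (F ν)) μ := by
  rw [joinOp, joinOp, map_multiset_sum, Multiset.map_map]
  congr 1
  refine Multiset.map_congr rfl fun a _ => ?_
  simp only [Function.comp_apply, map_nsmul]

open scoped Classical in
theorem genusPoly_succ_cons (m : ℕ) (μ : Multiset ℕ) :
    genusPoly s u v ((m + 1) ::ₘ μ) = Polynomial.C s *
      ((if μ = 0 then if m = 0 then Polynomial.C (u * v) else 0 else 0) +
      Polynomial.C (u + v) * genusPoly s u v (m ::ₘ μ) + joinOp m (genusPoly s u v) μ +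
      ∑ p ∈ Finset.HasAntidiagonal.antidiagonal m, (Polynomial.X * genusPoly s u v (p.1 ::ₘ p.2 ::ₘ μ) +
        multisetConv (fun ν => genusPoly s u v (p.1 ::ₘ ν))
          (fun ν => genusPoly s u v (p.2 ::ₘ ν)) μ)) := by
  apply toLaurentSq_injective
  have h := map_joinOp (toLaurentSq : ℂ[X] →+ ℂ[T;T⁻¹]) m (genusPoly s u v) μ
  simp only [AddMonoidHom.coe_coe] at h
  simp only [map_mul, map_add, map_sum, map_multisetConv, toLaurentSq_genusPoly, toLaurentSq_C,
    toLaurentSq_X, connSumGraded_succ_cons, h]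
  congr 4
  split_ifs <;> simp [toLaurentSq_C]

open scoped Classical in
theorem genusSum_succ_cons (g m : ℕ) (μ : Multiset ℕ) :
    genusSum s u v g ((m + 1) ::ₘ μ) = s *
      ((if μ = 0 then if m = 0 then if g = 0 then u * v else 0 else 0 else 0) +
      (u + v) * genusSum s u v g (m ::ₘ μ) + joinOp m (genusSum s u v g) μ +
      ∑ p ∈ Finset.HasAntidiagonal.antidiagonal m,
        ((if g = 0 then 0 else genusSum s u v (g - 1) (p.1 ::ₘ p.2 ::ₘ μ)) +
        ∑ h ∈ Finset.range (g + 1), multisetConv (fun ν => genusSum s u v h (p.1 ::ₘ ν))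
          (fun ν => genusSum s u v (g - h) (p.2 ::ₘ ν)) μ)) := by
  have h1 : (joinOp m (genusPoly s u v) μ).coeff g = joinOp m (genusSum s u v g) μ :=
    map_joinOp (Polynomial.lcoeff ℂ g).toAddMonoidHom m (genusPoly s u v) μ
  have h2 : ∀ F G : Multiset ℕ → ℂ[X], (multisetConv F G μ).coeff g =
      ∑ h ∈ Finset.range (g + 1), multisetConv (fun ν => (F ν).coeff h)
        (fun ν => (G ν).coeff (g - h)) μ := fun F G => by
    unfold multisetConv
    induction μ.antidiagonal using Multiset.induction_on with
    | empty => simp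
    | cons p M ih =>
      simp only [Multiset.map_cons, Multiset.sum_cons, Polynomial.coeff_add, ih,
        Finset.sum_add_distrib, Polynomial.coeff_mul,
        Finset.Nat.sum_antidiagonal_eq_sum_range_succ_mk]
  have h3 : ∀ P : ℂ[X], (Polynomial.X * P).coeff g = if g = 0 then 0 else P.coeff (g - 1) := fun P => by
    cases g <;> simp
  rw [genusSum, genusPoly_succ_cons, Polynomial.coeff_C_mul, Polynomial.coeff_add, Polynomial.coeff_add, Polynomial.coeff_add, Polynomial.coeff_C_mul, h1,
    Polynomial.finsetSum_coeff]
  simp only [Polynomial.coeff_add, h2, h3]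
  congr 4
  split_ifs <;> simp_all [Polynomial.coeff_C]

theorem genusSum_of_zero_mem (g : ℕ) {μ : Multiset ℕ} (h : 0 ∈ μ) : genusSum s u v g μ = 0 := by
  have : genusPoly s u v μ = 0 := toLaurentSq_injective (by
    rw [toLaurentSq_genusPoly, connSumGraded_of_zero_mem _ _ _ h, map_zero])
  rw [genusSum, this, Polynomial.coeff_zero]

end Genus

/-! ### Correlators as numbers of factorizations of one permutation -/

section Correlators

open Equiv LaurentPolynomial

/-- Each derivative multiplies a coefficient by the shifted exponent. The factorials on both sides
make these factors telescope without division. -/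
theorem MvPowerSeries.coeff_foldr_pderiv {ι A : Type*} [DecidableEq ι] [CommRing A] (F : MvPowerSeries ι A)
    (L : List ι) (S : Finset ι) (hS : ∀ m ∈ L, m ∈ S) (ν : ι →₀ ℕ) :
    MvPowerSeries.coeff ν (L.foldr (fun m F => MvPowerSeries.pderiv A m F) F) *
        ∏ m ∈ S, ((ν m).factorial : A) =
      MvPowerSeries.coeff (ν + Multiset.toFinsupp (L : Multiset ι)) F *
        ∏ m ∈ S, (((ν + Multiset.toFinsupp (L : Multiset ι)) m).factorial : A) := by
  induction L generalizing ν with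
  | nil => simp
  | cons m L ih =>
    have h := ih (fun k hk => hS k (List.mem_cons_of_mem _ hk)) (ν + Finsupp.single m 1)
    have e : ν + Multiset.toFinsupp ((m :: L : List ι) : Multiset ι) =
        ν + Finsupp.single m 1 + Multiset.toFinsupp (L : Multiset ι) := by
      rw [← Multiset.cons_coe, ← Multiset.singleton_add, map_add, Multiset.toFinsupp_singleton,
        add_assoc]
    have hp : ∏ k ∈ S, (((ν + Finsupp.single m 1 : ι →₀ ℕ) k).factorial : A) =
        (ν m + 1) * ∏ k ∈ S, ((ν k).factorial : A) := by
      have hm : m ∈ S := hS m (by simp)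
      rw [← Finset.mul_prod_erase _ _ hm, ← Finset.mul_prod_erase _ _ hm]
      have : ∀ k ∈ S.erase m, (((ν + Finsupp.single m 1 : ι →₀ ℕ) k).factorial : A) = (ν k).factorial :=
        fun k hk => by
          have := Finset.ne_of_mem_erase hk
          simp [this.symm]
      rw [Finset.prod_congr rfl this]
      simp [Nat.factorial_succ, mul_assoc]
    rw [e, ← h, hp, List.foldr_cons, MvPowerSeries.coeff_pderiv]
    ring

theorem constantCoeff_foldr_pderiv (F : MvPowerSeries ℕ ℂ) (L : List ℕ) :
    MvPowerSeries.constantCoeff (L.foldr (fun m F => MvPowerSeries.pderiv ℂ m F) F) =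
      MvPowerSeries.coeff (Multiset.toFinsupp (L : Multiset ℕ)) F *
        ∏ m ∈ (L : Multiset ℕ).toFinset, (((L : Multiset ℕ).count m).factorial : ℂ) := by
  have h := MvPowerSeries.coeff_foldr_pderiv F L (L : Multiset ℕ).toFinset (by simp) 0
  simpa using h

/-- The size of a conjugacy class. The fixed points, which `cycleType` ignores, account for the
factorial of the multiplicity of 1. -/
theorem card_filter_cycleLengths {d : ℕ} {μ : Multiset ℕ} (h0 : 0 ∉ μ) (hd : μ.sum = d) :
    (Finset.univ.filter fun φ : Perm (Fin d) => cycleLengths φ = μ).card *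
      (μ.prod * ∏ m ∈ μ.toFinset, (μ.count m).factorial) = d.factorial := by

  have hsplit : μ = μ.filter (2 ≤ ·) + Multiset.replicate (μ.count 1) 1 := by
    ext m
    rw [Multiset.count_add, Multiset.count_filter, Multiset.count_replicate]
    rcases m with _ | _ | m
    · simp [Multiset.count_eq_zero_of_notMem h0]
    · simp
    · simp
  have hs := congrArg Multiset.sum hsplit
  have hp := congrArg Multiset.prod hsplit
  simp only [Multiset.sum_add, Multiset.sum_replicate, Multiset.prod_add, Multiset.prod_replicate,
    one_pow, mul_one, smul_eq_mul] at hs hp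
  have h := Perm.card_of_cycleType_mul_eq (α := Fin d) (μ.filter (2 ≤ ·))
  rw [if_pos ⟨by simp; omega, fun a ha => (Multiset.mem_filter.mp ha).2⟩, Fintype.card_fin] at h
  rw [← h, hp]
  congr 1
  · congr 1
    ext φ
    simp only [Finset.mem_filter, Finset.mem_univ, true_and]
    refine ⟨fun h => by rw [← h, filter_cycleLengths], fun h => ?_⟩
    exact cycleLengths_eq_of_cycleType φ h0 (by simp [hd]) h
  · have e1 : d - (μ.filter (2 ≤ ·)).sum = μ.count 1 := by omega
    have e2 : ∏ m ∈ μ.toFinset, (μ.count m).factorial = (μ.count 1).factorial *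
        ∏ m ∈ (μ.filter (2 ≤ ·)).toFinset, ((μ.filter (2 ≤ ·)).count m).factorial := by
      have : ∏ m ∈ μ.toFinset, (μ.count m).factorial =
          ∏ m ∈ insert 1 (μ.filter (2 ≤ ·)).toFinset, (μ.count m).factorial := by
        apply Finset.prod_subset
        · intro m hm
          have hm' := Multiset.mem_toFinset.mp hm
          rw [hsplit, Multiset.mem_add] at hm'
          rw [Finset.mem_insert, Multiset.mem_toFinset]
          exact hm'.symm.imp (fun h => Multiset.eq_of_mem_replicate h) id
        · intro m _ hm
          rw [Multiset.mem_toFinset] at hm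
          rw [Multiset.count_eq_zero_of_notMem hm, Nat.factorial_zero]
      rw [this, Finset.prod_insert (by simp)]
      congr 1
      refine Finset.prod_congr rfl fun m hm => ?_
      rw [Multiset.count_filter_of_pos]
      exact (Multiset.mem_filter.mp (Multiset.mem_toFinset.mp hm)).2
    rw [e1, e2]
    ring

theorem isPretransitive_closure_iff {d : ℕ} (hd : 0 < d) (φ σ : Perm (Fin d)) :
    MulAction.IsPretransitive (Subgroup.closure {σ, σ⁻¹ * φ}) (Fin d) ↔ JointlyTransitive φ σ := by
  have hσ : σ ∈ Subgroup.closure {σ, σ⁻¹ * φ} := Subgroup.subset_closure (by simp)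
  have hφ : φ ∈ Subgroup.closure {σ, σ⁻¹ * φ} := by
    have h : σ⁻¹ * φ ∈ Subgroup.closure {σ, σ⁻¹ * φ} := Subgroup.subset_closure (by simp)
    simpa using mul_mem hσ h
  constructor
  · intro ht O ⟨x, hx⟩ h1 h2
    refine Finset.eq_univ_iff_forall.mpr fun y => ?_
    obtain ⟨⟨γ, hγ⟩, rfl⟩ := ht.exists_smul_eq x y
    have : ∀ γ ∈ Subgroup.closure {σ, σ⁻¹ * φ}, ∀ x, γ x ∈ O ↔ x ∈ O := by
      intro γ hγ
      induction hγ using Subgroup.closure_induction with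
      | mem γ hγ =>
        rcases hγ with rfl | rfl
        · exact h2
        · intro x
          rw [← h2 ((σ⁻¹ * φ) x), ← Perm.mul_apply, mul_inv_cancel_left]
          exact h1 x
      | one => simp
      | mul a b _ _ ha hb => intro x; rw [Perm.mul_apply, ha, hb]
      | inv a _ ha => intro x; rw [← ha, ← Perm.mul_apply, mul_inv_cancel, Perm.one_apply]
    exact (this γ hγ x).mpr hx
  · intro h
    classical
    let x₀ : Fin d := ⟨0, hd⟩
    let G := Subgroup.closure {σ, σ⁻¹ * φ}
    have key : ∀ x : Fin d, x ∈ MulAction.orbit G x₀ := by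
      intro x
      have := h (Finset.univ.filter fun x => x ∈ MulAction.orbit G x₀) ⟨x₀, by simp⟩
        (fun x => by
          simp only [Finset.mem_filter, Finset.mem_univ, true_and]
          rw [← MulAction.orbit_eq_iff, ← MulAction.orbit_eq_iff]
          exact Eq.congr_left (MulAction.orbit_smul (⟨φ, hφ⟩ : G) x))
        (fun x => by
          simp only [Finset.mem_filter, Finset.mem_univ, true_and]
          rw [← MulAction.orbit_eq_iff, ← MulAction.orbit_eq_iff]
          exact Eq.congr_left (MulAction.orbit_smul (⟨σ, hσ⟩ : G) x))
      have hx : x ∈ (Finset.univ : Finset (Fin d)) := Finset.mem_univ x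
      rw [← this] at hx
      simpa using hx
    refine ⟨fun x y => ?_⟩
    obtain ⟨a, ha⟩ := key x
    obtain ⟨b, hb⟩ := key y
    exact ⟨b * a⁻¹, by rw [← ha, ← hb]; simp [mul_smul]⟩

open scoped Classical in
-- The coefficient of T^(2g) selects the terms that satisfy Euler's formula.
theorem genusSum_cycleLengths (s u v : ℂ) (g : ℕ) {d : ℕ} (φ : Perm (Fin d)) :
    genusSum s u v g (cycleLengths φ) = ∑ σ : Perm (Fin d),
      if JointlyTransitive φ σ ∧ HasGenus σ (σ⁻¹ * φ) g then
        s ^ d * u ^ numCycles σ * v ^ numCycles (σ⁻¹ * φ) else 0 := by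
  have hc : ∀ τ : Perm (Fin d), (cycleLengths τ).card = numCycles τ := fun _ => rfl
  rw [genusSum, ← toLaurentSq_apply, toLaurentSq_genusPoly, connSumGraded, connSumOf_cycleLengths,
    connSum, Finset.mul_sum]
  rw [show ∀ (S : Finset (Perm (Fin d))) (f : Perm (Fin d) → ℂ[T;T⁻¹]) (k : ℤ),
    (∑ i ∈ S, f i).coeff k = ∑ i ∈ S, (f i).coeff k from fun S f k => by
      simp]
  refine Finset.sum_congr rfl fun σ _ => ?_
  by_cases h : JointlyTransitive φ σ
  · rw [if_pos h, Fintype.card_fin, hc, hc, hc]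
    simp only [h, true_and]
    have : (T (2 - (numCycles φ : ℤ)) * ((C s * T 1) ^ d * ((C u * T (-1)) ^ numCycles σ *
        (C v * T (-1)) ^ numCycles (σ⁻¹ * φ))) : ℂ[T;T⁻¹]) =
        C (s ^ d * u ^ numCycles σ * v ^ numCycles (σ⁻¹ * φ)) *
          T (2 - numCycles φ + d - numCycles σ - numCycles (σ⁻¹ * φ)) := by
      rw [show (2 - numCycles φ + d - numCycles σ - numCycles (σ⁻¹ * φ) : ℤ) =
        (2 - numCycles φ) + (d * 1 + (numCycles σ * (-1) + numCycles (σ⁻¹ * φ) * (-1))) by ring,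
        T_add, T_add, T_add, ← T_pow, ← T_pow, ← T_pow]
      simp only [mul_pow, map_mul, map_pow]
      ring
    rw [this, ← single_eq_C_mul_T]
    have h2 : (HasGenus σ (σ⁻¹ * φ) g) ↔
        (2 - numCycles φ + d - numCycles σ - numCycles (σ⁻¹ * φ) : ℤ) = 2 * g := by
      rw [HasGenus, mul_inv_cancel_left]
      omega
    rw [AddMonoidAlgebra.coeff_single, Finsupp.single_apply]
    simp only [h2]
  · simp [h]

theorem sum_toFinsupp (μ : Multiset ℕ) : (Multiset.toFinsupp μ).sum (fun m k => m * k) = μ.sum := by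
  rw [Finset.sum_multiset_count, Finsupp.sum]
  simp [mul_comm]

/-- Dessins are grouped by the product of their two permutations; all products in one conjugacy
class contribute equally. -/
theorem dessinSum_eq (s u v : ℂ) (g : ℕ) {d : ℕ} (hd : 0 < d) (μ : Multiset ℕ) :
    dessinSum s u v g d (Multiset.toFinsupp μ) = (d.factorial : ℂ)⁻¹ *
      ((Finset.univ.filter fun φ : Perm (Fin d) => cycleLengths φ = μ).card * genusSum s u v g μ) := by
  classical
  rw [dessinSum]
  congr 1
  rw [Fintype.sum_prod_type]
  have h1 : ∀ σ : Perm (Fin d), (∑ τ : Perm (Fin d),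
      if IsDessin σ τ ∧ HasGenus σ τ g ∧ faceExponent σ τ = Multiset.toFinsupp μ then
        s ^ d * u ^ numCycles σ * v ^ numCycles τ else 0) =
      ∑ φ : Perm (Fin d), if cycleLengths φ = μ then
        if JointlyTransitive φ σ ∧ HasGenus σ (σ⁻¹ * φ) g then
        s ^ d * u ^ numCycles σ * v ^ numCycles (σ⁻¹ * φ) else 0 else 0 := by
    intro σ
    rw [← Equiv.sum_comp (Equiv.mulLeft σ⁻¹)]
    refine Finset.sum_congr rfl fun φ _ => ?_
    have h2 : faceExponent σ (σ⁻¹ * φ) = Multiset.toFinsupp μ ↔ cycleLengths φ = μ := by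
      rw [faceExponent, mul_inv_cancel_left, Multiset.toFinsupp.injective.eq_iff]
      rfl
    have h3 : IsDessin σ (σ⁻¹ * φ) ↔ JointlyTransitive φ σ := by
      rw [IsDessin, isPretransitive_closure_iff hd, and_iff_right hd]
    simp only [Equiv.coe_mulLeft, h2, h3]
    split_ifs <;> simp_all
  simp only [h1]
  rw [Finset.sum_comm, Finset.card_eq_sum_ones, Nat.cast_sum, Finset.sum_mul, Finset.sum_filter]
  refine Finset.sum_congr rfl fun φ _ => ?_
  split_ifs with h
  · rw [← h, genusSum_cycleLengths]; simp
  · simp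

/-- The factors aᵢ and the factorials from the derivatives multiply to d! divided by the size of the
conjugacy class, so all normalizations cancel. -/
theorem dessinCorrelator_eq (s u v : ℂ) (g : ℕ) {n : ℕ} (hn : 0 < n) (a : Fin n → ℕ) :
    dessinCorrelator s u v g a = genusSum s u v g (Finset.univ.val.map a) := by
  rw [dessinCorrelator]
  by_cases h0 : ∃ i, a i = 0
  · obtain ⟨i, hi⟩ := h0
    rw [genusSum_of_zero_mem, Finset.prod_eq_zero (Finset.mem_univ i) (by simp [hi]), zero_mul]
    exact Multiset.mem_map.mpr ⟨i, by simp, hi⟩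
  · push Not at h0
    have hL : ((List.ofFn a : List ℕ) : Multiset ℕ) = Finset.univ.val.map a := by
      rw [Fin.univ_val_map]
    rw [constantCoeff_foldr_pderiv, hL]
    set μ := (Finset.univ.val.map a : Multiset ℕ) with hμ
    have hz : 0 ∉ μ := by simpa [hμ] using h0
    have hd : 0 < μ.sum := by
      have : a ⟨0, hn⟩ ∈ μ := by simp [hμ]
      have h1 := Multiset.le_sum_of_mem this
      have := h0 ⟨0, hn⟩
      omega
    have hF : MvPowerSeries.coeff (Multiset.toFinsupp μ) (dessinFreeEnergy s u v g) =
        dessinSum s u v g μ.sum (Multiset.toFinsupp μ) := by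
      rw [← sum_toFinsupp]; rfl
    have hprod : (∏ i, (a i : ℂ)) = (μ.prod : ℕ) := by
      rw [hμ, ← Finset.prod, Nat.cast_prod]
    have hc := congrArg (Nat.cast (R := ℂ)) (card_filter_cycleLengths hz rfl)
    push_cast at hc
    rw [hF, dessinSum_eq _ _ _ _ hd, hprod]
    have hf : (μ.sum.factorial : ℂ) ≠ 0 := Nat.cast_ne_zero.mpr (Nat.factorial_ne_zero _)
    field_simp
    rw [← hc]
    push_cast
    ring

end Correlators

/-! ### The loop equation in X = 1/x -/

section GeneratingSeries

open PowerSeries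

/-- The series `∑ F_{m + a} X ^ (m + 1)` obtained from `∑ F_m X ^ (m + 1)`. -/
noncomputable def shiftSer (a : ℕ) (F : ℂ⟦X⟧) : ℂ⟦X⟧ :=
  mk fun k => match k with
    | 0 => 0
    | m + 1 => coeff (m + a + 1) F

/-- The series obtained from `∑ F_{m, j} X ^ (m + 1) Y ^ (j + 1)` by setting `Y = X`. -/
noncomputable def diagSer (F : ℕ → ℂ⟦X⟧) : ℂ⟦X⟧ :=
  mk fun k => ∑ p ∈ Finset.HasAntidiagonal.antidiagonal k, match p.2 with
    | 0 => 0
    | j + 1 => coeff p.1 (F j)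

theorem coeff_zero_shiftSer (a : ℕ) (F : ℂ⟦X⟧) : coeff 0 (shiftSer a F) = 0 := by
  simp [shiftSer]

theorem coeff_succ_shiftSer (a : ℕ) (F : ℂ⟦X⟧) (m : ℕ) :
    coeff (m + 1) (shiftSer a F) = coeff (m + a + 1) F := by
  simp [shiftSer]

theorem shiftSer_add (a : ℕ) (F G : ℂ⟦X⟧) :
    shiftSer a (F + G) = shiftSer a F + shiftSer a G := by
  ext k; cases k <;> simp [coeff_zero_shiftSer, coeff_succ_shiftSer, -coeff_zero_eq_constantCoeff]

theorem shiftSer_smul (a : ℕ) (c : ℂ) (F : ℂ⟦X⟧) : shiftSer a (c • F) = c • shiftSer a F := by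
  ext k; cases k <;> simp [coeff_zero_shiftSer, coeff_succ_shiftSer, -coeff_zero_eq_constantCoeff]

theorem diagSer_add (F G : ℕ → ℂ⟦X⟧) : diagSer (F + G) = diagSer F + diagSer G := by
  ext k
  simp only [diagSer, coeff_mk, map_add, ← Finset.sum_add_distrib]
  refine Finset.sum_congr rfl fun p _ => ?_
  rcases p with ⟨i, _ | j⟩ <;> simp

theorem diagSer_smul (c : ℂ) (F : ℕ → ℂ⟦X⟧) : diagSer (c • F) = c • diagSer F := by
  ext k
  simp only [diagSer, coeff_mk, map_smul, Finset.smul_sum]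
  refine Finset.sum_congr rfl fun p _ => ?_
  rcases p with ⟨i, _ | j⟩ <;> simp

variable (s u v : ℂ)

/-- The generating series `∑ genusSum g (m, μ) X ^ (m + 1)`. -/
noncomputable def genusSer (g : ℕ) (μ : Multiset ℕ) : ℂ⟦X⟧ :=
  mk fun k => match k with
    | 0 => 0
    | m + 1 => genusSum s u v g (m ::ₘ μ)

theorem coeff_zero_genusSer (g : ℕ) (μ : Multiset ℕ) : coeff 0 (genusSer s u v g μ) = 0 := by
  simp [genusSer]

theorem coeff_succ_genusSer (g m : ℕ) (μ : Multiset ℕ) :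
    coeff (m + 1) (genusSer s u v g μ) = genusSum s u v g (m ::ₘ μ) := by
  simp [genusSer]

theorem coeff_one_genusSer (g : ℕ) (μ : Multiset ℕ) : coeff 1 (genusSer s u v g μ) = 0 := by
  rw [show 1 = 0 + 1 from rfl, coeff_succ_genusSer, genusSum_of_zero_mem _ _ _ _ (by simp)]

theorem coeff_add_two_mul {F G : ℂ⟦X⟧} (hF : coeff 0 F = 0) (hG : coeff 0 G = 0) (m : ℕ) :
    coeff (m + 2) (F * G) = ∑ p ∈ Finset.HasAntidiagonal.antidiagonal m,
      coeff (p.1 + 1) F * coeff (p.2 + 1) G := by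
  rw [coeff_mul, Finset.Nat.antidiagonal_succ_succ']
  simp [hF, hG, -coeff_zero_eq_constantCoeff]

theorem coeff_one_mul_of_zero {F G : ℂ⟦X⟧} (hF : coeff 0 F = 0) (hG : coeff 0 G = 0) :
    coeff 1 (F * G) = 0 := by
  rw [coeff_mul]
  simp [Finset.Nat.antidiagonal_succ, hF, hG, -coeff_zero_eq_constantCoeff]

theorem coeff_add_two_diagSer {F : ℕ → ℂ⟦X⟧} (hF : ∀ j, coeff 0 (F j) = 0) (m : ℕ) :
    coeff (m + 2) (diagSer F) = ∑ p ∈ Finset.HasAntidiagonal.antidiagonal m,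
      coeff (p.1 + 1) (F p.2) := by
  rw [diagSer, coeff_mk, Finset.Nat.antidiagonal_succ_succ']
  simp [hF, -coeff_zero_eq_constantCoeff]

theorem multisetConv_hom {A B : Type*} [CommRing A] [CommRing B] (f : A →+ B)
    (F G : Multiset ℕ → A) (μ : Multiset ℕ) :
    f (multisetConv F G μ) = (μ.antidiagonal.map fun p => f (F p.1 * G p.2)).sum := by
  simp [multisetConv, map_multiset_sum, Multiset.map_map]

open scoped Classical in
-- The coefficient of X^(m+2) is `genusSum_succ_cons` at m. Since every series carries an extra
-- factor X, the sums over p₁ + p₂ = m become products and diagonal restrictions.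
theorem genusSer_eq (g : ℕ) (μ : Multiset ℕ) :
    genusSer s u v g μ = C s *
      ((if μ = 0 then if g = 0 then C (u * v) * X ^ 2 else 0 else 0) +
      C (u + v) * (X * genusSer s u v g μ) +
      X * (μ.map fun a => a • shiftSer a (genusSer s u v g (μ.erase a))).sum +
      (if g = 0 then 0 else diagSer fun j => genusSer s u v (g - 1) (j ::ₘ μ)) +
      ∑ h ∈ Finset.range (g + 1), multisetConv (genusSer s u v h) (genusSer s u v (g - h)) μ) := by
  have h0 := coeff_zero_genusSer s u v
  have hc : ∀ k, coeff k (∑ h ∈ Finset.range (g + 1),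
      multisetConv (genusSer s u v h) (genusSer s u v (g - h)) μ) =
      ∑ h ∈ Finset.range (g + 1), (μ.antidiagonal.map fun p =>
        coeff k (genusSer s u v h p.1 * genusSer s u v (g - h) p.2)).sum := fun k => by
    rw [map_sum]
    exact Finset.sum_congr rfl fun h _ => multisetConv_hom (coeff k : ℂ⟦X⟧ →ₗ[ℂ] ℂ).toAddMonoidHom _ _ _
  have hm : ∀ k, coeff k (μ.map fun a => a • shiftSer a (genusSer s u v g (μ.erase a))).sum =
      (μ.map fun a => a • coeff k (shiftSer a (genusSer s u v g (μ.erase a)))).sum := fun k => by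
    rw [map_multiset_sum, Multiset.map_map]
    refine congrArg Multiset.sum (Multiset.map_congr rfl fun a _ => ?_)
    exact map_nsmul (coeff k : ℂ⟦X⟧ →ₗ[ℂ] ℂ) a _
  ext k
  rw [coeff_C_mul]
  simp only [LinearMap.map_add, hc]
  rcases k with _ | _ | m
  · rw [h0]
    have h1 : coeff 0 (if g = 0 then 0 else diagSer fun j => genusSer s u v (g - 1) (j ::ₘ μ)) = 0 := by
      split_ifs <;> simp [diagSer]
    have h2 : coeff 0 (if μ = 0 then if g = 0 then C (u * v) * X ^ 2 else 0 else 0 : ℂ⟦X⟧) = 0 := by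
      split_ifs <;> simp
    rw [h1, h2]
    have h3 : ∀ ν h, constantCoeff (genusSer s u v h ν) = 0 := fun ν h => by
      rw [← coeff_zero_eq_constantCoeff_apply, h0]
    simp [h3]
  · have h1 : coeff 1 (if g = 0 then 0 else diagSer fun j => genusSer s u v (g - 1) (j ::ₘ μ)) = 0 := by
      split_ifs
      · simp
      · simp [diagSer, Finset.Nat.antidiagonal_succ, h0, -coeff_zero_eq_constantCoeff]
    have h2 : coeff 1 (if μ = 0 then if g = 0 then C (u * v) * X ^ 2 else 0 else 0 : ℂ⟦X⟧) = 0 := by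
      split_ifs <;> simp [coeff_C_mul, coeff_X_pow, -map_mul]
    rw [zero_add, coeff_one_genusSer, h1, h2, coeff_C_mul, show 1 = 0 + 1 from rfl, coeff_succ_X_mul,
      coeff_succ_X_mul, hm]
    simp [coeff_zero_shiftSer, coeff_one_mul_of_zero, h0, -coeff_zero_eq_constantCoeff]
  · have h2 : coeff (m + 2) (if μ = 0 then if g = 0 then C (u * v) * X ^ 2 else 0 else 0 : ℂ⟦X⟧) =
        if μ = 0 then if m = 0 then if g = 0 then u * v else 0 else 0 else 0 := by
      split_ifs <;> simp [coeff_C_mul, coeff_X_pow, -map_mul, *]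
    have h1 : coeff (m + 2) (if g = 0 then 0 else diagSer fun j => genusSer s u v (g - 1) (j ::ₘ μ)) =
        ∑ p ∈ Finset.HasAntidiagonal.antidiagonal m,
        (if g = 0 then 0 else genusSum s u v (g - 1) (p.1 ::ₘ p.2 ::ₘ μ)) := by
      split_ifs
      · simp
      · rw [coeff_add_two_diagSer fun j => h0 _ _]
        simp only [coeff_succ_genusSer]
    have h3 : (μ.map fun a => a • coeff (m + 1) (shiftSer a (genusSer s u v g (μ.erase a)))).sum =
        joinOp m (genusSum s u v g) μ := by
      simp only [coeff_succ_shiftSer, coeff_succ_genusSer, joinOp]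
    have h4 : ∑ h ∈ Finset.range (g + 1), (μ.antidiagonal.map fun p =>
        coeff (m + 2) (genusSer s u v h p.1 * genusSer s u v (g - h) p.2)).sum =
        ∑ p ∈ Finset.HasAntidiagonal.antidiagonal m, ∑ h ∈ Finset.range (g + 1),
          multisetConv (fun ν => genusSum s u v h (p.1 ::ₘ ν))
          (fun ν => genusSum s u v (g - h) (p.2 ::ₘ ν)) μ := by
      rw [Finset.sum_comm]
      refine Finset.sum_congr rfl fun h _ => ?_
      simp only [coeff_add_two_mul (h0 _ _) (h0 _ _), coeff_succ_genusSer, multisetConv]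
      rw [Multiset.sum_map_sum]
    rw [show m + 1 + 1 = m + 2 from rfl, h2, h1, h4, coeff_C_mul, show m + 2 = (m + 1) + 1 from rfl,
      coeff_succ_X_mul, coeff_succ_X_mul, hm, h3, coeff_succ_genusSer, coeff_succ_genusSer,
      genusSum_succ_cons, Finset.sum_add_distrib, add_assoc _ (Finset.sum _ _)]

/-- The series of the function `y`, up to normalization. -/
noncomputable def ySer : ℂ⟦X⟧ := 1 - C (s * (u + v)) * X - C (2 * s) * genusSer s u v 0 0

/-- The loop equation (0,1) is quadratic in its unknown; this is its completed square. The
right-hand side is 4s² y² on the spectral curve. -/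
theorem ySer_sq : ySer s u v ^ 2 =
    (1 - C (s * (u + v)) * X) ^ 2 - C (4 * s ^ 2 * (u * v)) * X ^ 2 := by
  have h := genusSer_eq s u v 0 0
  simp only [if_true, Multiset.map_zero, Multiset.sum_zero, mul_zero, add_zero, zero_add,
    Finset.range_one, Finset.sum_singleton, multisetConv_zero] at h
  rw [ySer]
  simp only [map_mul, map_add, map_pow, map_ofNat] at h ⊢
  linear_combination (-4 * C s) * h

theorem constantCoeff_ySer : constantCoeff (ySer s u v) = 1 := by
  have : constantCoeff (genusSer s u v 0 0) = 0 := by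
    rw [← coeff_zero_eq_constantCoeff_apply, coeff_zero_genusSer]
  simp [ySer, this]

theorem erase_map_univ {n : ℕ} (a : Fin n → ℕ) (j : Fin n) :
    (Finset.univ.val.map a).erase (a j) = ({j}ᶜ : Finset (Fin n)).val.map a := by
  rw [← Multiset.map_erase_of_mem _ _ (Finset.mem_univ_val j), ← Finset.erase_val]
  congr 2
  ext i; simp

/-- The two excluded index pairs are distinct because g + n > 0. -/
theorem sum_eq_sum_add_unstable {M : Type*} [AddCommMonoid M] {g n : ℕ} (hgn : 0 < g + n)
    (t : Fin (g + 1) → Finset (Fin n) → M) :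
    ∑ h : Fin (g + 1), ∑ I : Finset (Fin n), t h I =
      (∑ h : Fin (g + 1), ∑ I : Finset (Fin n),
        if (h.val = 0 ∧ I = ∅) ∨ (h.val = g ∧ I = Finset.univ) then 0 else t h I) +
      (t 0 ∅ + t (Fin.last g) Finset.univ) := by
  have h5 : ∀ (h : Fin (g + 1)) (I : Finset (Fin n)), t h I =
      (if (h.val = 0 ∧ I = ∅) ∨ (h.val = g ∧ I = Finset.univ) then 0 else t h I) +
      ((if h = 0 then if I = ∅ then t h I else 0 else 0) +
        (if h = Fin.last g then if I = Finset.univ then t h I else 0 else 0)) := by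
    intro h I
    have e1 : h = 0 ↔ h.val = 0 := Fin.ext_iff
    have e2 : h = Fin.last g ↔ h.val = g := Fin.ext_iff
    have e3 : h.val = 0 → I = ∅ → h.val = g → I ≠ Finset.univ := by
      rintro h0 rfl hg hI
      have := congrArg Finset.card hI
      simp at this
      omega
    simp only [e1, e2]
    split_ifs <;> simp_all
  rw [Finset.sum_congr rfl fun h _ => Finset.sum_congr rfl fun I _ => h5 h I]
  simp only [Finset.sum_add_distrib]
  congr 1
  congr 1
  · rw [Finset.sum_eq_single 0 (fun h _ hh => by simp [hh]) (by simp)]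
    simp
  · rw [Finset.sum_eq_single (Fin.last g) (fun h _ hh => by simp [hh]) (by simp)]
    simp

/-- The recursion of the generating series with the unstable terms that contain `genusSer 0 0`
moved to the left. -/
theorem ySer_mul_genusSer (g : ℕ) {n : ℕ} (hgn : 0 < g + n) (a : Fin n → ℕ) :
    ySer s u v * genusSer s u v g (Finset.univ.val.map a) = C s *
      (X * ∑ j, a j • shiftSer (a j) (genusSer s u v g (({j}ᶜ : Finset (Fin n)).val.map a)) +
      (if g = 0 then 0 else diagSer fun j => genusSer s u v (g - 1) (j ::ₘ Finset.univ.val.map a)) +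
      ∑ h : Fin (g + 1), ∑ I : Finset (Fin n),
        if (h.val = 0 ∧ I = ∅) ∨ (h.val = g ∧ I = Finset.univ) then 0 else
          genusSer s u v h.val (I.val.map a) * genusSer s u v (g - h.val) (Iᶜ.val.map a)) := by
  classical
  have h := genusSer_eq s u v g (Finset.univ.val.map a)
  have h1 : (if (Finset.univ.val.map a) = 0 then if g = 0 then C (u * v) * X ^ 2 else 0 else 0 : ℂ⟦X⟧)
      = 0 := by
    split_ifs with h1 h2
    · have := congrArg Multiset.card h1
      simp at this
      omega
    · rfl
    · rfl
  have h2 : ((Finset.univ.val.map a).map fun b => b • shiftSer b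
      (genusSer s u v g ((Finset.univ.val.map a).erase b))).sum =
      ∑ j, a j • shiftSer (a j) (genusSer s u v g (({j}ᶜ : Finset (Fin n)).val.map a)) := by
    rw [Multiset.map_map, Finset.sum]
    refine congrArg Multiset.sum (Multiset.map_congr rfl fun j _ => ?_)
    simp only [Function.comp_apply, erase_map_univ]
  set t : Fin (g + 1) → Finset (Fin n) → ℂ⟦X⟧ := fun h I =>
    genusSer s u v h.val (I.val.map a) * genusSer s u v (g - h.val) (Iᶜ.val.map a) with ht
  have h3 : ∑ h ∈ Finset.range (g + 1), multisetConv (genusSer s u v h) (genusSer s u v (g - h))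
      (Finset.univ.val.map a) = ∑ h : Fin (g + 1), ∑ I : Finset (Fin n), t h I := by
    rw [← Fin.sum_univ_eq_sum_range (fun h => multisetConv (genusSer s u v h)
      (genusSer s u v (g - h)) (Finset.univ.val.map a))]
    refine Finset.sum_congr rfl fun h _ => ?_
    rw [multisetConv_map, Finset.powerset_univ]
    rfl
  have h4 := sum_eq_sum_add_unstable hgn t
  have h6 : t 0 ∅ + t (Fin.last g) Finset.univ =
      2 * (genusSer s u v 0 0 * genusSer s u v g (Finset.univ.val.map a)) := by
    simp [ht]; ring
  rw [h1, h2, h3, h4, h6] at h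
  rw [ySer]
  simp only [map_mul, map_add, map_ofNat] at h ⊢
  linear_combination h

end GeneratingSeries

/-! ### Expansions at x = ∞ of differentials on the spectral curve -/

section CurveSeries

open PowerSeries

theorem derivative_units_zpow (Z : ℂ⟦X⟧ˣ) (m : ℤ) :
    d⁄dX ℂ ((Z ^ m : ℂ⟦X⟧ˣ) : ℂ⟦X⟧) = C (m : ℂ) * ((Z ^ (m - 1) : ℂ⟦X⟧ˣ) : ℂ⟦X⟧) * d⁄dX ℂ (Z : ℂ⟦X⟧) := by
  have hstep : ∀ m : ℤ, d⁄dX ℂ ((Z ^ (m + 1) : ℂ⟦X⟧ˣ) : ℂ⟦X⟧) =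
      Z * d⁄dX ℂ ((Z ^ m : ℂ⟦X⟧ˣ) : ℂ⟦X⟧) + ((Z ^ m : ℂ⟦X⟧ˣ) : ℂ⟦X⟧) * d⁄dX ℂ (Z : ℂ⟦X⟧) := by
    intro m
    rw [zpow_add_one, Units.val_mul, Derivation.leibniz, smul_eq_mul, smul_eq_mul]
    ring
  have hz : ∀ m : ℤ, ((Z ^ m : ℂ⟦X⟧ˣ) : ℂ⟦X⟧) = Z * ((Z ^ (m - 1) : ℂ⟦X⟧ˣ) : ℂ⟦X⟧) := fun m => by
    rw [← Units.val_mul, ← zpow_one_add]; congr 2; ring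
  induction m with
  | zero => simp
  | succ k ih =>
    rw [hstep, ih, add_sub_cancel_right]
    have := hz k
    push_cast
    rw [map_add, map_one]
    linear_combination (-C (k : ℂ) * d⁄dX ℂ (Z : ℂ⟦X⟧)) * this
  | pred k ih =>
    have h1 := hstep (-k - 1)
    rw [sub_add_cancel, ih] at h1
    have h2 := hz (-k - 1)
    have h3 := hz (-k)
    have hinv : ((Z⁻¹ : ℂ⟦X⟧ˣ) : ℂ⟦X⟧) * Z = 1 := by simp
    push_cast at h1 ⊢
    rw [map_sub, map_neg, map_one]
    rw [map_neg] at h1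
    linear_combination (-((Z⁻¹ : ℂ⟦X⟧ˣ) : ℂ⟦X⟧)) * h1 + (d⁄dX ℂ ((Z ^ (-(k:ℤ) - 1) : ℂ⟦X⟧ˣ) : ℂ⟦X⟧) +
      (C (k : ℂ) + 1) * ((Z ^ (-(k:ℤ) - 1 - 1) : ℂ⟦X⟧ˣ) : ℂ⟦X⟧) * d⁄dX ℂ (Z : ℂ⟦X⟧)) * (-hinv) - ((Z⁻¹ : ℂ⟦X⟧ˣ) : ℂ⟦X⟧) * (C (k : ℂ) + 1) * d⁄dX ℂ (Z : ℂ⟦X⟧) * h2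

variable (s α β : ℂ) (Z : ℂ⟦X⟧ˣ)

/-- The series of the rational function `α z ^ 2 - β`. -/
noncomputable def dSer : ℂ⟦X⟧ := C α * (Z : ℂ⟦X⟧) ^ 2 - C β

/-- The series of the differential `z ^ (2 k) dz / dx`. -/
noncomputable def eSer (k : ℤ) : ℂ⟦X⟧ :=
  C (-1 / (2 * s * (α - β))) * ((Z : ℂ⟦X⟧) ^ 2 - 1) ^ 2 * ((Z ^ (2 * k - 1) : ℂ⟦X⟧ˣ) : ℂ⟦X⟧)

/-- The coefficients of `eSer`. -/
noncomputable def eCoeff (k : ℤ) (a : ℕ) : ℂ := coeff (a + 1) (eSer s α β Z k)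

/-- The quotient of `s` by the series of `y`. -/
noncomputable def kerSer : ℂ⟦X⟧ := C (s / (α - β)) * dSer α β Z * ((Z⁻¹ : ℂ⟦X⟧ˣ) : ℂ⟦X⟧)

/-- The coefficients of the polynomial `-(z - 1)² (α z - β) / (2 (α - β)²)`. -/
noncomputable def kerCoeff (i : ℕ) : ℂ :=
  match i with
  | 0 => β / (2 * (α - β) ^ 2)
  | 1 => -(α + 2 * β) / (2 * (α - β) ^ 2)
  | 2 => (2 * α + β) / (2 * (α - β) ^ 2)
  | 3 => -α / (2 * (α - β) ^ 2)
  | _ => 0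

theorem sum_kerCoeff {R : Type*} [CommRing R] [Algebra ℂ R] (w : R) :
    ∑ i ∈ Finset.range 4, algebraMap ℂ R (kerCoeff α β i) * w ^ i =
      algebraMap ℂ R (-1 / (2 * (α - β) ^ 2)) * ((w - 1) ^ 2 *
        (algebraMap ℂ R α * w - algebraMap ℂ R β)) := by
  have h : ∀ c : ℂ, algebraMap ℂ R (c / (2 * (α - β) ^ 2)) =
      algebraMap ℂ R (1 / (2 * (α - β) ^ 2)) * algebraMap ℂ R c := fun c => by
    rw [← map_mul]; congr 1; ring
  simp only [Finset.sum_range_succ, Finset.sum_range_zero, kerCoeff]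
  rw [h, h (-_), h (2 * α + β), h (-α), h (-1)]
  simp only [map_neg, map_add, map_mul, map_one, map_ofNat]
  ring

variable {s α β Z}

theorem coe_zpow_add (m k : ℤ) : ((Z ^ (m + k) : ℂ⟦X⟧ˣ) : ℂ⟦X⟧) =
    ((Z ^ m : ℂ⟦X⟧ˣ) : ℂ⟦X⟧) * ((Z ^ k : ℂ⟦X⟧ˣ) : ℂ⟦X⟧) := by
  rw [zpow_add, Units.val_mul]

theorem coe_zpow_mul_self (m : ℤ) : (Z : ℂ⟦X⟧) * ((Z ^ (m - 1) : ℂ⟦X⟧ˣ) : ℂ⟦X⟧) =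
    ((Z ^ m : ℂ⟦X⟧ˣ) : ℂ⟦X⟧) := by
  conv_lhs => rw [← zpow_one Z, zpow_one, ← Units.val_mul, ← zpow_one_add]
  congr 2; ring

section

variable (hs : s ≠ 0) (hαβ : α - β ≠ 0)
  (hZ : (1 - C (s * α) * X) * (Z : ℂ⟦X⟧) ^ 2 = 1 - C (s * β) * X)
include hZ

theorem X_mul_dSer : C s * X * dSer α β Z = (Z : ℂ⟦X⟧) ^ 2 - 1 := by
  rw [dSer]
  simp only [map_mul] at hZ
  linear_combination -hZ

theorem dSer_mul : dSer α β Z * (1 - C (s * α) * X) = C (α - β) := by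
  rw [dSer]
  simp only [map_mul, map_sub] at hZ ⊢
  linear_combination C α * hZ

theorem dSer_sq : C s * dSer α β Z ^ 2 = 2 * C (α - β) * Z * d⁄dX ℂ (Z : ℂ⟦X⟧) := by
  have h := congrArg (d⁄dX ℂ) hZ
  simp only [Derivation.leibniz, map_sub, Derivation.map_one_eq_zero, smul_eq_mul, derivative_C,
    derivative_X, Derivation.leibniz_pow, mul_zero, add_zero, mul_one, zero_sub] at h
  have h2 := dSer_mul hZ
  have h3 : dSer α β Z = C α * (Z : ℂ⟦X⟧) ^ 2 - C β := rfl
  simp only [map_mul, map_sub, nsmul_eq_mul, Nat.cast_ofNat, pow_one, Nat.reduceSub] at h h2 ⊢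
  linear_combination (-dSer α β Z) * h + C s * dSer α β Z * h3 + 2 * Z * d⁄dX ℂ (Z : ℂ⟦X⟧) * h2

include hs hαβ

/-- With x = 1/X one has dz/dx = -X² dz/dX. -/
theorem eSer_eq (k : ℤ) :
    eSer s α β Z k = -(X ^ 2 * ((Z ^ (2 * k) : ℂ⟦X⟧ˣ) : ℂ⟦X⟧) * d⁄dX ℂ (Z : ℂ⟦X⟧)) := by
  have h1 := X_mul_dSer hZ
  have h2 := dSer_sq hZ
  have h3 := coe_zpow_mul_self (Z := Z) (2 * k)
  have hc : C (-1 / (2 * s * (α - β))) * (2 * C (α - β) * C s) = (-1 : ℂ⟦X⟧) := by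
    rw [← map_ofNat C 2, ← map_mul, ← map_mul, ← map_mul, ← map_one C, ← map_neg]
    congr 1
    field_simp
  rw [eSer, ← h1, ← h3]
  linear_combination (C (-1 / (2 * s * (α - β))) * C s * X ^ 2 *
    ((Z ^ (2 * k - 1) : ℂ⟦X⟧ˣ) : ℂ⟦X⟧)) * h2 +
    X ^ 2 * Z * ((Z ^ (2 * k - 1) : ℂ⟦X⟧ˣ) : ℂ⟦X⟧) * d⁄dX ℂ (Z : ℂ⟦X⟧) * hc

theorem coeff_zero_eSer (k : ℤ) : coeff 0 (eSer s α β Z k) = 0 := by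
  rw [eSer_eq hs hαβ hZ]; simp

theorem eCoeff_zero (k : ℤ) : eCoeff s α β Z k 0 = 0 := by
  rw [eCoeff, eSer_eq hs hαβ hZ, sq, mul_assoc, mul_assoc, map_neg, coeff_succ_X_mul]
  simp

/-- Comparison of coefficients in d(z^(2j+1)) = (2j+1) z^(2j) dz. -/
theorem mul_coeff_zpow (j : ℤ) (a : ℕ) : a * coeff a ((Z ^ (2 * j + 1) : ℂ⟦X⟧ˣ) : ℂ⟦X⟧) =
    -((2 * j + 1) * eCoeff s α β Z j a) := by
  rcases a with _ | a
  · rw [eCoeff_zero hs hαβ hZ]; simp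
  · have h := coeff_derivative ((Z ^ (2 * j + 1) : ℂ⟦X⟧ˣ) : ℂ⟦X⟧) a
    rw [derivative_units_zpow, mul_assoc, coeff_C_mul, add_sub_cancel_right] at h
    rw [eCoeff, eSer_eq hs hαβ hZ, mul_assoc, sq, mul_assoc, map_neg, coeff_succ_X_mul,
      coeff_succ_X_mul]
    push_cast at h ⊢
    linear_combination -h

theorem kerSer_mul : kerSer s α β Z * ((1 - C (s * α) * X) * (Z : ℂ⟦X⟧)) = C s := by
  have h1 := dSer_mul hZ
  have hc : C (s / (α - β)) * C (α - β) = (C s : ℂ⟦X⟧) := by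
    rw [← map_mul]; congr 1; field_simp
  have hi : ((Z⁻¹ : ℂ⟦X⟧ˣ) : ℂ⟦X⟧) * Z = 1 := by simp
  rw [kerSer]
  linear_combination C (s / (α - β)) * ((Z⁻¹ : ℂ⟦X⟧ˣ) : ℂ⟦X⟧) * Z * h1 + hc +
    C (s / (α - β)) * C (α - β) * hi

omit hZ in
-- Both 1/y and dz/dx are odd Laurent polynomials in z, so their product is an even one; it has the
-- four coefficients `kerCoeff`.
theorem kerSer_mul_eSer (l : ℤ) : kerSer s α β Z * eSer s α β Z l =
    ∑ i ∈ Finset.range 4, kerCoeff α β i • ((Z ^ (2 * (l - 1 + i)) : ℂ⟦X⟧ˣ) : ℂ⟦X⟧) := by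
  have hz : ∀ i : ℕ, ((Z ^ (2 * (l - 1 + i)) : ℂ⟦X⟧ˣ) : ℂ⟦X⟧) =
      ((Z ^ (2 * l - 2) : ℂ⟦X⟧ˣ) : ℂ⟦X⟧) * ((Z : ℂ⟦X⟧) ^ 2) ^ i := fun i => by
    rw [show 2 * (l - 1 + i) = 2 * l - 2 + (2 * i : ℕ) by push_cast; ring, coe_zpow_add,
      zpow_natCast, Units.val_pow_eq_pow_val, pow_mul]
  have h := sum_kerCoeff (R := ℂ⟦X⟧) α β ((Z : ℂ⟦X⟧) ^ 2)
  have h2 := coe_zpow_mul_self (Z := Z) (2 * l - 1)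
  rw [show 2 * l - 1 - 1 = 2 * l - 2 by ring] at h2
  have hi : ((Z⁻¹ : ℂ⟦X⟧ˣ) : ℂ⟦X⟧) * Z = 1 := by simp
  have hc : C (s / (α - β)) * C (-1 / (2 * s * (α - β))) = (C (-1 / (2 * (α - β) ^ 2)) : ℂ⟦X⟧) := by
    rw [← map_mul]; congr 1; field_simp
  simp only [hz, smul_eq_C_mul]
  simp only [PowerSeries.algebraMap_apply, Algebra.algebraMap_self, RingHom.id_apply] at h
  rw [show ∑ i ∈ Finset.range 4, C (kerCoeff α β i) * (((Z ^ (2 * l - 2) : ℂ⟦X⟧ˣ) : ℂ⟦X⟧) *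
    ((Z : ℂ⟦X⟧) ^ 2) ^ i) = ((Z ^ (2 * l - 2) : ℂ⟦X⟧ˣ) : ℂ⟦X⟧) * ∑ i ∈ Finset.range 4,
      C (kerCoeff α β i) * ((Z : ℂ⟦X⟧) ^ 2) ^ i by
    rw [Finset.mul_sum]; exact Finset.sum_congr rfl fun i _ => by ring, h, kerSer, eSer, ← h2, dSer]
  linear_combination (((C α * (Z : ℂ⟦X⟧) ^ 2 - C β)) * ((Z : ℂ⟦X⟧) ^ 2 - 1) ^ 2 * ((Z ^ (2 * l - 2) : ℂ⟦X⟧ˣ) : ℂ⟦X⟧)) * hc +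
    C (s / (α - β)) * C (-1 / (2 * s * (α - β))) * (((C α * (Z : ℂ⟦X⟧) ^ 2 - C β)) * ((Z : ℂ⟦X⟧) ^ 2 - 1) ^ 2 * ((Z ^ (2 * l - 2) : ℂ⟦X⟧ˣ) : ℂ⟦X⟧)) * hi

omit hZ in
theorem kerSer_mul_eSer_mul_eSer (k l : ℤ) :
    kerSer s α β Z * (eSer s α β Z k * eSer s α β Z l) =
      ∑ i ∈ Finset.range 4, kerCoeff α β i • eSer s α β Z (k + l - 1 + i) := by
  rw [mul_left_comm, kerSer_mul_eSer hs hαβ, Finset.mul_sum]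
  refine Finset.sum_congr rfl fun i _ => ?_
  rw [mul_smul_comm, eSer, eSer, show 2 * (k + l - 1 + i) - 1 = 2 * k - 1 + 2 * (l - 1 + i) by ring,
    coe_zpow_add, mul_assoc]

end

theorem shiftSer_X_mul (a : ℕ) (F : ℂ⟦X⟧) :
    shiftSer a (X * F) = X * (shiftSer a F + C (coeff a F)) := by
  ext k
  rcases k with _ | _ | m
  · rw [coeff_zero_shiftSer, coeff_zero_X_mul]
  · rw [coeff_succ_shiftSer, zero_add, coeff_succ_X_mul, show 1 = 0 + 1 from rfl, coeff_succ_X_mul,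
      LinearMap.map_add, coeff_zero_shiftSer, zero_add, coeff_zero_C]
  · rw [coeff_succ_shiftSer, coeff_succ_X_mul, coeff_succ_X_mul, LinearMap.map_add,
      coeff_succ_shiftSer, coeff_C, if_neg (by omega), add_zero]
    congr 2; omega

theorem shiftSer_sub (a : ℕ) (F G : ℂ⟦X⟧) :
    shiftSer a (F - G) = shiftSer a F - shiftSer a G := by
  have h := shiftSer_add a (F - G) G
  rw [sub_add_cancel] at h
  rw [h, add_sub_cancel_right]

theorem shiftSer_C_mul (a : ℕ) (c : ℂ) (F : ℂ⟦X⟧) :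
    shiftSer a (C c * F) = C c * shiftSer a F := by
  rw [← smul_eq_C_mul, shiftSer_smul, smul_eq_C_mul]

section

variable (hs : s ≠ 0) (hαβ : α - β ≠ 0)
  (hZ : (1 - C (s * α) * X) * (Z : ℂ⟦X⟧) ^ 2 = 1 - C (s * β) * X)
include hαβ hZ

/-- The shift commutes with multiplication by X up to one coefficient. Applied to (1 - sαX) G = (1 -
sβX) F with G = F Z², this leaves a single correction term. -/
theorem shiftSer_mul_sq (a : ℕ) (F : ℂ⟦X⟧) : shiftSer a (F * (Z : ℂ⟦X⟧) ^ 2) =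
    (Z : ℂ⟦X⟧) ^ 2 * shiftSer a F +
      C (s / (α - β)) * X * dSer α β Z * C (coeff a (F * dSer α β Z)) := by
  set G := F * (Z : ℂ⟦X⟧) ^ 2 with hG
  have h1 : G - C (s * α) * (X * G) = F - C (s * β) * (X * F) := by
    rw [hG]; linear_combination F * hZ
  have h2 := congrArg (shiftSer a) h1
  simp only [shiftSer_sub, shiftSer_C_mul, shiftSer_X_mul] at h2
  have h3 : coeff a (F * dSer α β Z) = α * coeff a G - β * coeff a F := by
    rw [dSer, mul_sub, show F * (C α * (Z : ℂ⟦X⟧) ^ 2) = C α * G by rw [hG]; ring,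
      show F * C β = C β * F by ring, map_sub, coeff_C_mul, coeff_C_mul]
  have h4 := dSer_mul hZ
  have hc : C (1 / (α - β)) * C (α - β) = (1 : ℂ⟦X⟧) := by
    rw [← map_mul, ← map_one C]; congr 1; field_simp
  have hu : IsUnit (1 - C (s * α) * X : ℂ⟦X⟧) := by
    rw [isUnit_iff_constantCoeff]; simp
  refine hu.mul_left_cancel ?_
  have hc2 : (C (s / (α - β)) : ℂ⟦X⟧) = C s * C (1 / (α - β)) := by
    rw [← map_mul]; congr 1; ring
  rw [h3, hc2]
  simp only [map_mul, map_sub] at h2 h4 hZ hc ⊢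
  linear_combination h2 - C s * X * (C α * C (coeff a G) - C β * C (coeff a F)) * hc -
    C s * C (1 / (α - β)) * X * (C α * C (coeff a G) - C β * C (coeff a F)) * h4 - shiftSer a F * hZ

end

end CurveSeries

/-! ### Terms with the two-point series -/

section UnstableSeries

open PowerSeries

variable {s α β : ℂ} {Z : ℂ⟦X⟧ˣ}

variable (s α Z) in
/-- The series of the function `y`, in terms of the series of the coordinate `z`. -/
noncomputable def yOfSer : ℂ⟦X⟧ := (1 - C (s * α) * X) * (Z : ℂ⟦X⟧)

variable (s α β Z) in
/-- The action of the insertion of a face of degree `a` on the function `z ^ (2 m)`. -/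
noncomputable def insertSer (m : ℤ) (a : ℕ) : ℂ⟦X⟧ :=
  C (a / s) * X * kerSer s α β Z *
    (shiftSer a (yOfSer s α Z * ((Z ^ (2 * m) : ℂ⟦X⟧ˣ) : ℂ⟦X⟧)) -
      ((Z ^ (2 * m) : ℂ⟦X⟧ˣ) : ℂ⟦X⟧) * shiftSer a (yOfSer s α Z))

theorem insertSer_zero (a : ℕ) : insertSer s α β Z 0 a = 0 := by
  simp [insertSer]

section

variable (hs : s ≠ 0) (hαβ : α - β ≠ 0)
  (hZ : (1 - C (s * α) * X) * (Z : ℂ⟦X⟧) ^ 2 = 1 - C (s * β) * X)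
include hs hαβ hZ

/-- The correction term of `shiftSer_mul_sq` is a coefficient of z^(2m+1), hence an `eCoeff`. The
residues with the Bergman kernel satisfy the same recursion in m. -/
theorem insertSer_add_one (m : ℤ) (a : ℕ) : insertSer s α β Z (m + 1) a =
    (Z : ℂ⟦X⟧) ^ 2 * insertSer s α β Z m a +
      (2 * (2 * m + 1) * eCoeff s α β Z m a) • eSer s α β Z 0 := by
  have hz : ((Z ^ (2 * (m + 1)) : ℂ⟦X⟧ˣ) : ℂ⟦X⟧) =
      ((Z ^ (2 * m) : ℂ⟦X⟧ˣ) : ℂ⟦X⟧) * (Z : ℂ⟦X⟧) ^ 2 := by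
    rw [mul_add, mul_one, coe_zpow_add]
    norm_cast
  have h1 := shiftSer_mul_sq hαβ hZ a (yOfSer s α Z * ((Z ^ (2 * m) : ℂ⟦X⟧ˣ) : ℂ⟦X⟧))
  have h2 : yOfSer s α Z * ((Z ^ (2 * m) : ℂ⟦X⟧ˣ) : ℂ⟦X⟧) * dSer α β Z =
      C (α - β) * ((Z ^ (2 * m + 1) : ℂ⟦X⟧ˣ) : ℂ⟦X⟧) := by
    rw [coe_zpow_add, zpow_one, yOfSer, ← dSer_mul hZ]
    ring
  have h3 := mul_coeff_zpow hs hαβ hZ m a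
  have h4 := X_mul_dSer hZ
  rw [h2, coeff_C_mul] at h1
  have hc : (C (2 * (2 * m + 1) * eCoeff s α β Z m a) * C (-1 / (2 * s * (α - β))) : ℂ⟦X⟧) =
      C (a / s) * C (s / (α - β)) * C ((α - β)⁻¹ / s) * C ((α - β) *
        coeff a ((Z ^ (2 * m + 1) : ℂ⟦X⟧ˣ) : ℂ⟦X⟧)) := by
    rw [← map_mul, ← map_mul, ← map_mul, ← map_mul]
    congr 1
    field_simp
    linear_combination -h3
  have hc2 : (C (s / (α - β)) : ℂ⟦X⟧) = C ((α - β)⁻¹ / s) * C s ^ 2 := by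
    rw [← map_pow, ← map_mul]; congr 1; field_simp
  rw [insertSer, hz, ← mul_assoc, h1, insertSer, smul_eq_C_mul, eSer, mul_zero, zero_sub,
    zpow_neg_one, ← h4, kerSer]
  linear_combination (-((C s * X * dSer α β Z) ^ 2 * ((Z⁻¹ : ℂ⟦X⟧ˣ) : ℂ⟦X⟧))) * hc +
    C (a / s) * X ^ 2 * C (s / (α - β)) * dSer α β Z ^ 2 * ((Z⁻¹ : ℂ⟦X⟧ˣ) : ℂ⟦X⟧) * C ((α - β) *
        coeff a ((Z ^ (2 * m + 1) : ℂ⟦X⟧ˣ) : ℂ⟦X⟧)) * hc2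

theorem eSer_eq_sum (k : ℤ) : eSer s α β Z k = C s⁻¹ * (yOfSer s α Z *
    ∑ i ∈ Finset.range 4, kerCoeff α β i • ((Z ^ (2 * (k - 1 + i)) : ℂ⟦X⟧ˣ) : ℂ⟦X⟧)) := by
  rw [← kerSer_mul_eSer hs hαβ, yOfSer]
  have h := kerSer_mul hs hαβ hZ
  have hc : C s⁻¹ * C s = (1 : ℂ⟦X⟧) := by rw [← map_mul, inv_mul_cancel₀ hs, map_one]
  linear_combination (-(C s⁻¹ * eSer s α β Z k)) * h - eSer s α β Z k * hc

omit hs hαβ hZ in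
theorem shiftSer_sum {ι : Type*} (S : Finset ι) (a : ℕ) (F : ι → ℂ⟦X⟧) :
    shiftSer a (∑ i ∈ S, F i) = ∑ i ∈ S, shiftSer a (F i) := by
  induction S using Finset.cons_induction with
  | empty => ext k; cases k <;> simp [shiftSer]
  | cons i S hi ih => rw [Finset.sum_cons, Finset.sum_cons, shiftSer_add, ih]

variable {U : ℕ → ℂ⟦X⟧}
  (hU : ∀ a, 2 * (yOfSer s α Z * U a) = -(C (a : ℂ) * X * shiftSer a (yOfSer s α Z)))
include hU

/-- Write `eSer` as y times an even Laurent polynomial in z, up to a constant. The equation `hU`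
replaces 2 `U a` by -aX `shiftSer a` y / y, so what remains is a commutator of the shift with even
powers of z. -/
theorem kerSer_mul_insert (k : ℤ) (a : ℕ) :
    kerSer s α β Z * (2 * U a * eSer s α β Z k + a • (X * shiftSer a (eSer s α β Z k))) =
      ∑ i ∈ Finset.range 4, kerCoeff α β i • insertSer s α β Z (k - 1 + i) a := by
  have h1 := eSer_eq_sum hs hαβ hZ k
  have h2 : shiftSer a (eSer s α β Z k) = C s⁻¹ * ∑ i ∈ Finset.range 4, kerCoeff α β i •
      shiftSer a (yOfSer s α Z * ((Z ^ (2 * (k - 1 + i)) : ℂ⟦X⟧ˣ) : ℂ⟦X⟧)) := by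
    rw [h1, shiftSer_C_mul, Finset.mul_sum, shiftSer_sum]
    simp only [mul_smul_comm, shiftSer_smul]
  have hc : (C (a / s) : ℂ⟦X⟧) = C (a : ℂ) * C s⁻¹ := by rw [← map_mul]; rfl
  have h3 : ∑ i ∈ Finset.range 4, kerCoeff α β i • insertSer s α β Z (k - 1 + i) a =
      C (a / s) * X * kerSer s α β Z * (∑ i ∈ Finset.range 4, kerCoeff α β i •
        shiftSer a (yOfSer s α Z * ((Z ^ (2 * (k - 1 + i)) : ℂ⟦X⟧ˣ) : ℂ⟦X⟧)) -
        (∑ i ∈ Finset.range 4, kerCoeff α β i • ((Z ^ (2 * (k - 1 + i)) : ℂ⟦X⟧ˣ) : ℂ⟦X⟧)) *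
          shiftSer a (yOfSer s α Z)) := by
    rw [Finset.sum_mul, ← Finset.sum_sub_distrib, Finset.mul_sum]
    refine Finset.sum_congr rfl fun i _ => ?_
    rw [insertSer, smul_mul_assoc, ← smul_sub, mul_smul_comm]
  rw [h3, h2, hc, h1, nsmul_eq_mul]
  have hn : ((a : ℕ) : ℂ⟦X⟧) = C (a : ℂ) := by simp
  rw [hn]
  linear_combination (kerSer s α β Z * C s⁻¹ * ∑ i ∈ Finset.range 4, kerCoeff α β i •
    ((Z ^ (2 * (k - 1 + i)) : ℂ⟦X⟧ˣ) : ℂ⟦X⟧)) * hU a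

omit hs hαβ hZ in
theorem coeff_zero_of_mul_yOfSer (h0 : constantCoeff (Z : ℂ⟦X⟧) = 1) (a : ℕ) :
    coeff 0 (U a) = 0 := by
  have h := congrArg constantCoeff (hU a)
  have h2 : constantCoeff (2 : ℂ⟦X⟧) = 2 := map_ofNat _ 2
  simpa [yOfSer, h0, h2] using h

omit hs hαβ hZ in
-- In the coefficient of X^(K+2), each j < K contributes j times the coefficient K of y. The sum
-- K(K-1)/2 of these j turns the result into a second derivative.
theorem coeff_mul_diagSer (N : ℕ) : 2 * coeff N (2 * (yOfSer s α Z * diagSer U)) =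
    -coeff N (X ^ 4 * d⁄dX ℂ (d⁄dX ℂ (yOfSer s α Z))) := by
  set Y := yOfSer s α Z
  -- Up to order N the diagonal series is a finite sum of multiples of the `U j`, so `hU` applies
  -- term by term.
  have h1 : ∀ k ≤ N, coeff k (diagSer U) =
      coeff k (∑ j ∈ Finset.range (N + 1), X ^ (j + 1) * U j) := by
    intro k hk
    rw [diagSer, coeff_mk, map_sum, ← Finset.Nat.sum_antidiagonal_swap,
      Finset.Nat.sum_antidiagonal_eq_sum_range_succ_mk, Finset.sum_range_succ']
    simp only [Prod.swap, add_zero, coeff_X_pow_mul']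
    rw [← Finset.sum_filter, Finset.range_eq_Ico, Finset.range_eq_Ico]
    refine Finset.sum_congr ?_ fun j _ => rfl
    ext j
    simp
    omega
  have h2 : coeff N (2 * (Y * diagSer U)) =
      coeff N (2 * (Y * ∑ j ∈ Finset.range (N + 1), X ^ (j + 1) * U j)) := by
    rw [← mul_assoc, ← mul_assoc, coeff_mul, coeff_mul]
    refine Finset.sum_congr rfl fun p hp => ?_
    rw [h1]
    have := Finset.HasAntidiagonal.mem_antidiagonal.mp hp
    omega
  have h3 : 2 * (Y * ∑ j ∈ Finset.range (N + 1), X ^ (j + 1) * U j) =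
      -∑ j ∈ Finset.range (N + 1), C (j : ℂ) * (X ^ (j + 2) * shiftSer j Y) := by
    rw [Finset.mul_sum, Finset.mul_sum, ← Finset.sum_neg_distrib]
    refine Finset.sum_congr rfl fun j _ => ?_
    linear_combination X ^ (j + 1) * hU j
  rw [h2, h3, map_neg, mul_neg, neg_inj, map_sum]
  simp only [coeff_C_mul, coeff_X_pow_mul']
  rcases N with _ | _ | K
  · simp
  · simp
  · have h4 : ∀ j ∈ Finset.range (K + 1 + 1 + 1), ((j : ℂ) * if j + 2 ≤ K + 1 + 1 then
        coeff (K + 1 + 1 - (j + 2)) (shiftSer j Y) else 0) =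
        if j < K then (j : ℂ) * coeff K Y else 0 := by
      intro j _
      rcases lt_trichotomy j K with h | rfl | h
      · obtain ⟨m, rfl⟩ := Nat.exists_eq_add_of_lt h
        rw [if_pos (by omega), if_pos h, show j + m + 1 + 1 + 1 - (j + 2) = m + 1 by omega,
          coeff_succ_shiftSer]
        congr 3; omega
      · rw [if_neg (lt_irrefl _), if_pos le_rfl, show j + 1 + 1 - (j + 2) = 0 by omega,
          coeff_zero_shiftSer, mul_zero]
      · rw [if_neg (by omega), if_neg (by omega), mul_zero]
    rw [Finset.sum_congr rfl h4, ← Finset.sum_filter]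
    have h5 : (Finset.range (K + 1 + 1 + 1)).filter (· < K) = Finset.range K := by
      ext j; simp; omega
    rw [h5, ← Finset.sum_mul, ← Nat.cast_sum]
    have h6 := Finset.sum_range_id_mul_two K
    rcases K with _ | _ | K
    · simp
    · simp
    · rw [if_pos (by omega), show K + 1 + 1 + 1 + 1 - 4 = K by omega, coeff_derivative,
        coeff_derivative]
      have h7 := congrArg (Nat.cast (R := ℂ)) h6
      rw [show K + 1 + 1 - 1 = K + 1 by omega] at h7
      push_cast at h7 ⊢
      linear_combination coeff (K + 1 + 1) Y * h7

omit hs hαβ hU in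
theorem yOfSer_sq : yOfSer s α Z ^ 2 = (1 - C (s * α) * X) * (1 - C (s * β) * X) := by
  rw [yOfSer]; linear_combination (1 - C (s * α) * X) * hZ

/-- `coeff_mul_diagSer` expresses the diagonal by the second derivative Y'' of Y. As Y² is a
quadratic polynomial in X, 4Y³Y'' is minus its discriminant (sα - sβ)². -/
theorem diagSer_eq (h0 : constantCoeff (Z : ℂ⟦X⟧) = 1) :
    diagSer U = C (1 / 4) * (eSer s α β Z 0 * eSer s α β Z (-1)) := by
  set Y := yOfSer s α Z with hY
  have h1 : 4 * (Y * diagSer U) = -(X ^ 4 * d⁄dX ℂ (d⁄dX ℂ Y)) := by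
    ext N
    have := coeff_mul_diagSer hU N
    rw [map_neg, ← this, show (4 * (Y * diagSer U)) = C 2 * (2 * (Y * diagSer U)) by
      rw [map_ofNat]; ring, coeff_C_mul]
  have h2 := yOfSer_sq hZ
  rw [← hY] at h2
  have h3 := congrArg (d⁄dX ℂ) h2
  simp only [Derivation.leibniz, map_sub, Derivation.map_one_eq_zero, smul_eq_mul, derivative_C,
    derivative_X, Derivation.leibniz_pow, mul_zero, add_zero, mul_one, zero_sub,
    nsmul_eq_mul, Nat.cast_ofNat, pow_one, Nat.reduceSub] at h3
  have h4 := congrArg (d⁄dX ℂ) h3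
  have hd2 : d⁄dX ℂ (2 : ℂ⟦X⟧) = 0 := by
    rw [← map_ofNat C 2]; exact derivative_C
  simp only [Derivation.leibniz, map_sub, map_add, map_neg, Derivation.map_one_eq_zero, smul_eq_mul,
    derivative_C, hd2, derivative_X, mul_zero, add_zero, mul_one, zero_sub] at h4
  have h5 : 4 * Y ^ 3 * d⁄dX ℂ (d⁄dX ℂ Y) = -C (s * α - s * β) ^ 2 := by
    rw [map_sub]
    linear_combination 2 * Y ^ 2 * h4 - (2 * (Y * d⁄dX ℂ Y) + ((1 - C (s * α) * X) * -C (s * β) +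
      (1 - C (s * β) * X) * -C (s * α))) * h3 + 4 * C (s * α) * C (s * β) * h2
  have hu : IsUnit Y := by
    rw [isUnit_iff_constantCoeff, hY, yOfSer]; simp [h0]
  have h6 := X_mul_dSer hZ
  have h7 := dSer_mul hZ
  have hz : ((Z ^ (2 * 0 - 1 : ℤ) : ℂ⟦X⟧ˣ) : ℂ⟦X⟧) * ((Z ^ (2 * (-1) - 1 : ℤ) : ℂ⟦X⟧ˣ) : ℂ⟦X⟧) *
      (Z : ℂ⟦X⟧) ^ 4 = 1 := by
    rw [← Units.val_pow_eq_pow_val, ← zpow_natCast, ← coe_zpow_add, ← coe_zpow_add]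
    simp
  have hc : C (1 / 4) * C (-1 / (2 * s * (α - β))) ^ 2 * (16 * C (α - β) ^ 4 * C s ^ 4) =
      (C (s * α - s * β) ^ 2 : ℂ⟦X⟧) := by
    rw [← map_ofNat C 16]
    simp only [← map_pow, ← map_mul]
    congr 1
    field_simp
    ring
  refine (hu.pow 4).mul_left_cancel ((show IsUnit (16 : ℂ⟦X⟧) from ?_).mul_left_cancel ?_)
  · rw [isUnit_iff_constantCoeff, map_ofNat]; norm_num
  have h8 : 16 * (Y ^ 4 * (C (1 / 4) * (eSer s α β Z 0 * eSer s α β Z (-1)))) =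
      C (s * α - s * β) ^ 2 * X ^ 4 := by
    rw [← hc, eSer, eSer, ← h6, hY, yOfSer, ← h7]
    linear_combination (16 * C (1 / 4) * C (-1 / (2 * s * (α - β))) ^ 2 * C s ^ 4 * X ^ 4 *
      (dSer α β Z * (1 - C (s * α) * X)) ^ 4) * hz
  rw [h8]
  linear_combination 4 * Y ^ 3 * h1 - X ^ 4 * h5

end

end UnstableSeries

/-! ### Polynomials inside power series, and their values at 1/c -/

section DegreeBound

open PowerSeries

/-- The power series `F` is a polynomial of degree at most `N`. -/
def DegreeLE (N : ℕ) (F : ℂ⟦X⟧) : Prop := ∀ k, N < k → coeff k F = 0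

theorem DegreeLE.mono {M N : ℕ} {F : ℂ⟦X⟧} (h : DegreeLE M F) (hMN : M ≤ N) : DegreeLE N F :=
  fun k hk => h k (hMN.trans_lt hk)

theorem DegreeLE.add {N : ℕ} {F G : ℂ⟦X⟧} (hF : DegreeLE N F) (hG : DegreeLE N G) :
    DegreeLE N (F + G) := fun k hk => by rw [map_add, hF k hk, hG k hk, add_zero]

theorem DegreeLE.sub {N : ℕ} {F G : ℂ⟦X⟧} (hF : DegreeLE N F) (hG : DegreeLE N G) :
    DegreeLE N (F - G) := fun k hk => by rw [map_sub, hF k hk, hG k hk, sub_zero]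

theorem DegreeLE.mul {M N : ℕ} {F G : ℂ⟦X⟧} (hF : DegreeLE M F) (hG : DegreeLE N G) :
    DegreeLE (M + N) (F * G) := fun k hk => by
  rw [coeff_mul]
  refine Finset.sum_eq_zero fun p hp => ?_
  have := Finset.HasAntidiagonal.mem_antidiagonal.mp hp
  by_cases h : M < p.1
  · rw [hF _ h, zero_mul]
  · rw [hG _ (by omega), mul_zero]

theorem degreeLE_C (c : ℂ) : DegreeLE 0 (C c) := fun k hk => by
  rw [coeff_C, if_neg (by omega)]

theorem degreeLE_one : DegreeLE 0 (1 : ℂ⟦X⟧) := by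
  rw [← map_one C]; exact degreeLE_C 1

theorem degreeLE_X_pow (n : ℕ) : DegreeLE n (X ^ n : ℂ⟦X⟧) := fun k hk => by
  rw [coeff_X_pow, if_neg (by omega)]

theorem degreeLE_one_sub (c : ℂ) : DegreeLE 1 (1 - C c * X : ℂ⟦X⟧) := by
  refine (degreeLE_one.mono zero_le_one).sub ?_
  have := (degreeLE_C c).mul (degreeLE_X_pow 1)
  rwa [pow_one, zero_add] at this

theorem degreeLE_trunc (n : ℕ) (F : ℂ⟦X⟧) : DegreeLE n (trunc (n + 1) F : ℂ⟦X⟧) := fun k hk => by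
  rw [Polynomial.coeff_coe, coeff_trunc, if_neg (by omega)]

theorem coeff_trunc_mul (n : ℕ) (F J : ℂ⟦X⟧) :
    coeff n ((trunc (n + 1) F : ℂ⟦X⟧) * J) = coeff n (F * J) := by
  rw [coeff_mul, coeff_mul]
  refine Finset.sum_congr rfl fun p hp => ?_
  have := Finset.HasAntidiagonal.mem_antidiagonal.mp hp
  rw [Polynomial.coeff_coe, coeff_trunc, if_pos (by omega)]

theorem X_pow_mul_shiftSer (a : ℕ) (F : ℂ⟦X⟧) :
    X ^ a * shiftSer a F = F - (trunc (a + 1) F : ℂ⟦X⟧) := by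
  ext k
  rw [coeff_X_pow_mul', map_sub, Polynomial.coeff_coe, coeff_trunc]
  rcases lt_trichotomy k a with h | rfl | h
  · rw [if_neg (by omega), if_pos (by omega), sub_self]
  · rw [if_pos le_rfl, Nat.sub_self, coeff_zero_shiftSer, if_pos (by omega), sub_self]
  · obtain ⟨m, rfl⟩ := Nat.exists_eq_add_of_lt h
    rw [if_pos (by omega), if_neg (by omega), show a + m + 1 - a = m + 1 by omega,
      coeff_succ_shiftSer, sub_zero]
    congr 2; omega

theorem coeff_add_of_mul_geometric {c : ℂ} {J F : ℂ⟦X⟧} (hJ : (1 - C c * X) * J = 1) {a : ℕ}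
    (hF : DegreeLE a F) (n : ℕ) : coeff (a + n) (F * J) = c ^ n * coeff a (F * J) := by
  have h : F * J = F + C c * (X * (F * J)) := by linear_combination F * hJ
  induction n with
  | zero => simp
  | succ n ih =>
    conv_lhs => rw [h]
    rw [map_add, hF _ (by omega), zero_add, coeff_C_mul, show a + (n + 1) = a + n + 1 by omega,
      coeff_succ_X_mul, ih]
    ring

/-- For c ≠ 0 both sides are c^(a+b+1) F(1/c) G(1/c). Working with coefficients also covers c = 0,
which occurs when α or β is 0. -/
theorem coeff_mul_mul_geometric {c : ℂ} {J F G : ℂ⟦X⟧} (hJ : (1 - C c * X) * J = 1) {a b : ℕ}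
    (hF : DegreeLE a F) (hG : DegreeLE b G) :
    coeff (a + b + 1) (F * G * J) = c * (coeff a (F * J) * coeff b (G * J)) := by
  set r := coeff a (F * J) with hr
  have hJn : ∀ n, coeff n J = c ^ n := fun n => by
    have h := coeff_add_of_mul_geometric hJ degreeLE_one n
    have h0 : coeff 0 J = 1 := by
      have := congrArg constantCoeff hJ
      simpa using this
    rwa [zero_add, one_mul, h0, mul_one] at h
  have hL : DegreeLE a (F * J - C r * (X ^ a * J)) := fun k hk => by
    obtain ⟨m, rfl⟩ := Nat.exists_eq_add_of_lt hk
    rw [map_sub, coeff_C_mul, add_assoc, coeff_add_of_mul_geometric hJ hF, coeff_X_pow_mul',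
      if_pos (by omega), add_tsub_cancel_left, hJn]
    ring
  have h1 : F * G * J = (F * J - C r * (X ^ a * J)) * G + C r * (X ^ a * (G * J)) := by ring
  rw [h1, map_add, hL.mul hG _ (by omega), zero_add, coeff_C_mul, coeff_X_pow_mul',
    if_pos (by omega), show a + b + 1 - a = b + 1 by omega, coeff_add_of_mul_geometric hJ hG]
  ring

end DegreeBound

/-! ### The genus 0 three-point function -/

section GenusZeroThree

open PowerSeries

/-- For `Y ^ 2` quadratic and `U a` the solutions of the equations of the two-point functions, the
quadratic expression of the three-point functions is a quotient of polynomials. -/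
theorem exists_threePoint_numerator {c d : ℂ} {Y : ℂ⟦X⟧}
    (hY : Y ^ 2 = (1 - C c * X) * (1 - C d * X)) {U : ℕ → ℂ⟦X⟧}
    (hU : ∀ a, 2 * (Y * U a) = -(C (a : ℂ) * X * shiftSer a Y)) (hU0 : ∀ a, coeff 0 (U a) = 0)
    {J J' : ℂ⟦X⟧} (hJ : (1 - C c * X) * J = 1) (hJ' : (1 - C d * X) * J' = 1)
    {a b : ℕ} (ha : 0 < a) (hb : 0 < b) :
    ∃ p q : ℂ, 2 * Y ^ 2 * (2 * (U a * U b) + C (a : ℂ) * (X * shiftSer a (U b)) +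
        C (b : ℂ) * (X * shiftSer b (U a))) = C p * X ^ 2 + C q * X ^ 3 ∧
      q + c * p = a * b * c * (coeff a (Y * J) * coeff b (Y * J)) ∧
      q + d * p = a * b * d * (coeff a (Y * J') * coeff b (Y * J')) := by
  set V := 2 * (U a * U b) + C (a : ℂ) * (X * shiftSer a (U b)) +
        C (b : ℂ) * (X * shiftSer b (U a)) with hV
  set A : ℂ⟦X⟧ := (trunc (a + 1) Y : ℂ⟦X⟧) with hA
  set B : ℂ⟦X⟧ := (trunc (b + 1) Y : ℂ⟦X⟧) with hB
  set ub : ℂ⟦X⟧ := (trunc (a + 1) (U b) : ℂ⟦X⟧) with hub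
  set ua : ℂ⟦X⟧ := (trunc (b + 1) (U a) : ℂ⟦X⟧) with hua
  have dA := degreeLE_trunc a Y
  have dB := degreeLE_trunc b Y
  have dub := degreeLE_trunc a (U b)
  have dua := degreeLE_trunc b (U a)
  have hAY := X_pow_mul_shiftSer a Y
  have hBY := X_pow_mul_shiftSer b Y
  have hbU := X_pow_mul_shiftSer a (U b)
  have haU := X_pow_mul_shiftSer b (U a)
  rw [← hA] at dA hAY
  rw [← hB] at dB hBY
  rw [← hub] at dub hbU
  rw [← hua] at dua haU
  have hUa : X ^ a * (2 * (Y * U a)) = C (a : ℂ) * X * (A - Y) := by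
    rw [hU]; linear_combination (-C (a : ℂ) * X) * hAY
  have hUb : X ^ b * (2 * (Y * U b)) = C (b : ℂ) * X * (B - Y) := by
    rw [hU]; linear_combination (-C (b : ℂ) * X) * hBY
  -- Shifts are traded for truncations by multiplying with X^(a+b). After substitution of the
  -- two-point equations Y enters only through Y², so everything is a polynomial and `T` has degree
  -- at most 3.
  have key : X ^ (a + b) * (2 * Y ^ 2 * V) = C (a : ℂ) * C (b : ℂ) * (X ^ 2 * (A * B)) -
      (C (a : ℂ) * C (b : ℂ) * X ^ 2 + 2 * C (a : ℂ) * (X ^ (b + 1) * ub) +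
        2 * C (b : ℂ) * (X ^ (a + 1) * ua)) * Y ^ 2 := by
    rw [hV, pow_add]
    linear_combination (X ^ b * (2 * (Y * U b))) * hUa + C (a : ℂ) * X * (A - Y) * hUb +
      (2 * C (a : ℂ) * X ^ b * X * Y ^ 2) * hbU + C (a : ℂ) * X * Y * hUb +
      (2 * C (b : ℂ) * X ^ a * X * Y ^ 2) * haU + C (b : ℂ) * X * Y * hUa
  have d2 : DegreeLE 0 (2 : ℂ⟦X⟧) := by rw [← map_ofNat C 2]; exact degreeLE_C _
  have dR : DegreeLE (a + b + 1) (C (a : ℂ) * C (b : ℂ) * X ^ 2 +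
      2 * C (a : ℂ) * (X ^ (b + 1) * ub) + 2 * C (b : ℂ) * (X ^ (a + 1) * ua)) := by
    refine (DegreeLE.add ?_ ?_).add ?_
    · exact (((degreeLE_C _).mul (degreeLE_C _)).mul (degreeLE_X_pow 2)).mono (by omega)
    · exact ((d2.mul (degreeLE_C _)).mul ((degreeLE_X_pow _).mul dub)).mono (by omega)
    · exact ((d2.mul (degreeLE_C _)).mul ((degreeLE_X_pow _).mul dua)).mono (by omega)
  set R := C (a : ℂ) * C (b : ℂ) * X ^ 2 +
      2 * C (a : ℂ) * (X ^ (b + 1) * ub) + 2 * C (b : ℂ) * (X ^ (a + 1) * ua)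
  have dAB : DegreeLE (a + b + 2) (C (a : ℂ) * C (b : ℂ) * (X ^ 2 * (A * B))) :=
    (((degreeLE_C _).mul (degreeLE_C _)).mul ((degreeLE_X_pow 2).mul (dA.mul dB))).mono (by omega)
  have dT : DegreeLE (a + b + 3) (X ^ (a + b) * (2 * Y ^ 2 * V)) := by
    rw [key, hY]
    exact (dAB.mono (by omega)).sub ((dR.mul ((degreeLE_one_sub c).mul (degreeLE_one_sub d))).mono
      (by omega))
  set T := 2 * Y ^ 2 * V with hT
  have cV0 : coeff 0 V = 0 := by
    have hz : ∀ a, constantCoeff (U a) = 0 := fun a => by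
      rw [← coeff_zero_eq_constantCoeff_apply, hU0]
    simp [hV, hz]
  have cV1 : coeff 1 V = 0 := by
    have h1 : ∀ n F, coeff 1 (C n * (X * shiftSer a F)) = 0 := fun n F => by
      rw [coeff_C_mul, show 1 = 0 + 1 from rfl, coeff_succ_X_mul, coeff_zero_shiftSer, mul_zero]
    have h2 : ∀ n F, coeff 1 (C n * (X * shiftSer b F)) = 0 := fun n F => by
      rw [coeff_C_mul, show 1 = 0 + 1 from rfl, coeff_succ_X_mul, coeff_zero_shiftSer, mul_zero]
    rw [hV, map_add, map_add, h1, h2, ← map_ofNat C 2, coeff_C_mul,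
      coeff_one_mul_of_zero (hU0 a) (hU0 b)]
    simp
  have cT0 : coeff 0 T = 0 := by
    rw [hT, coeff_mul]; simp [cV0, -coeff_zero_eq_constantCoeff]
  have cT1 : coeff 1 T = 0 := by
    rw [hT, coeff_mul]
    simp [Finset.Nat.antidiagonal_succ, cV0, cV1, -coeff_zero_eq_constantCoeff]
  have hTpq : T = C (coeff 2 T) * X ^ 2 + C (coeff 3 T) * X ^ 3 := by
    ext k
    rw [map_add, coeff_C_mul, coeff_C_mul, coeff_X_pow, coeff_X_pow]
    rcases k with _ | _ | _ | _ | k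
    · simpa using cT0
    · simpa using cT1
    · simp
    · simp
    · have := dT (a + b + (k + 4)) (by omega)
      rw [coeff_X_pow_mul', if_pos (by omega), add_tsub_cancel_left] at this
      simpa using this
  -- Evaluation at the zero 1/c of Y², where the term with `R` drops out: divided by 1 - cX, that
  -- term has degree at most a+b+2, below the coefficient a+b+3 that is read off.
  have main : ∀ {c d : ℂ} {J : ℂ⟦X⟧}, Y ^ 2 = (1 - C c * X) * (1 - C d * X) →
      (1 - C c * X) * J = 1 →
      coeff 3 T + c * coeff 2 T = a * b * c * (coeff a (Y * J) * coeff b (Y * J)) := by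
    intro c d J hY hJ
    have h1 : X ^ (a + b) * T * J = C (a : ℂ) * C (b : ℂ) * (X ^ 2 * (A * B * J)) -
        R * (1 - C d * X) := by
      rw [key, hY]
      linear_combination (-R * (1 - C d * X)) * hJ
    have h2 := congrArg (coeff (a + b + 3)) h1
    have hJ0 : constantCoeff J = 1 := by
      have := congrArg constantCoeff hJ
      simpa using this
    have hJ1 : coeff 1 J = c := by
      have := congrArg (coeff 1) hJ
      rw [sub_mul, one_mul, mul_assoc, map_sub, coeff_C_mul, show 1 = 0 + 1 from rfl,
        coeff_succ_X_mul] at this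
      simp [hJ0] at this
      linear_combination this
    have h3 : coeff (a + b + 3) (X ^ (a + b) * T * J) = coeff 3 T + c * coeff 2 T := by
      rw [mul_assoc, coeff_X_pow_mul', if_pos (by omega), add_tsub_cancel_left]
      conv_lhs => rw [hTpq]
      rw [add_mul, mul_assoc, mul_assoc, map_add, coeff_C_mul, coeff_C_mul, coeff_X_pow_mul',
        coeff_X_pow_mul', if_pos (by norm_num), if_pos le_rfl]
      simp [hJ0, hJ1]; ring
    rw [h3, map_sub, (dR.mul (degreeLE_one_sub d)) _ (by omega), sub_zero, mul_assoc, coeff_C_mul,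
      coeff_C_mul, coeff_X_pow_mul', if_pos (by omega), show a + b + 3 - 2 = a + b + 1 by omega,
      coeff_mul_mul_geometric hJ dA dB, hA, hB, coeff_trunc_mul, coeff_trunc_mul] at h2
    rw [h2]; ring
  exact ⟨coeff 2 T, coeff 3 T, hTpq, main hY hJ, main (by rw [hY, mul_comm]) hJ'⟩

variable {s α β : ℂ} {Z : ℂ⟦X⟧ˣ} (hs : s ≠ 0) (hαβ : α - β ≠ 0)
  (hZ : (1 - C (s * α) * X) * (Z : ℂ⟦X⟧) ^ 2 = 1 - C (s * β) * X)
  {U : ℕ → ℂ⟦X⟧}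
  (hU : ∀ a, 2 * (yOfSer s α Z * U a) = -(C (a : ℂ) * X * shiftSer a (yOfSer s α Z)))
include hs hαβ hZ hU

/-- Dividing y by 1 - sαX gives z, and dividing it by 1 - sβX gives 1/z. The two values of the
numerator are therefore products of coefficients of z and of 1/z, that is of `eCoeff` at 0 and at
-1, and they determine the numerator. -/
theorem kerSer_mul_threePoint (h0 : constantCoeff (Z : ℂ⟦X⟧) = 1) (a b : ℕ) :
    kerSer s α β Z * (2 * (U a * U b) + C (a : ℂ) * (X * shiftSer a (U b)) +
        C (b : ℂ) * (X * shiftSer b (U a))) =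
      (-α / (α - β) ^ 2 * (eCoeff s α β Z 0 a * eCoeff s α β Z 0 b)) • eSer s α β Z 0 +
      (β / (α - β) ^ 2 * (eCoeff s α β Z (-1) a * eCoeff s α β Z (-1) b)) • eSer s α β Z (-1) := by
  have hu : IsUnit (yOfSer s α Z) := by
    rw [isUnit_iff_constantCoeff, yOfSer]; simp [h0]
  have h2 : IsUnit (2 : ℂ⟦X⟧) := by rw [isUnit_iff_constantCoeff, map_ofNat]; norm_num
  -- `exists_threePoint_numerator` needs positive degrees; in degree 0 both sides vanish.
  have hU00 : U 0 = 0 := by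
    refine hu.mul_left_cancel (h2.mul_left_cancel ?_)
    rw [hU]; simp
  have hs0 : ∀ n, shiftSer n 0 = 0 := fun n => by
    have := shiftSer_smul n 0 0; simpa using this
  rcases Nat.eq_zero_or_pos a with rfl | ha
  · simp [hU00, hs0, eCoeff_zero hs hαβ hZ]
  rcases Nat.eq_zero_or_pos b with rfl | hb
  · simp [hU00, hs0, eCoeff_zero hs hαβ hZ]
  have hgeom : ∀ c : ℂ, ∃ J : ℂ⟦X⟧, (1 - C c * X) * J = 1 := fun c =>
    ⟨_, PowerSeries.mul_inv_cancel _ (by simp)⟩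
  obtain ⟨J, hJ⟩ := hgeom (s * α)
  obtain ⟨J', hJ'⟩ := hgeom (s * β)
  obtain ⟨p, q, hT, hp, hq⟩ := exists_threePoint_numerator (yOfSer_sq hZ) hU
    (coeff_zero_of_mul_yOfSer hU h0) hJ hJ' ha hb
  have hYJ : yOfSer s α Z * J = ((Z ^ (2 * 0 + 1 : ℤ) : ℂ⟦X⟧ˣ) : ℂ⟦X⟧) := by
    rw [mul_zero, zero_add, zpow_one, yOfSer]; linear_combination Z * hJ
  have hYJ' : yOfSer s α Z * J' = ((Z ^ (2 * (-1) + 1 : ℤ) : ℂ⟦X⟧ˣ) : ℂ⟦X⟧) := by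
    have : (Z : ℂ⟦X⟧) * ((Z⁻¹ : ℂ⟦X⟧ˣ) : ℂ⟦X⟧) = 1 := by simp
    rw [show (2 * (-1) + 1 : ℤ) = -1 by norm_num, zpow_neg_one, yOfSer]
    linear_combination ((Z⁻¹ : ℂ⟦X⟧ˣ) : ℂ⟦X⟧) * hJ' + ((Z⁻¹ : ℂ⟦X⟧ˣ) : ℂ⟦X⟧) * J' * hZ -
      (1 - C (s * α) * X) * Z * J' * this
  have e0 : ∀ n : ℕ, n * coeff n ((Z ^ (2 * 0 + 1 : ℤ) : ℂ⟦X⟧ˣ) : ℂ⟦X⟧) =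
      -eCoeff s α β Z 0 n := fun n => by rw [mul_coeff_zpow hs hαβ hZ 0 n]; simp
  have e1 : ∀ n : ℕ, n * coeff n ((Z ^ (2 * (-1) + 1 : ℤ) : ℂ⟦X⟧ˣ) : ℂ⟦X⟧) =
      eCoeff s α β Z (-1) n := fun n => by
    rw [mul_coeff_zpow hs hαβ hZ (-1) n]; push_cast; ring
  rw [hYJ] at hp
  rw [hYJ'] at hq
  have hp' : q + s * α * p = s * α * (eCoeff s α β Z 0 a * eCoeff s α β Z 0 b) := by
    have h1 := e0 a
    have h2 := e0 b
    rw [hp]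
    linear_combination s * α * (b * coeff b ((Z ^ (2 * 0 + 1 : ℤ) : ℂ⟦X⟧ˣ) : ℂ⟦X⟧)) * h1 -
      s * α * eCoeff s α β Z 0 a * h2
  have hq' : q + s * β * p = s * β * (eCoeff s α β Z (-1) a * eCoeff s α β Z (-1) b) := by
    have h1 := e1 a
    have h2 := e1 b
    rw [hq]
    linear_combination s * β * (b * coeff b ((Z ^ (2 * (-1) + 1 : ℤ) : ℂ⟦X⟧ˣ) : ℂ⟦X⟧)) * h1 +
      s * β * eCoeff s α β Z (-1) a * h2
  set A := eCoeff s α β Z 0 a * eCoeff s α β Z 0 b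
  set B := eCoeff s α β Z (-1) a * eCoeff s α β Z (-1) b
  have hker := kerSer_mul hs hαβ hZ
  have h6 := X_mul_dSer hZ
  have h7 := dSer_mul hZ
  have hz0 : ((Z ^ (2 * 0 - 1 : ℤ) : ℂ⟦X⟧ˣ) : ℂ⟦X⟧) * (Z : ℂ⟦X⟧) = 1 := by
    rw [mul_zero, zero_sub, zpow_neg_one, Units.inv_mul]
  have hz1 : ((Z ^ (2 * (-1) - 1 : ℤ) : ℂ⟦X⟧ˣ) : ℂ⟦X⟧) * (Z : ℂ⟦X⟧) ^ 3 = 1 := by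
    rw [← Units.val_pow_eq_pow_val, ← zpow_natCast, ← coe_zpow_add]
    simp
  have hE0 : yOfSer s α Z ^ 3 * eSer s α β Z 0 =
      C (-(s * (α - β)) / 2) * X ^ 2 * (1 - C (s * β) * X) := by
    have hc : (C (-(s * (α - β)) / 2) : ℂ⟦X⟧) =
        C (-1 / (2 * s * (α - β))) * C s ^ 2 * C (α - β) ^ 2 := by
      simp only [← map_pow, ← map_mul]; congr 1; field_simp
    rw [hc, ← h7, ← hZ, eSer, ← h6, yOfSer]
    linear_combination (C (-1 / (2 * s * (α - β))) * C s ^ 2 * (dSer α β Z) ^ 2 *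
      (1 - C (s * α) * X) ^ 3 * X ^ 2 * (Z : ℂ⟦X⟧) ^ 2) * hz0
  have hE1 : yOfSer s α Z ^ 3 * eSer s α β Z (-1) =
      C (-(s * (α - β)) / 2) * X ^ 2 * (1 - C (s * α) * X) := by
    have hc : (C (-(s * (α - β)) / 2) : ℂ⟦X⟧) =
        C (-1 / (2 * s * (α - β))) * C s ^ 2 * C (α - β) ^ 2 := by
      simp only [← map_pow, ← map_mul]; congr 1; field_simp
    rw [hc, ← h7, eSer, ← h6, yOfSer]
    linear_combination (C (-1 / (2 * s * (α - β))) * C s ^ 2 * (dSer α β Z) ^ 2 *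
      (1 - C (s * α) * X) ^ 3 * X ^ 2) * hz1
  refine (hu.pow 3).mul_left_cancel (h2.mul_left_cancel ?_)
  rw [smul_eq_C_mul, smul_eq_C_mul]
  have hpc : (C s * C p : ℂ⟦X⟧) = 2 * C (-(s * (α - β)) / 2) *
      (C (-α / (α - β) ^ 2 * A) + C (β / (α - β) ^ 2 * B)) := by
    rw [← map_ofNat C 2]
    simp only [← map_mul, ← map_add]
    congr 1
    field_simp
    exact mul_left_cancel₀ hs (by linear_combination hp' - hq')
  have hqc : (C s * C q : ℂ⟦X⟧) = -(2 * C (-(s * (α - β)) / 2) *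
      (C (-α / (α - β) ^ 2 * A) * C (s * β) + C (β / (α - β) ^ 2 * B) * C (s * α))) := by
    rw [← map_ofNat C 2]
    simp only [← map_mul, ← map_add, ← map_neg]
    congr 1
    field_simp
    linear_combination α * hq' - β * hp'
  rw [← yOfSer] at hker
  linear_combination (2 * yOfSer s α Z ^ 2 * (2 * (U a * U b) + C (a : ℂ) * (X * shiftSer a (U b)) +
        C (b : ℂ) * (X * shiftSer b (U a)))) * hker + C s * hT -
    2 * C (-α / (α - β) ^ 2 * A) * hE0 - 2 * C (β / (α - β) ^ 2 * B) * hE1 +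
    X ^ 2 * hpc + X ^ 3 * hqc

end GenusZeroThree

/-! ### Residues at the ramification points 0 and ∞ -/

section Residues

open Filter Topology

/-- The function `f` has residue `c` at `0`. -/
def HasResZero (f : ℂ → ℂ) (c : ℂ) : Prop :=
  ∀ᶠ r : ℝ in 𝓝[>] 0, CircleIntegrable f 0 r ∧
    (2 * (Real.pi : ℂ) * Complex.I)⁻¹ * circleIntegral f 0 r = c

theorem HasResZero.residueZero_eq {f : ℂ → ℂ} {c : ℂ} (h : HasResZero f c) : residueZero f = c := by
  refine Tendsto.limUnder_eq (tendsto_const_nhds.congr' ?_)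
  filter_upwards [h] with r hr
  exact hr.2.symm

theorem HasResZero.add {f g : ℂ → ℂ} {c d : ℂ} (hf : HasResZero f c) (hg : HasResZero g d) :
    HasResZero (fun z => f z + g z) (c + d) := by
  filter_upwards [hf, hg] with r h1 h2
  refine ⟨h1.1.add h2.1, ?_⟩
  rw [circleIntegral.integral_add h1.1 h2.1, mul_add, h1.2, h2.2]

theorem HasResZero.const_mul {f : ℂ → ℂ} {c : ℂ} (a : ℂ) (hf : HasResZero f c) :
    HasResZero (fun z => a * f z) (a * c) := by
  filter_upwards [hf] with r h1
  refine ⟨h1.1.const_mul a, ?_⟩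
  rw [circleIntegral.integral_const_mul, mul_left_comm, h1.2]

theorem eventually_sphere {p : ℂ → Prop} (h : ∀ᶠ z in 𝓝[≠] (0 : ℂ), p z) :
    ∀ᶠ r : ℝ in 𝓝[>] 0, 0 < r ∧ ∀ z ∈ Metric.sphere (0 : ℂ) r, p z := by
  rw [eventually_nhdsWithin_iff, Metric.eventually_nhds_iff] at h
  obtain ⟨ε, hε, h⟩ := h
  filter_upwards [Ioo_mem_nhdsGT hε] with r hr
  refine ⟨hr.1, fun z hz => ?_⟩
  have hz' : ‖z‖ = r := by simpa using hz
  refine h (by simpa [hz'] using hr.2) ?_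
  simp only [Set.mem_compl_iff, Set.mem_singleton_iff]
  rintro rfl
  simp at hz'
  exact hr.1.ne hz'

theorem HasResZero.congr {f g : ℂ → ℂ} {c : ℂ} (hf : HasResZero f c)
    (h : ∀ᶠ z in 𝓝[≠] (0 : ℂ), f z = g z) : HasResZero g c := by
  filter_upwards [hf, eventually_sphere h] with r h1 h2
  refine ⟨h1.1.congr ?_, ?_⟩
  · intro z hz
    exact h2.2 _ (circleMap_mem_sphere 0 h2.1.le z)
  · rw [← h1.2]
    congr 1
    exact circleIntegral.integral_congr h2.1.le fun z hz => (h2.2 z hz).symm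

theorem AnalyticAt.hasResZero_inv_mul {g : ℂ → ℂ} (hg : AnalyticAt ℂ g 0) :
    HasResZero (fun z => z⁻¹ * g z) (g 0) := by
  obtain ⟨ε, hε, hb⟩ := Metric.eventually_nhds_iff.mp hg.eventually_analyticAt
  filter_upwards [Ioo_mem_nhdsGT hε] with r hr
  have hd : ∀ z ∈ Metric.closedBall (0 : ℂ) r, AnalyticAt ℂ g z := fun z hz => hb (by
    have := Metric.mem_closedBall.mp hz
    exact this.trans_lt hr.2)
  have hcont : ContinuousOn g (Metric.closedBall (0 : ℂ) r) := fun z hz =>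
    (hd z hz).continuousAt.continuousWithinAt
  refine ⟨?_, ?_⟩
  · refine ContinuousOn.circleIntegrable hr.1.le ?_
    refine ContinuousOn.mul (continuousOn_id.inv₀ fun z hz => ?_)
      (hcont.mono Metric.sphere_subset_closedBall)
    have : ‖z‖ = r := by simpa using hz
    rw [id, ← norm_ne_zero_iff, this]
    exact hr.1.ne'
  · have h := Complex.circleIntegral_sub_inv_smul_of_differentiable_on_off_countable
      (s := ∅) Set.countable_empty (c := (0 : ℂ)) (w := 0) (R := r) (f := g)
      (by simpa using hr.1) hcont
      (fun z hz => (hd z (Metric.ball_subset_closedBall hz.1)).differentiableAt)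
    simp only [sub_zero, smul_eq_mul] at h
    rw [h, inv_mul_cancel_left₀ Complex.two_pi_I_ne_zero]

theorem hasResZero_of_eq {f g : ℂ → ℂ} (hg : AnalyticAt ℂ g 0)
    (h : ∀ᶠ z in 𝓝[≠] (0 : ℂ), f z = z⁻¹ * g z) : HasResZero f (g 0) :=
  hg.hasResZero_inv_mul.congr (h.mono fun _ hz => hz.symm)

theorem hasResZero_zpow (k : ℤ) : HasResZero (fun z => z ^ k) (if k = -1 then 1 else 0) := by
  have hci : ∀ᶠ r : ℝ in 𝓝[>] 0, CircleIntegrable (fun z : ℂ => z ^ k) 0 r := by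
    filter_upwards [self_mem_nhdsWithin] with r (hr : 0 < r)
    refine ContinuousOn.circleIntegrable hr.le fun z hz => ?_
    have : ‖z‖ = r := by simpa using hz
    exact (continuousAt_zpow₀ z k (Or.inl (norm_ne_zero_iff.mp (this ▸ hr.ne')))).continuousWithinAt
  split_ifs with h
  · subst h
    have := (analyticAt_const (v := (1 : ℂ)) (x := (0 : ℂ)) (𝕜 := ℂ)).hasResZero_inv_mul
    simpa using this
  · filter_upwards [hci] with r h1
    refine ⟨h1, ?_⟩
    have := circleIntegral.integral_sub_zpow_of_ne h 0 0 r
    simp only [sub_zero] at this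
    rw [this, mul_zero]

/-- The filter of neighbourhoods of the two ramification points `0` and `∞`. -/
noncomputable def ramificationFilter : Filter ℂ := 𝓝[≠] 0 ⊔ map (fun t => t⁻¹) (𝓝[≠] 0)

theorem eventually_ramification_ne (w : ℂ) : ∀ᶠ q in ramificationFilter, q ≠ w := by
  rw [ramificationFilter, eventually_sup, eventually_map]
  constructor
  · by_cases hw : w = 0
    · subst hw; exact self_mem_nhdsWithin
    · exact nhdsWithin_le_nhds (isOpen_ne.mem_nhds (Ne.symm hw))
  · by_cases hw : w = 0
    · subst hw
      filter_upwards [self_mem_nhdsWithin] with t ht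
      exact inv_ne_zero ht
    · filter_upwards [nhdsWithin_le_nhds (isOpen_ne.mem_nhds (inv_ne_zero hw).symm)] with t ht
      exact fun h => ht (by rw [← h, inv_inv])

/-- The sum of the residues of `f` at `0` and `∞` is `c`. -/
def HasTotalRes (f : ℂ → ℂ) (c : ℂ) : Prop :=
  ∃ c₀ c₁, HasResZero f c₀ ∧ HasResZero (fun t => f t⁻¹ * (-(t ^ 2)⁻¹)) c₁ ∧ c = c₀ + c₁

theorem HasTotalRes.residue_eq {f : ℂ → ℂ} {c : ℂ} (h : HasTotalRes f c) :
    residueZero f + residueInfinity f = c := by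
  obtain ⟨c₀, c₁, h0, h1, rfl⟩ := h
  rw [h0.residueZero_eq, residueInfinity, h1.residueZero_eq]

theorem HasTotalRes.add {f g : ℂ → ℂ} {c d : ℂ} (hf : HasTotalRes f c) (hg : HasTotalRes g d) :
    HasTotalRes (fun z => f z + g z) (c + d) := by
  obtain ⟨c₀, c₁, h0, h1, rfl⟩ := hf
  obtain ⟨d₀, d₁, k0, k1, rfl⟩ := hg
  refine ⟨_, _, h0.add k0, (h1.add k1).congr (Eventually.of_forall fun t => ?_), by ring⟩
  ring

theorem HasTotalRes.const_mul {f : ℂ → ℂ} {c : ℂ} (a : ℂ) (hf : HasTotalRes f c) :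
    HasTotalRes (fun z => a * f z) (a * c) := by
  obtain ⟨c₀, c₁, h0, h1, rfl⟩ := hf
  refine ⟨_, _, h0.const_mul a, (h1.const_mul a).congr (Eventually.of_forall fun t => ?_), by ring⟩
  ring

theorem HasTotalRes.congr {f g : ℂ → ℂ} {c : ℂ} (hf : HasTotalRes f c)
    (h : ∀ᶠ z in ramificationFilter, f z = g z) : HasTotalRes g c := by
  obtain ⟨c₀, c₁, h0, h1, rfl⟩ := hf
  rw [ramificationFilter, eventually_sup, eventually_map] at h
  exact ⟨c₀, c₁, h0.congr h.1, h1.congr (h.2.mono fun t ht => by rw [ht]), rfl⟩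

theorem HasTotalRes.sum {ι : Type*} (S : Finset ι) {f : ι → ℂ → ℂ} {c : ι → ℂ}
    (h : ∀ i ∈ S, HasTotalRes (f i) (c i)) : HasTotalRes (fun z => ∑ i ∈ S, f i z) (∑ i ∈ S, c i) := by
  classical
  induction S using Finset.induction_on with
  | empty =>
    have h0 : HasResZero (fun _ => 0) 0 := by
      have := (hasResZero_zpow 0).const_mul 0
      simpa using this
    exact ⟨0, 0, h0, by simpa using h0, by simp⟩
  | insert i S hi ih =>
    simp only [Finset.sum_insert hi]
    exact (h i (Finset.mem_insert_self _ _)).add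
      (ih fun j hj => h j (Finset.mem_insert_of_mem hj))

/-- The total residue of a function with at most simple poles at `0` and `∞`. -/
theorem hasTotalRes_of_eq {f g g' : ℂ → ℂ} (hg : AnalyticAt ℂ g 0) (hg' : AnalyticAt ℂ g' 0)
    (h : ∀ᶠ z in ramificationFilter, f z = z⁻¹ * g z)
    (h' : ∀ᶠ z in ramificationFilter, f z = -z⁻¹ * g' z⁻¹) : HasTotalRes f (g 0 + g' 0) := by
  rw [ramificationFilter, eventually_sup, eventually_map] at h h'
  refine ⟨_, _, hasResZero_of_eq hg h.1, hasResZero_of_eq hg' ?_, rfl⟩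
  filter_upwards [h'.2, self_mem_nhdsWithin] with t ht (ht0 : t ≠ 0)
  rw [ht, inv_inv]
  field_simp

theorem hasTotalRes_zpow (k : ℤ) : HasTotalRes (fun q => q ^ k) 0 := by
  refine ⟨_, _, hasResZero_zpow k, ((hasResZero_zpow (-k - 2)).const_mul (-1)).congr ?_, ?_⟩
  · filter_upwards [self_mem_nhdsWithin] with t (ht : t ≠ 0)
    rw [zpow_sub₀ ht, inv_zpow', zpow_ofNat]
    ring
  · have : -k - 2 = -1 ↔ k = -1 := by omega
    simp only [this]
    split_ifs <;> simp

/-- The remaining pole w has residue w^k. In place of the residue theorem, q^(k+1)/(q-w) = q^k + w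
q^k/(q-w) gives an induction in both directions. -/
theorem hasTotalRes_div_sub {w : ℂ} (hw : w ≠ 0) (k : ℤ) :
    HasTotalRes (fun q => q ^ k / (q - w)) (-w ^ k) := by
  have hne := (eventually_ramification_ne w).and (eventually_ramification_ne 0)
  induction k with
  | zero =>
    have h := hasTotalRes_of_eq (f := fun q => q ^ (0 : ℤ) / (q - w)) (g := fun q => q / (q - w))
      (g' := fun t => -1 / (1 - t * w))
      (by fun_prop (disch := simp [hw])) (by fun_prop (disch := simp))
      (by filter_upwards [hne] with q hq
          have := sub_ne_zero.mpr hq.1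
          have := hq.2
          simp [field])
      (by filter_upwards [hne] with q hq
          have := sub_ne_zero.mpr hq.1
          have := hq.2
          have : 1 - q⁻¹ * w ≠ 0 := by field_simp; exact div_ne_zero ‹_› (by simp [*])
          simp [field])
    simpa using h
  | succ k ih =>
    have h := (hasTotalRes_zpow k).add (ih.const_mul w)
    rw [show 0 + w * -w ^ (k : ℤ) = -w ^ (k + 1 : ℤ) by rw [zpow_add_one₀ hw]; ring] at h
    refine h.congr ?_
    filter_upwards [hne] with q hq
    have := sub_ne_zero.mpr hq.1
    rw [zpow_add_one₀ hq.2]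
    field_simp
    ring
  | pred k ih =>
    have h := (ih.add ((hasTotalRes_zpow (-k - 1)).const_mul (-1))).const_mul w⁻¹
    rw [show w⁻¹ * (-w ^ (-k : ℤ) + -1 * 0) = -w ^ (-k - 1 : ℤ) by rw [zpow_sub_one₀ hw]; ring] at h
    refine h.congr ?_
    filter_upwards [hne] with q hq
    have := sub_ne_zero.mpr hq.1
    have h3 : q ^ (-k : ℤ) = q ^ (-k - 1 : ℤ) * q := by rw [← zpow_add_one₀ hq.2, sub_add_cancel]
    rw [h3]
    field_simp
    ring

theorem hasTotalRes_div_sub_sq {w : ℂ} (hw : w ≠ 0) (k : ℤ) :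
    HasTotalRes (fun q => q ^ k / (q - w) ^ 2) (-(k * w ^ (k - 1))) := by
  have hne := (eventually_ramification_ne w).and (eventually_ramification_ne 0)
  induction k with
  | zero =>
    have h := hasTotalRes_of_eq (f := fun q => q ^ (0 : ℤ) / (q - w) ^ 2)
      (g := fun q => q / (q - w) ^ 2)
      (g' := fun t => -t / (1 - t * w) ^ 2)
      (by fun_prop (disch := simp [hw])) (by fun_prop (disch := simp))
      (by filter_upwards [hne] with q hq
          have := sub_ne_zero.mpr hq.1
          have := hq.2
          simp [field])
      (by filter_upwards [hne] with q hq
          have := sub_ne_zero.mpr hq.1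
          have := hq.2
          have : 1 - q⁻¹ * w ≠ 0 := by field_simp; exact div_ne_zero ‹_› (by simp [*])
          simp [field])
    simpa using h
  | succ k ih =>
    have h := (hasTotalRes_div_sub hw k).add (ih.const_mul w)
    have h3 : w * w ^ (k - 1 : ℤ) = w ^ (k : ℤ) := by rw [← zpow_one_add₀ hw]; congr 1; ring
    rw [show -w ^ (k : ℤ) + w * -((k : ℤ) * w ^ (k - 1 : ℤ)) =
      -(((k + 1 : ℤ) : ℂ) * w ^ (k + 1 - 1 : ℤ)) by
        rw [add_sub_cancel_right]; push_cast; linear_combination (-(k : ℂ)) * h3] at h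
    refine h.congr ?_
    filter_upwards [hne] with q hq
    have := sub_ne_zero.mpr hq.1
    rw [zpow_add_one₀ hq.2]
    field_simp
    ring
  | pred k ih =>
    have h := (ih.add ((hasTotalRes_div_sub hw (-k - 1)).const_mul (-1))).const_mul w⁻¹
    have h3 : w ^ (-k - 1 : ℤ) = w ^ (-k - 1 - 1 : ℤ) * w := by
      rw [← zpow_add_one₀ hw, sub_add_cancel]
    rw [show w⁻¹ * (-(((-k : ℤ) : ℂ) * w ^ (-k - 1 : ℤ)) + -1 * -w ^ (-k - 1 : ℤ)) =
      -(((-k - 1 : ℤ) : ℂ) * w ^ (-k - 1 - 1 : ℤ)) by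
        rw [h3]; push_cast; field_simp; ring] at h
    refine h.congr ?_
    filter_upwards [hne] with q hq
    have := sub_ne_zero.mpr hq.1
    have h3 : q ^ (-k : ℤ) = q ^ (-k - 1 : ℤ) * q := by rw [← zpow_add_one₀ hq.2, sub_add_cancel]
    rw [h3]
    field_simp
    ring

theorem eventually_ramification_sq_sub (w : ℂ) :
    ∀ᶠ q in ramificationFilter, q ≠ 0 ∧ w ^ 2 - q ^ 2 ≠ 0 := by
  filter_upwards [eventually_ramification_ne w, eventually_ramification_ne (-w),
    eventually_ramification_ne 0] with q h1 h2 h0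
  refine ⟨h0, ?_⟩
  rw [sq_sub_sq]
  refine mul_ne_zero (fun h => h2 ?_) (sub_ne_zero.mpr h1.symm)
  linear_combination h

/-- The kernel factor q/(w² - q²) reproduces even Laurent polynomials: the other poles ±w each have
residue -w^(2m)/2. The induction uses q²/(w² - q²) = w²/(w² - q²) - 1. -/
theorem hasTotalRes_even {w : ℂ} (hw : w ≠ 0) (m : ℤ) :
    HasTotalRes (fun q => q / (w ^ 2 - q ^ 2) * q ^ (2 * m)) (w ^ (2 * m)) := by
  have hne := eventually_ramification_sq_sub w
  induction m with
  | zero =>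
    have h := hasTotalRes_of_eq (f := fun q => q / (w ^ 2 - q ^ 2) * q ^ (2 * 0 : ℤ))
      (g := fun q => q ^ 2 / (w ^ 2 - q ^ 2)) (g' := fun t => -1 / (t ^ 2 * w ^ 2 - 1))
      (by fun_prop (disch := simp [hw])) (by fun_prop (disch := simp))
      (by filter_upwards [hne] with q ⟨h0, hq⟩
          simp [field])
      (by filter_upwards [hne] with q ⟨h0, hq⟩
          have : q⁻¹ ^ 2 * w ^ 2 - 1 ≠ 0 := by field_simp; exact div_ne_zero ‹_› (by simp [*])
          simp [field])
    simpa using h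
  | succ k ih =>
    have h := (ih.const_mul (w ^ 2)).add ((hasTotalRes_zpow (2 * k + 1)).const_mul (-1))
    have e : ∀ q : ℂ, q ≠ 0 → q ^ (2 * (k + 1) : ℤ) = q ^ (2 * k : ℤ) * q ^ 2 := fun q hq => by
      rw [mul_add, zpow_add₀ hq]; norm_cast
    rw [show w ^ 2 * w ^ (2 * k : ℤ) + -1 * 0 = w ^ (2 * (k + 1) : ℤ) by rw [e w hw]; ring] at h
    refine h.congr ?_
    filter_upwards [hne] with q ⟨h0, hq⟩
    rw [e q h0, zpow_add_one₀ h0]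
    field_simp
    ring
  | pred k ih =>
    have h := (ih.add (hasTotalRes_zpow (2 * (-k - 1) + 1))).const_mul (w ^ 2)⁻¹
    have e : ∀ q : ℂ, q ≠ 0 → q ^ (2 * -k : ℤ) = q ^ (2 * (-k - 1) : ℤ) * q ^ 2 := fun q hq => by
      rw [← zpow_ofNat q 2, ← zpow_add₀ hq]; congr 1; ring
    rw [show (w ^ 2)⁻¹ * (w ^ (2 * -k : ℤ) + 0) = w ^ (2 * (-k - 1) : ℤ) by
      rw [e w hw]; field_simp; ring] at h
    refine h.congr ?_
    filter_upwards [hne] with q ⟨h0, hq⟩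
    rw [e q h0, zpow_add_one₀ h0]
    field_simp
    ring

end Residues

/-! ### Residues of integrands that contain Bergman kernels -/

section BergmanResidues

open Filter Topology

theorem eventually_ramification_sub (z : ℂ) :
    ∀ᶠ q in ramificationFilter, q - z ≠ 0 ∧ -q - z ≠ 0 := by
  filter_upwards [eventually_ramification_ne z, eventually_ramification_ne (-z)] with q h1 h2
  exact ⟨sub_ne_zero.mpr h1, fun h => h2 (by linear_combination -h)⟩

theorem hasTotalRes_odd_bergman {z : ℂ} (hz : z ≠ 0) (m : ℤ) :
    HasTotalRes (fun q => q ^ (2 * m + 1) * (1 / (q - z) ^ 2 + 1 / (-q - z) ^ 2))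
      (-(2 * (2 * m + 1) * z ^ (2 * m))) := by
  have h := (hasTotalRes_div_sub_sq hz (2 * m + 1)).add
    (hasTotalRes_div_sub_sq (neg_ne_zero.mpr hz) (2 * m + 1))
  have e : (-z) ^ (2 * m) = z ^ (2 * m) := (even_two_mul m).neg_zpow z
  rw [add_sub_cancel_right, e] at h
  rw [show -(2 * (2 * m + 1) * z ^ (2 * m)) = -(((2 * m + 1 : ℤ) : ℂ) * z ^ (2 * m)) +
    -(((2 * m + 1 : ℤ) : ℂ) * z ^ (2 * m)) by push_cast; ring]
  refine h.congr (Eventually.of_forall fun q => ?_)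
  rw [show (-q - z) ^ 2 = (q - -z) ^ 2 by ring]
  ring

/-- The integrand is regular at 0 and decays like q⁻³ at ∞, so neither point has a residue. -/
theorem hasTotalRes_even_bergman_zero {w z : ℂ} (hw : w ≠ 0) (hz : z ≠ 0) :
    HasTotalRes (fun q => q / (w ^ 2 - q ^ 2) * q ^ (2 * 0 : ℤ) *
      (1 / (q - z) ^ 2 + 1 / (-q - z) ^ 2)) 0 := by
  have hne := (eventually_ramification_sq_sub w).and (eventually_ramification_sub z)
  have h := hasTotalRes_of_eq (f := fun q => q / (w ^ 2 - q ^ 2) * q ^ (2 * 0 : ℤ) *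
      (1 / (q - z) ^ 2 + 1 / (-q - z) ^ 2))
    (g := fun q => q ^ 2 / (w ^ 2 - q ^ 2) * (1 / (q - z) ^ 2 + 1 / (-q - z) ^ 2))
    (g' := fun t => -t ^ 2 / (t ^ 2 * w ^ 2 - 1) * (1 / (1 - t * z) ^ 2 + 1 / (1 + t * z) ^ 2))
    (by fun_prop (disch := simp [hw, hz])) (by fun_prop (disch := simp))
    (by filter_upwards [hne] with q ⟨⟨h0, hq⟩, h1, h2⟩
        simp [field])
    (by filter_upwards [hne] with q ⟨⟨h0, hq⟩, h1, h2⟩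
        have h3 : q⁻¹ ^ 2 * w ^ 2 - 1 ≠ 0 := by field_simp; exact div_ne_zero hq (by simp [h0])
        have h4 : 1 - q⁻¹ * z ≠ 0 := by field_simp; exact div_ne_zero h1 h0
        have h5 : 1 + q⁻¹ * z ≠ 0 := by
          have : q + z ≠ 0 := fun h => h2 (by linear_combination -h)
          field_simp; exact div_ne_zero this h0
        rw [mul_zero, zpow_zero, mul_one]
        have e1 : (1 - q⁻¹ * z) = (q - z) / q := by field_simp
        have e2 : (1 + q⁻¹ * z) = -(-q - z) / q := by field_simp; ring
        have e3 : (q⁻¹ ^ 2 * w ^ 2 - 1) = (w ^ 2 - q ^ 2) / q ^ 2 := by field_simp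
        rw [e1, e2, e3]
        field_simp)
  simpa using h

/-- The residue calculus of the recursion kernel on even functions multiplied by the Bergman
kernel. -/
theorem HasTotalRes.even_bergman_add_one {w z c : ℂ} (hz : z ≠ 0) {m : ℤ}
    (h : HasTotalRes (fun q => q / (w ^ 2 - q ^ 2) * q ^ (2 * m) *
      (1 / (q - z) ^ 2 + 1 / (-q - z) ^ 2)) c) :
    HasTotalRes (fun q => q / (w ^ 2 - q ^ 2) * q ^ (2 * (m + 1)) *
      (1 / (q - z) ^ 2 + 1 / (-q - z) ^ 2)) (w ^ 2 * c + 2 * (2 * m + 1) * z ^ (2 * m)) := by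
  have h1 := (h.const_mul (w ^ 2)).add ((hasTotalRes_odd_bergman hz m).const_mul (-1))
  rw [show w ^ 2 * c + -1 * -(2 * (2 * m + 1) * z ^ (2 * m)) =
    w ^ 2 * c + 2 * (2 * m + 1) * z ^ (2 * m) by ring] at h1
  refine h1.congr ?_
  filter_upwards [eventually_ramification_sq_sub w] with q ⟨h0, hq⟩
  have e : q ^ (2 * (m + 1)) = q ^ (2 * m) * q ^ 2 := by
    rw [mul_add, zpow_add₀ h0]; norm_cast
  have e2 : q * q ^ 2 / (w ^ 2 - q ^ 2) = w ^ 2 * (q / (w ^ 2 - q ^ 2)) - q := by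
    field_simp; ring
  rw [e, zpow_add_one₀ h0]
  linear_combination (-(q ^ (2 * m) * (1 / (q - z) ^ 2 + 1 / (-q - z) ^ 2))) * e2

theorem HasTotalRes.even_bergman_sub_one {w z c : ℂ} (hw : w ≠ 0) (hz : z ≠ 0) {m : ℤ}
    (h : HasTotalRes (fun q => q / (w ^ 2 - q ^ 2) * q ^ (2 * (m + 1)) *
      (1 / (q - z) ^ 2 + 1 / (-q - z) ^ 2)) c) :
    HasTotalRes (fun q => q / (w ^ 2 - q ^ 2) * q ^ (2 * m) *
      (1 / (q - z) ^ 2 + 1 / (-q - z) ^ 2))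
      ((w ^ 2)⁻¹ * (c - 2 * (2 * m + 1) * z ^ (2 * m))) := by
  have h1 := (h.add (hasTotalRes_odd_bergman hz m)).const_mul (w ^ 2)⁻¹
  rw [← sub_eq_add_neg] at h1
  refine h1.congr ?_
  filter_upwards [eventually_ramification_sq_sub w] with q ⟨h0, hq⟩
  have e : q ^ (2 * (m + 1)) = q ^ (2 * m) * q ^ 2 := by
    rw [mul_add, zpow_add₀ h0]; norm_cast
  have e2 : q * q ^ 2 / (w ^ 2 - q ^ 2) = w ^ 2 * (q / (w ^ 2 - q ^ 2)) - q := by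
    field_simp; ring
  have e3 : (w ^ 2)⁻¹ * w ^ 2 = 1 := by field_simp
  rw [e, zpow_add_one₀ h0]
  linear_combination ((w ^ 2)⁻¹ * q ^ (2 * m) * (1 / (q - z) ^ 2 + 1 / (-q - z) ^ 2)) * e2 +
    (q / (w ^ 2 - q ^ 2) * q ^ (2 * m) * (1 / (q - z) ^ 2 + 1 / (-q - z) ^ 2)) * e3

/-- The product of Bergman kernels of the three-point function. -/
noncomputable def bergmanPair (x y q : ℂ) : ℂ :=
  1 / (q - x) ^ 2 * (1 / (-q - y) ^ 2) + 1 / (q - y) ^ 2 * (1 / (-q - x) ^ 2)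

/-- The hypotheses on `g` and `g'` say that the poles at 0 and ∞ are at most simple. The residues
follow from `bergmanPair` being 2/(x²y²) at q = 0 and asymptotic to 2q⁻⁴ at ∞. -/
theorem hasTotalRes_bergmanPair {w x y : ℂ} (hw : w ≠ 0) (hx : x ≠ 0) (hy : y ≠ 0)
    {m : ℤ} {g g' : ℂ → ℂ} (hg : AnalyticAt ℂ g 0) (hg' : AnalyticAt ℂ g' 0)
    (h : ∀ q, q ≠ 0 → q * q ^ (2 * m) = q⁻¹ * g q)
    (h' : ∀ q, q ≠ 0 → q * q ^ (2 * m) = q ^ 5 * g' q⁻¹) :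
    HasTotalRes (fun q => q / (w ^ 2 - q ^ 2) * q ^ (2 * m) * bergmanPair x y q)
      (g 0 * (2 / (w ^ 2 * x ^ 2 * y ^ 2)) + 2 * g' 0) := by
  have hne := (eventually_ramification_sq_sub w).and
    ((eventually_ramification_sub x).and (eventually_ramification_sub y))
  have h := hasTotalRes_of_eq
    (f := fun q => q / (w ^ 2 - q ^ 2) * q ^ (2 * m) * bergmanPair x y q)
    (g := fun q => g q * (1 / (w ^ 2 - q ^ 2) * bergmanPair x y q))
    (g' := fun t => g' t * (-1 / (t ^ 2 * w ^ 2 - 1) *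
      (1 / (1 - t * x) ^ 2 * (1 / (1 + t * y) ^ 2) + 1 / (1 - t * y) ^ 2 * (1 / (1 + t * x) ^ 2))))
    (by unfold bergmanPair; fun_prop (disch := simp [hw, hx, hy])) (by fun_prop (disch := simp))
    (by filter_upwards [hne] with q ⟨⟨h0, hq⟩, h1, h2⟩
        linear_combination (1 / (w ^ 2 - q ^ 2) * bergmanPair x y q) * h q h0)
    (by filter_upwards [hne] with q ⟨⟨h0, hq⟩, ⟨h1, h2⟩, ⟨h3, h4⟩⟩
        have e1 : ∀ x, (1 - q⁻¹ * x) = (q - x) / q := fun x => by field_simp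
        have e2 : ∀ x, (1 + q⁻¹ * x) = -(-q - x) / q := fun x => by field_simp; ring
        have e3 : (q⁻¹ ^ 2 * w ^ 2 - 1) = (w ^ 2 - q ^ 2) / q ^ 2 := by field_simp
        rw [e1, e2, e3, e1, e2, bergmanPair]
        have := h' q h0
        have e4 : q / (w ^ 2 - q ^ 2) * q ^ (2 * m) = q * q ^ (2 * m) / (w ^ 2 - q ^ 2) := by ring
        rw [e4, this]
        field_simp)
  convert h using 1
  simp [bergmanPair]
  field_simp
  ring

end BergmanResidues

/-! ### Simultaneous description of series and differentials by Laurent coefficients -/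

section Matching

open PowerSeries Filter

variable (s α β : ℂ) (Z : ℂ⟦X⟧ˣ) {n : ℕ}

/-- The generating series of the differential `∏ zᵢ ^ (2 kᵢ) dzᵢ`. -/
noncomputable def monoSer (k : ℤ × (Fin n → ℤ)) (a : Fin n → ℕ) : ℂ⟦X⟧ :=
  (∏ i, eCoeff s α β Z (k.2 i) (a i)) • eSer s α β Z k.1

/-- The function `q ^ (2 k₀) ∏ zᵢ ^ (2 kᵢ)`. -/
noncomputable def monoFun (k : ℤ × (Fin n → ℤ)) (z : Fin n → ℂ) (q : ℂ) : ℂ :=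
  q ^ (2 * k.1) * ∏ i, z i ^ (2 * k.2 i)

/-- The series `F` are the expansions of the differential with the coefficient function `G`, which
is an even Laurent polynomial. -/
def Matches (F : (Fin n → ℕ) → ℂ⟦X⟧) (G : (Fin n → ℂ) → ℂ → ℂ) : Prop :=
  ∃ w : ℤ × (Fin n → ℤ) →₀ ℂ, (∀ a, F a = w.sum fun k c => c • monoSer s α β Z k a) ∧
    ∀ z q, (∀ i, z i ≠ 0) → q ≠ 0 → G z q = w.sum fun k c => c * monoFun k z q

/-- The series `F` are the expansions of the residues of `I z z₀`. -/
def ResMatches (F : (Fin n → ℕ) → ℂ⟦X⟧) (I : (Fin n → ℂ) → ℂ → ℂ → ℂ) : Prop :=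
  ∃ G, Matches s α β Z F G ∧
    ∀ z z₀, (∀ i, z i ≠ 0) → z₀ ≠ 0 → HasTotalRes (I z z₀) (G z z₀)

variable {s α β Z}

theorem matches_mono (k : ℤ × (Fin n → ℤ)) : Matches s α β Z (monoSer s α β Z k) (monoFun k) :=
  ⟨Finsupp.single k 1, fun a => by rw [Finsupp.sum_single_index] <;> simp, fun z q _ _ => by
    rw [Finsupp.sum_single_index] <;> simp⟩

theorem Matches.congr {F F' : (Fin n → ℕ) → ℂ⟦X⟧} {G G' : (Fin n → ℂ) → ℂ → ℂ}
    (h : Matches s α β Z F G) (hF : ∀ a, F a = F' a)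
    (hG : ∀ z q, (∀ i, z i ≠ 0) → q ≠ 0 → G z q = G' z q) : Matches s α β Z F' G' := by
  obtain ⟨w, h1, h2⟩ := h
  exact ⟨w, fun a => by rw [← hF, h1], fun z q hz hq => by rw [← hG z q hz hq, h2 z q hz hq]⟩

theorem Matches.add {F F' : (Fin n → ℕ) → ℂ⟦X⟧} {G G' : (Fin n → ℂ) → ℂ → ℂ}
    (h : Matches s α β Z F G) (h' : Matches s α β Z F' G') :
    Matches s α β Z (fun a => F a + F' a) (fun z q => G z q + G' z q) := by
  obtain ⟨w, h1, h2⟩ := h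
  obtain ⟨w', h1', h2'⟩ := h'
  refine ⟨w + w', fun a => ?_, fun z q hz hq => ?_⟩
  · beta_reduce
    rw [h1, h1', Finsupp.sum_add_index' (by simp) (fun _ _ _ => add_smul _ _ _)]
  · beta_reduce
    rw [h2 z q hz hq, h2' z q hz hq, Finsupp.sum_add_index' (by simp) (fun _ _ _ => add_mul _ _ _)]

theorem Matches.smul {F : (Fin n → ℕ) → ℂ⟦X⟧} {G : (Fin n → ℂ) → ℂ → ℂ} (c : ℂ)
    (h : Matches s α β Z F G) : Matches s α β Z (fun a => c • F a) (fun z q => c * G z q) := by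
  obtain ⟨w, h1, h2⟩ := h
  refine ⟨c • w, fun a => ?_, fun z q hz hq => ?_⟩
  · beta_reduce
    rw [h1, Finsupp.sum_smul_index' (by simp), Finsupp.smul_sum]
    simp only [smul_eq_mul, mul_smul]
  · beta_reduce
    rw [h2 z q hz hq, Finsupp.sum_smul_index' (by simp), Finsupp.mul_sum]
    simp only [smul_eq_mul, mul_assoc]

theorem matches_zero : Matches s α β Z (n := n) (fun _ => 0) (fun _ _ => 0) :=
  ⟨0, fun a => by simp, fun z q _ _ => by simp⟩

theorem Matches.sum {ι : Type*} (S : Finset ι) {F : ι → (Fin n → ℕ) → ℂ⟦X⟧}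
    {G : ι → (Fin n → ℂ) → ℂ → ℂ} (h : ∀ i ∈ S, Matches s α β Z (F i) (G i)) :
    Matches s α β Z (fun a => ∑ i ∈ S, F i a) (fun z q => ∑ i ∈ S, G i z q) := by
  classical
  induction S using Finset.induction_on with
  | empty => simpa using matches_zero
  | insert i S hi ih =>
    simp only [Finset.sum_insert hi]
    exact (h i (Finset.mem_insert_self _ _)).add
      (ih fun j hj => h j (Finset.mem_insert_of_mem hj))

theorem Matches.induction {C : ((Fin n → ℕ) → ℂ⟦X⟧) → ((Fin n → ℂ) → ℂ → ℂ) → Prop}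
    (hadd : ∀ F F' G G', C F G → C F' G' → C (fun a => F a + F' a) (fun z q => G z q + G' z q))
    (hsmul : ∀ (c : ℂ) k, C (fun a => c • monoSer s α β Z k a) (fun z q => c * monoFun k z q))
    (hcongr : ∀ F G G', C F G → (∀ z q, (∀ i, z i ≠ 0) → q ≠ 0 → G z q = G' z q) → C F G')
    {F : (Fin n → ℕ) → ℂ⟦X⟧} {G : (Fin n → ℂ) → ℂ → ℂ} (h : Matches s α β Z F G) : C F G := by
  obtain ⟨w, h1, h2⟩ := h
  have key : ∀ w : ℤ × (Fin n → ℤ) →₀ ℂ, C (fun a => w.sum fun k c => c • monoSer s α β Z k a)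
      (fun z q => w.sum fun k c => c * monoFun k z q) := by
    intro w
    induction w using Finsupp.induction_linear with
    | zero =>
      have := hsmul 0 0
      simpa using this
    | add w w' h h' =>
      have := hadd _ _ _ _ h h'
      convert this using 1
      · ext1 a
        rw [Finsupp.sum_add_index' (by simp) (fun _ _ _ => add_smul _ _ _)]
      · ext z q
        rw [Finsupp.sum_add_index' (by simp) (fun _ _ _ => add_mul _ _ _)]
    | single k c =>
      convert hsmul c k using 1
      · ext1 a
        rw [Finsupp.sum_single_index (by simp)]
      · ext z q
        rw [Finsupp.sum_single_index (by simp)]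
  rw [show F = fun a => w.sum fun k c => c • monoSer s α β Z k a from funext h1]
  exact hcongr _ _ _ (key w) fun z q hz hq => (h2 z q hz hq).symm

theorem ResMatches.congr {F F' : (Fin n → ℕ) → ℂ⟦X⟧} {I I' : (Fin n → ℂ) → ℂ → ℂ → ℂ}
    (h : ResMatches s α β Z F I) (hF : ∀ a, F a = F' a)
    (hI : ∀ z z₀, (∀ i, z i ≠ 0) → z₀ ≠ 0 → ∀ᶠ q in ramificationFilter, I z z₀ q = I' z z₀ q) :
    ResMatches s α β Z F' I' := by
  obtain ⟨G, h1, h2⟩ := h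
  exact ⟨G, h1.congr hF fun _ _ _ _ => rfl, fun z z₀ hz hz0 =>
    (h2 z z₀ hz hz0).congr (hI z z₀ hz hz0)⟩

theorem ResMatches.add {F F' : (Fin n → ℕ) → ℂ⟦X⟧} {I I' : (Fin n → ℂ) → ℂ → ℂ → ℂ}
    (h : ResMatches s α β Z F I) (h' : ResMatches s α β Z F' I') :
    ResMatches s α β Z (fun a => F a + F' a) (fun z z₀ q => I z z₀ q + I' z z₀ q) := by
  obtain ⟨G, h1, h2⟩ := h
  obtain ⟨G', h1', h2'⟩ := h'
  exact ⟨_, h1.add h1', fun z z₀ hz hz0 => (h2 z z₀ hz hz0).add (h2' z z₀ hz hz0)⟩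

theorem ResMatches.smul {F : (Fin n → ℕ) → ℂ⟦X⟧} {I : (Fin n → ℂ) → ℂ → ℂ → ℂ} (c : ℂ)
    (h : ResMatches s α β Z F I) :
    ResMatches s α β Z (fun a => c • F a) (fun z z₀ q => c * I z z₀ q) := by
  obtain ⟨G, h1, h2⟩ := h
  exact ⟨_, h1.smul c, fun z z₀ hz hz0 => (h2 z z₀ hz hz0).const_mul c⟩

theorem ResMatches.sum {ι : Type*} (S : Finset ι) {F : ι → (Fin n → ℕ) → ℂ⟦X⟧}
    {I : ι → (Fin n → ℂ) → ℂ → ℂ → ℂ} (h : ∀ i ∈ S, ResMatches s α β Z (F i) (I i)) :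
    ResMatches s α β Z (fun a => ∑ i ∈ S, F i a) (fun z z₀ q => ∑ i ∈ S, I i z z₀ q) := by
  choose! G h1 h2 using h
  exact ⟨_, Matches.sum S h1, fun z z₀ hz hz0 => HasTotalRes.sum S fun i hi => h2 i hi z z₀ hz hz0⟩

theorem Matches.mul_zpow {F : (Fin n → ℕ) → ℂ⟦X⟧} {G : (Fin n → ℂ) → ℂ → ℂ} (j : ℤ)
    (h : Matches s α β Z F G) :
    Matches s α β Z (fun a => ((Z ^ (2 * j) : ℂ⟦X⟧ˣ) : ℂ⟦X⟧) * F a)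
      (fun z q => q ^ (2 * j) * G z q) := by
  refine h.induction (C := fun F G => Matches s α β Z (fun a => ((Z ^ (2 * j) : ℂ⟦X⟧ˣ) : ℂ⟦X⟧) * F a)
      (fun z q => q ^ (2 * j) * G z q)) (fun F F' G G' h h' => ?_) (fun c k => ?_)
      (fun F G G' h hG => ?_)
  · exact (h.add h').congr (fun a => by ring) (fun z q _ _ => by ring)
  · refine ((matches_mono (j + k.1, k.2)).smul c).congr (fun a => ?_) (fun z q _ hq => ?_)
    · simp only [monoSer, mul_smul_comm]
      congr 2
      rw [eSer, show 2 * (j + k.1) - 1 = 2 * j + (2 * k.1 - 1) by ring, coe_zpow_add, eSer]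
      ring
    · simp only [monoFun, mul_add, zpow_add₀ hq]
      ring
  · exact h.congr (fun _ => rfl) fun z q hz hq => by rw [hG z q hz hq]

variable {m l : ℕ}

theorem prod_sumElim {M : Type*} [CommMonoid M] (e : Fin m ⊕ Fin l ≃ Fin n)
    (k₁ : Fin m → ℤ) (k₂ : Fin l → ℤ) (f : ℤ → Fin n → M) :
    ∏ i, f (Sum.elim k₁ k₂ (e.symm i)) i =
      (∏ i, f (k₁ i) (e (Sum.inl i))) * ∏ i, f (k₂ i) (e (Sum.inr i)) := by
  rw [← e.prod_comp, Fintype.prod_sum_type]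
  simp

theorem Matches.mul_mono {F : (Fin m → ℕ) → ℂ⟦X⟧} {G : (Fin m → ℂ) → ℂ → ℂ}
    (h : Matches s α β Z F G) (e : Fin m ⊕ Fin l ≃ Fin n) (k : Fin l → ℤ) :
    Matches s α β Z
      (fun a => (∏ i, eCoeff s α β Z (k i) (a (e (Sum.inr i)))) • F fun i => a (e (Sum.inl i)))
      (fun z q => G (fun i => z (e (Sum.inl i))) q * ∏ i, z (e (Sum.inr i)) ^ (2 * k i)) := by
  refine h.induction (C := fun F G => Matches s α β Z
      (fun a => (∏ i, eCoeff s α β Z (k i) (a (e (Sum.inr i)))) • F fun i => a (e (Sum.inl i)))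
      (fun z q => G (fun i => z (e (Sum.inl i))) q * ∏ i, z (e (Sum.inr i)) ^ (2 * k i)))
      (fun F F' G G' h h' => ?_) (fun c k' => ?_) (fun F G G' h hG => ?_)
  · exact (h.add h').congr (fun a => (smul_add _ _ _).symm) (fun z q _ _ => (add_mul _ _ _).symm)
  · refine ((matches_mono (k'.1, fun i => Sum.elim k'.2 k (e.symm i))).smul c).congr
      (fun a => ?_) (fun z q _ hq => ?_)
    · simp only [monoSer]
      rw [prod_sumElim e k'.2 k fun k i => eCoeff s α β Z k (a i), smul_smul, smul_smul, smul_smul]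
      congr 1
      ring
    · simp only [monoFun]
      rw [prod_sumElim e k'.2 k fun k i => z i ^ (2 * k)]
      ring
  · exact h.congr (fun _ => rfl) fun z q hz hq => by rw [hG _ q (fun i => hz _) hq]

/-! ### The recursion kernel -/

theorem deriv_curveX {q : ℂ} (h : q ^ 2 - 1 ≠ 0) :
    deriv (curveX s α β) q = -(2 * s * (α - β) * q) / (q ^ 2 - 1) ^ 2 := by
  have h1 : HasDerivAt (fun q : ℂ => s * (α * q ^ 2 - β)) (s * (α * (2 * q))) q := by
    have := (((hasDerivAt_pow 2 q).const_mul α).sub_const β).const_mul s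
    simpa using this
  have h2 : HasDerivAt (fun q : ℂ => q ^ 2 - 1) (2 * q) q := by
    have := (hasDerivAt_pow 2 q).sub_const 1
    simpa using this
  have h3 := h1.div h2 h
  have : deriv (curveX s α β) q = _ := h3.deriv
  rw [this]
  congr 1
  ring

/-- The quotient by (y(q) - y(-q)) dx is the same Laurent polynomial that describes division by y in
`kerSer_mul_eSer`. -/
theorem eoKernel_eq (hs : s ≠ 0) (hαβ : α - β ≠ 0) (z₀ : ℂ) : ∀ᶠ q in ramificationFilter,
    -eoKernel (curveX s α β) (curveY s α β) z₀ q =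
      q / (z₀ ^ 2 - q ^ 2) * ∑ i ∈ Finset.range 4, kerCoeff α β i * q ^ (2 * ((i : ℤ) - 1)) := by
  filter_upwards [eventually_ramification_sq_sub z₀, eventually_ramification_sq_sub 1,
    eventually_ramification_ne z₀, eventually_ramification_ne (-z₀)] with q ⟨h0, h1⟩ ⟨_, h2⟩ h3 h4
  have h2' : q ^ 2 - 1 ≠ 0 := fun h => h2 (by linear_combination -h)
  have h3' : z₀ - q ≠ 0 := sub_ne_zero.mpr h3.symm
  have h4' : z₀ - -q ≠ 0 := fun h => h4 (by linear_combination h)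
  have hsum : ∑ i ∈ Finset.range 4, kerCoeff α β i * q ^ (2 * ((i : ℤ) - 1)) =
      -(q ^ 2 - 1) ^ 2 * (α * q ^ 2 - β) / (2 * (α - β) ^ 2 * q ^ 2) := by
    have h := sum_kerCoeff (R := ℂ) α β (q ^ 2)
    simp only [Algebra.algebraMap_self, RingHom.id_apply] at h
    have : ∀ i : ℕ, q ^ (2 * ((i : ℤ) - 1)) = (q ^ 2) ^ i * (q ^ 2)⁻¹ := fun i => by
      rw [mul_sub, zpow_sub₀ h0, ← pow_mul, ← zpow_natCast q (2 * i)]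
      push_cast
      rw [div_eq_mul_inv]
      norm_cast
    simp only [this, ← mul_assoc]
    rw [← Finset.sum_mul, h]
    field_simp
  rw [hsum, eoKernel, deriv_curveX h2', curveY, curveY]
  have h5 : 1 / (z₀ - q) - 1 / (z₀ - -q) = 2 * q / (z₀ ^ 2 - q ^ 2) := by
    rw [show z₀ ^ 2 - q ^ 2 = (z₀ - q) * (z₀ - -q) by ring]
    field_simp
    ring
  rw [h5, neg_sq]
  -- Where α q² = β both sides are 0, the left one because `curveY` is then a division by zero.
  by_cases hD : α * q ^ 2 - β = 0
  · simp [hD]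
  · field_simp
    ring

end Matching

/-! ### Division by y against residues with the kernel -/

section KernelOperations

open PowerSeries Filter

variable {s α β : ℂ} {Z : ℂ⟦X⟧ˣ} {n m l : ℕ}

theorem ResMatches.mul_mono {F : (Fin m → ℕ) → ℂ⟦X⟧} {I : (Fin m → ℂ) → ℂ → ℂ → ℂ}
    (h : ResMatches s α β Z F I) (e : Fin m ⊕ Fin l ≃ Fin n) (k : Fin l → ℤ) :
    ResMatches s α β Z
      (fun a => (∏ i, eCoeff s α β Z (k i) (a (e (Sum.inr i)))) • F fun i => a (e (Sum.inl i)))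
      (fun z z₀ q => (∏ i, z (e (Sum.inr i)) ^ (2 * k i)) * I (fun i => z (e (Sum.inl i))) z₀ q) := by
  obtain ⟨G, h1, h2⟩ := h
  refine ⟨_, h1.mul_mono e k, fun z z₀ hz hz0 => ?_⟩
  rw [mul_comm]
  exact (h2 _ z₀ (fun i => hz _) hz0).const_mul _

theorem Matches.resMatches {F : (Fin n → ℕ) → ℂ⟦X⟧} {k₀ : ℤ} {k : Fin n → ℤ}
    (h : Matches s α β Z F (monoFun (k₀, k))) : ResMatches s α β Z F
      (fun z z₀ q => q / (z₀ ^ 2 - q ^ 2) * q ^ (2 * k₀) * ∏ i, z i ^ (2 * k i)) := by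
  refine ⟨_, h, fun z z₀ hz hz0 => ?_⟩
  have := (hasTotalRes_even hz0 k₀).const_mul (∏ i, z i ^ (2 * k i))
  rw [show monoFun (k₀, k) z z₀ = (∏ i, z i ^ (2 * k i)) * z₀ ^ (2 * k₀) from mul_comm _ _]
  exact this.congr (Eventually.of_forall fun q => mul_comm _ _)

variable (hs : s ≠ 0) (hαβ : α - β ≠ 0)
include hs hαβ

/-- Both operations send the exponents k₀ and l to k₀ + l - 1 + i with weight `kerCoeff` i, for i =
0, …, 3. -/
theorem resMatches_kernel_mono (k₀ l : ℤ) (k : Fin n → ℤ) : ResMatches s α β Z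
    (fun a => kerSer s α β Z * ((∏ i, eCoeff s α β Z (k i) (a i)) •
      (eSer s α β Z k₀ * eSer s α β Z l)))
    (fun z z₀ q => eoKernel (curveX s α β) (curveY s α β) z₀ q *
      -(q ^ (2 * k₀) * q ^ (2 * l) * ∏ i, z i ^ (2 * k i))) := by
  refine (ResMatches.sum (Finset.range 4) fun i _ => ((matches_mono (s := s) (α := α) (β := β)
    (Z := Z) (k₀ + l - 1 + i, k)).resMatches.smul (kerCoeff α β i))).congr (fun a => ?_)
    (fun z z₀ hz hz0 => ?_)
  · rw [mul_smul_comm, kerSer_mul_eSer_mul_eSer hs hαβ, Finset.smul_sum]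
    exact Finset.sum_congr rfl fun i _ => by rw [monoSer, smul_comm]
  · filter_upwards [eoKernel_eq hs hαβ z₀, eventually_ramification_ne 0] with q hq h0
    rw [mul_neg, ← neg_mul, hq, Finset.mul_sum, Finset.sum_mul]
    refine Finset.sum_congr rfl fun i _ => ?_
    rw [show 2 * (k₀ + l - 1 + i) = 2 * (i - 1) + (2 * k₀ + 2 * l) by ring, zpow_add₀ h0,
      zpow_add₀ h0]
    ring

variable (hZ : (1 - C (s * α) * X) * (Z : ℂ⟦X⟧) ^ 2 = 1 - C (s * β) * X)
include hZ

/-- Setting two arguments equal turns a product of expansions in separate variables into a product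
of series. -/
theorem diagSer_smul_eSer (k l : ℤ) : (diagSer fun j => eCoeff s α β Z l j • eSer s α β Z k) =
    eSer s α β Z k * eSer s α β Z l := by
  ext N
  rw [diagSer, coeff_mk, coeff_mul]
  refine Finset.sum_congr rfl fun p _ => ?_
  rcases p with ⟨i, _ | j⟩
  · simp only [coeff_zero_eSer hs hαβ hZ, mul_zero]
  · simp only [map_smul, smul_eq_mul, eCoeff, mul_comm]

/-- The argument -q in the residue causes no sign, because all exponents are even. -/
theorem Matches.resMatches_diag {F : (Fin (n + 1) → ℕ) → ℂ⟦X⟧} {G : (Fin (n + 1) → ℂ) → ℂ → ℂ}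
    (h : Matches s α β Z F G) : ResMatches s α β Z
      (fun a => kerSer s α β Z * diagSer fun j => F (Fin.cons j a))
      (fun z z₀ q => eoKernel (curveX s α β) (curveY s α β) z₀ q * -G (Fin.cons (-q) z) q) := by
  refine h.induction (C := fun F G => ResMatches s α β Z
      (fun a => kerSer s α β Z * diagSer fun j => F (Fin.cons j a))
      (fun z z₀ q => eoKernel (curveX s α β) (curveY s α β) z₀ q * -G (Fin.cons (-q) z) q))
      (fun F F' G G' h h' => ?_) (fun c k => ?_) (fun F G G' h hG => ?_)
  · refine (h.add h').congr (fun a => ?_) (fun z z₀ _ _ => Eventually.of_forall fun q => by ring)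
    rw [← mul_add, ← diagSer_add]
    rfl
  · refine ((resMatches_kernel_mono hs hαβ k.1 (k.2 0) (Fin.tail k.2)).smul c).congr
      (fun a => ?_) (fun z z₀ _ _ => Eventually.of_forall fun q => ?_)
    · have : (fun j => c • monoSer s α β Z k (Fin.cons j a)) =
          (c * ∏ i, eCoeff s α β Z (Fin.tail k.2 i) (a i)) •
            fun j => eCoeff s α β Z (k.2 0) j • eSer s α β Z k.1 := by
        ext1 j
        simp only [monoSer, Fin.prod_univ_succ, Fin.cons_zero, Fin.cons_succ, Pi.smul_apply,
          smul_smul, Fin.tail]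
        congr 1
        ring
      rw [this, diagSer_smul, diagSer_smul_eSer hs hαβ hZ, mul_smul, mul_smul_comm c]
    · simp only [monoFun, Fin.prod_univ_succ, Fin.cons_zero, Fin.cons_succ, Fin.tail,
        (even_two_mul (k.2 0)).neg_zpow]
      ring
  · refine h.congr (fun _ => rfl) fun z z₀ hz _ => ?_
    filter_upwards [eventually_ramification_ne 0] with q hq
    rw [hG _ q _ hq]
    exact Fin.cases (by simpa using hq) (by simpa using hz)

omit hZ in
theorem Matches.resMatches_mul {F : (Fin m → ℕ) → ℂ⟦X⟧} {G : (Fin m → ℂ) → ℂ → ℂ}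
    {F' : (Fin l → ℕ) → ℂ⟦X⟧} {G' : (Fin l → ℂ) → ℂ → ℂ} (h : Matches s α β Z F G)
    (h' : Matches s α β Z F' G') (e : Fin m ⊕ Fin l ≃ Fin n) : ResMatches s α β Z
      (fun a => kerSer s α β Z *
        ((F fun i => a (e (Sum.inl i))) * F' fun i => a (e (Sum.inr i))))
      (fun z z₀ q => eoKernel (curveX s α β) (curveY s α β) z₀ q *
        -(G (fun i => z (e (Sum.inl i))) q * G' (fun i => z (e (Sum.inr i))) (-q))) := by
  refine h.induction (C := fun F G => ResMatches s α β Z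
      (fun a => kerSer s α β Z *
        ((F fun i => a (e (Sum.inl i))) * F' fun i => a (e (Sum.inr i))))
      (fun z z₀ q => eoKernel (curveX s α β) (curveY s α β) z₀ q *
        -(G (fun i => z (e (Sum.inl i))) q * G' (fun i => z (e (Sum.inr i))) (-q))))
      (fun F₁ F₂ G₁ G₂ h₁ h₂ => ?_) (fun c k => ?_) (fun F₁ G₁ G₂ h₁ hG => ?_)
  · exact (h₁.add h₂).congr (fun a => by ring)
      (fun z z₀ _ _ => Eventually.of_forall fun q => by ring)
  · refine h'.induction (C := fun F' G' => ResMatches s α β Z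
      (fun a => kerSer s α β Z * ((c • monoSer s α β Z k fun i => a (e (Sum.inl i))) *
        F' fun i => a (e (Sum.inr i))))
      (fun z z₀ q => eoKernel (curveX s α β) (curveY s α β) z₀ q *
        -((c * monoFun k (fun i => z (e (Sum.inl i))) q) * G' (fun i => z (e (Sum.inr i))) (-q))))
      (fun F₁ F₂ G₁ G₂ h₁ h₂ => ?_) (fun c' k' => ?_) (fun F₁ G₁ G₂ h₁ hG => ?_)
    · exact (h₁.add h₂).congr (fun a => by ring)
        (fun z z₀ _ _ => Eventually.of_forall fun q => by ring)
    · refine ((resMatches_kernel_mono hs hαβ k.1 k'.1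
        fun i => Sum.elim k.2 k'.2 (e.symm i)).smul (c * c')).congr
        (fun a => ?_) (fun z z₀ _ _ => Eventually.of_forall fun q => ?_)
      · rw [prod_sumElim e k.2 k'.2 fun k i => eCoeff s α β Z k (a i)]
        simp only [monoSer, smul_eq_C_mul, map_mul]
        ring
      · rw [prod_sumElim e k.2 k'.2 fun k i => z i ^ (2 * k)]
        simp only [monoFun, (even_two_mul k'.1).neg_zpow]
        ring
    · refine h₁.congr (fun _ => rfl) fun z z₀ hz _ => ?_
      filter_upwards [eventually_ramification_ne 0] with q hq
      rw [hG _ (-q) (fun i => hz _) (neg_ne_zero.mpr hq)]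
  · refine h₁.congr (fun _ => rfl) fun z z₀ hz _ => ?_
    filter_upwards [eventually_ramification_ne 0] with q hq
    rw [hG _ q (fun i => hz _) hq]

/-- Both sides vanish at m = 0 and obey the same recursion in m; the induction runs in both
directions. -/
theorem resMatches_insert (m : ℤ) : ResMatches s α β Z (n := 1)
    (fun a => insertSer s α β Z m (a 0))
    (fun z z₀ q => q / (z₀ ^ 2 - q ^ 2) * q ^ (2 * m) *
      (1 / (q - z 0) ^ 2 + 1 / (-q - z 0) ^ 2)) := by
  have hm : ∀ m : ℤ, Matches s α β Z (n := 1)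
      (fun a => (2 * (2 * m + 1) * eCoeff s α β Z m (a 0)) • eSer s α β Z 0)
      (fun z q => 2 * (2 * m + 1) * z 0 ^ (2 * m)) := fun m => by
    refine ((matches_mono (0, fun _ => m)).smul (2 * (2 * m + 1))).congr (fun a => ?_)
      (fun z q _ _ => ?_)
    · simp [monoSer, mul_smul]
    · simp [monoFun]
  have hz2 : ((Z ^ (2 * 1 : ℤ) : ℂ⟦X⟧ˣ) : ℂ⟦X⟧) = (Z : ℂ⟦X⟧) ^ 2 := by norm_cast
  induction m with
  | zero =>
    refine ⟨_, matches_zero.congr (fun a => (insertSer_zero (a 0)).symm) fun _ _ _ _ => rfl,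
      fun z z₀ hz hz0 => hasTotalRes_even_bergman_zero hz0 (hz 0)⟩
  | succ k ih =>
    obtain ⟨G, h1, h2⟩ := ih
    refine ⟨_, ((h1.mul_zpow 1).add (hm k)).congr (fun a => ?_) fun _ _ _ _ => rfl,
      fun z z₀ hz hz0 => ?_⟩
    · rw [insertSer_add_one hs hαβ hZ, hz2]
    · have := (h2 z z₀ hz hz0).even_bergman_add_one (hz 0)
      exact_mod_cast this
  | pred k ih =>
    obtain ⟨G, h1, h2⟩ := ih
    refine ⟨_, ((h1.add ((hm (-k - 1)).smul (-1))).mul_zpow (-1)).congr (fun a => ?_)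
      fun _ _ _ _ => rfl, fun z z₀ hz hz0 => ?_⟩
    · have h := insertSer_add_one hs hαβ hZ (-k - 1) (a 0)
      rw [sub_add_cancel] at h
      rw [h, ← hz2, neg_smul, one_smul, add_neg_cancel_right, ← mul_assoc, ← coe_zpow_add]
      simp
    · have h := h2 z z₀ hz hz0
      rw [show (-k : ℤ) = (-k - 1) + 1 by ring] at h
      have := h.even_bergman_sub_one hz0 (hz 0)
      rw [show z₀ ^ (2 * -1 : ℤ) = (z₀ ^ 2)⁻¹ by rw [mul_neg, mul_one, zpow_neg]; norm_cast]
      convert this using 2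
      ring

variable {U : ℕ → ℂ⟦X⟧}
  (hU : ∀ a, 2 * (yOfSer s α Z * U a) = -(C (a : ℂ) * X * shiftSer a (yOfSer s α Z)))
include hU

/-- The two-point series and the shift term together correspond to the Bergman kernel at q and at
-q. The left-hand series is linear in `F` and the integrand is linear in `G`, so monomials suffice,
where `kerSer_mul_insert` applies. -/
theorem Matches.resMatches_insert {F : (Fin l → ℕ) → ℂ⟦X⟧} {G : (Fin l → ℂ) → ℂ → ℂ}
    (h : Matches s α β Z F G) (e : Fin 1 ⊕ Fin l ≃ Fin n) : ResMatches s α β Z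
      (fun a => kerSer s α β Z * (2 * U (a (e (Sum.inl 0))) * (F fun i => a (e (Sum.inr i))) +
        a (e (Sum.inl 0)) • (X * shiftSer (a (e (Sum.inl 0))) (F fun i => a (e (Sum.inr i))))))
      (fun z z₀ q => eoKernel (curveX s α β) (curveY s α β) z₀ q *
        -(1 / (q - z (e (Sum.inl 0))) ^ 2 * G (fun i => z (e (Sum.inr i))) (-q) +
          G (fun i => z (e (Sum.inr i))) q * (1 / (-q - z (e (Sum.inl 0))) ^ 2))) := by
  refine h.induction (C := fun F G => ResMatches s α β Z
      (fun a => kerSer s α β Z * (2 * U (a (e (Sum.inl 0))) * (F fun i => a (e (Sum.inr i))) +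
        a (e (Sum.inl 0)) • (X * shiftSer (a (e (Sum.inl 0))) (F fun i => a (e (Sum.inr i))))))
      (fun z z₀ q => eoKernel (curveX s α β) (curveY s α β) z₀ q *
        -(1 / (q - z (e (Sum.inl 0))) ^ 2 * G (fun i => z (e (Sum.inr i))) (-q) +
          G (fun i => z (e (Sum.inr i))) q * (1 / (-q - z (e (Sum.inl 0))) ^ 2))))
      (fun F F' G G' h h' => ?_) (fun c k => ?_) (fun F G G' h hG => ?_)
  · refine (h.add h').congr (fun a => ?_) (fun z z₀ _ _ => Eventually.of_forall fun q => by ring)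
    rw [shiftSer_add]
    simp only [nsmul_eq_mul]
    ring
  · refine (ResMatches.sum (Finset.range 4) fun i _ =>
      ((_root_.resMatches_insert hs hαβ hZ (k.1 - 1 + i)).mul_mono e k.2).smul
        (c * kerCoeff α β i)).congr (fun a => ?_) (fun z z₀ hz hz0 => ?_)
    · have h := kerSer_mul_insert hs hαβ hZ hU k.1 (a (e (Sum.inl 0)))
      simp only [monoSer, shiftSer_smul]
      set p := ∏ i, eCoeff s α β Z (k.2 i) (a (e (Sum.inr i)))
      have h2 : kerSer s α β Z * (2 * U (a (e (Sum.inl 0))) * (c • p • eSer s α β Z k.1) +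
          a (e (Sum.inl 0)) • (X * (c • p • shiftSer (a (e (Sum.inl 0))) (eSer s α β Z k.1)))) =
          c • p • (kerSer s α β Z * (2 * U (a (e (Sum.inl 0))) * eSer s α β Z k.1 +
          a (e (Sum.inl 0)) • (X * shiftSer (a (e (Sum.inl 0))) (eSer s α β Z k.1)))) := by
        simp only [nsmul_eq_mul, smul_eq_C_mul]; ring
      rw [h2, h, Finset.smul_sum, Finset.smul_sum]
      refine Finset.sum_congr rfl fun i _ => ?_
      rw [mul_smul, smul_comm p]
    · filter_upwards [eoKernel_eq hs hαβ z₀, eventually_ramification_ne 0] with q hq h0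
      rw [mul_neg, ← neg_mul, hq, Finset.mul_sum, Finset.sum_mul]
      refine Finset.sum_congr rfl fun i _ => ?_
      rw [show 2 * (k.1 - 1 + i) = 2 * (i - 1) + 2 * k.1 by ring, zpow_add₀ h0]
      simp only [monoFun, (even_two_mul k.1).neg_zpow]
      ring
  · refine h.congr (fun _ => rfl) fun z z₀ hz _ => ?_
    filter_upwards [eventually_ramification_ne 0] with q hq
    rw [hG _ q (fun i => hz _) hq, hG _ (-q) (fun i => hz _) (neg_ne_zero.mpr hq)]

end KernelOperations

/-! ### The loop equation is the topological recursion -/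

section Recursion

open PowerSeries Filter

theorem map_univ_orderEmbOfFin {n m : ℕ} {I : Finset (Fin n)} (h : I.card = m) (a : Fin n → ℕ) :
    Finset.univ.val.map (fun i => a (I.orderEmbOfFin h i)) = I.val.map a := by
  conv_rhs => rw [← Finset.map_orderEmbOfFin_univ I h, Finset.map_val, Multiset.map_map]
  rfl

theorem map_univ_cons {n : ℕ} (j : ℕ) (a : Fin n → ℕ) :
    Finset.univ.val.map (Fin.cons j a : Fin (n + 1) → ℕ) = j ::ₘ Finset.univ.val.map a := by
  rw [Fin.univ_val_map, Fin.univ_val_map, List.ofFn_cons]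
  rfl

/-- The summand of the topological recursion that belongs to a splitting of the genus and of the
points. -/
noncomputable def eoTerm (x y : ℂ → ℂ) (g : ℕ) {n : ℕ} (z : Fin n → ℂ) (q : ℂ)
    (h : Fin (g + 1)) (I : Finset (Fin n)) : ℂ :=
  eoOmega x y h.val (I.card + 1) (Fin.cons q (z ∘ I.orderEmbOfFin rfl)) *
    eoOmega x y (g - h.val) (Iᶜ.card + 1) (Fin.cons (-q) (z ∘ Iᶜ.orderEmbOfFin rfl))

theorem HasTotalRes.eoOmega_eq {x y : ℂ → ℂ} {g n : ℕ} (h : 2 < 2 * g + (n + 1)) {z : Fin n → ℂ}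
    {z₀ c : ℂ} (hc : HasTotalRes (fun q => eoKernel x y z₀ q *
        -((if g = 0 then 0 else eoOmega x y (g - 1) (n + 2) (Fin.cons q (Fin.cons (-q) z))) +
          ∑ h : Fin (g + 1), ∑ I : Finset (Fin n),
            if (h.val = 0 ∧ I = ∅) ∨ (h.val = g ∧ I = Finset.univ) then 0
            else eoTerm x y g z q h I)) c) :
    eoOmega x y g (n + 1) (Fin.cons z₀ z) = c := by
  rw [← hc.residue_eq, eoOmega]
  · simp only [dite_eq_ite]
    rfl
  · omega
  · omega

theorem eoOmega_zero_two (x y : ℂ → ℂ) (z : Fin 2 → ℂ) :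
    eoOmega x y 0 2 z = 1 / (z 0 - z 1) ^ 2 := by
  rw [eoOmega]

theorem eoOmega_singleton (x y : ℂ → ℂ) {n : ℕ} (z : Fin n → ℂ) (q : ℂ) {I : Finset (Fin n)}
    {j : Fin n} (hI : I = {j}) {g : ℕ} (hg : g = 0) :
    eoOmega x y g (I.card + 1) (Fin.cons q (z ∘ I.orderEmbOfFin rfl)) = 1 / (q - z j) ^ 2 := by
  subst hg
  -- The cardinality is made a variable so that it can be replaced by 1 in the type of the
  -- arguments.
  have h : ∀ m (hm : I.card = m), m = 1 →
      eoOmega x y 0 (m + 1) (Fin.cons q (z ∘ I.orderEmbOfFin hm)) = 1 / (q - z j) ^ 2 := by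
    rintro m hm rfl
    subst hI
    rw [eoOmega_zero_two]
    simp only [Fin.cons_zero, Fin.cons_one, Function.comp_apply]
    rw [Finset.orderEmbOfFin_singleton]
  exact h _ rfl (by rw [hI, Finset.card_singleton])

/-- Splits off the terms that contain ω_{0,2}. The two families are disjoint because 2g + n > 2. -/
theorem sum_eq_sum_add_two_point {M : Type*} [AddCommMonoid M] {g n : ℕ} (hgn : 2 < 2 * g + n)
    (t : Fin (g + 1) → Finset (Fin n) → M) :
    (∑ h : Fin (g + 1), ∑ I : Finset (Fin n),
        if (h.val = 0 ∧ I = ∅) ∨ (h.val = g ∧ I = Finset.univ) then 0 else t h I) =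
      (∑ h : Fin (g + 1), ∑ I : Finset (Fin n),
        if ((h.val = 0 ∧ I = ∅) ∨ (h.val = g ∧ I = Finset.univ)) ∨
          ((h.val = 0 ∧ I.card = 1) ∨ (h.val = g ∧ Iᶜ.card = 1)) then 0 else t h I) +
      ∑ j, (t 0 {j} + t (Fin.last g) {j}ᶜ) := by
  have hsing : ∀ f : Finset (Fin n) → M, (∑ I : Finset (Fin n), if I.card = 1 then f I else 0) =
      ∑ j, f {j} := fun f => by
    rw [← Finset.sum_filter, ← Finset.powerset_univ, ← Finset.powersetCard_eq_filter,
      Finset.powersetCard_one, Finset.sum_map]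
    rfl
  have h5 : ∀ (h : Fin (g + 1)) (I : Finset (Fin n)),
      (if (h.val = 0 ∧ I = ∅) ∨ (h.val = g ∧ I = Finset.univ) then 0 else t h I) =
      (if ((h.val = 0 ∧ I = ∅) ∨ (h.val = g ∧ I = Finset.univ)) ∨
          ((h.val = 0 ∧ I.card = 1) ∨ (h.val = g ∧ Iᶜ.card = 1)) then 0 else t h I) +
      ((if h = 0 then if I.card = 1 then t h I else 0 else 0) +
        (if h = Fin.last g then if Iᶜ.card = 1 then t h I else 0 else 0)) := by
    intro h I
    have e1 : h = 0 ↔ h.val = 0 := Fin.ext_iff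
    have e2 : h = Fin.last g ↔ h.val = g := Fin.ext_iff
    have e3 : I = ∅ ↔ I.card = 0 := Finset.card_eq_zero.symm
    have e4 : I = Finset.univ ↔ I.card = n := by
      rw [← Finset.card_eq_iff_eq_univ, Fintype.card_fin]
    have e5 : I.card + Iᶜ.card = n := by rw [Finset.card_add_card_compl, Fintype.card_fin]
    simp only [e1, e2, e3, e4]
    by_cases hA : h.val = 0 ∧ I.card = 1
    · have : ¬ (h.val = g ∧ Iᶜ.card = 1) := by omega
      rw [if_neg (by omega), if_pos (Or.inr (Or.inl hA)), if_pos hA.1, if_pos hA.2, zero_add,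
        ← ite_and, if_neg this, add_zero]
    · by_cases hB : h.val = g ∧ Iᶜ.card = 1
      · rw [if_neg (by omega), if_pos (Or.inr (Or.inr hB)), if_pos hB.1, if_pos hB.2, zero_add,
          ← ite_and, if_neg hA, zero_add]
      · rw [← ite_and, ← ite_and, if_neg hA, if_neg hB, add_zero, add_zero]
        simp only [hA, hB, or_false]
  rw [Finset.sum_congr rfl fun h _ => Finset.sum_congr rfl fun I _ => h5 h I]
  simp only [Finset.sum_add_distrib]
  congr 1
  congr 1
  · rw [Finset.sum_eq_single 0 (fun h _ hh => by simp [hh]) (by simp)]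
    simp only [if_true]
    exact hsing _
  · rw [Finset.sum_eq_single (Fin.last g) (fun h _ hh => by simp [hh]) (by simp)]
    simp only [if_true]
    rw [← Equiv.sum_comp (compl_involutive (α := Finset (Fin n))).toPerm]
    simp only [Function.Involutive.coe_toPerm, compl_compl]
    exact hsing fun I => t (Fin.last g) Iᶜ

variable {s u v α β : ℂ} {Z : ℂ⟦X⟧ˣ} (hs : s ≠ 0) (hαβ : α - β ≠ 0)
  (hZ : (1 - C (s * α) * X) * (Z : ℂ⟦X⟧) ^ 2 = 1 - C (s * β) * X)
  (hY : ySer s u v = yOfSer s α Z)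
include hY

/-- In the loop equation (0,2) the quadratic terms are all unstable. A shift by a > 0 kills 1 -
s(u+v)X, so the shifted (0,1) series can be replaced by the shifted y. -/
theorem yOfSer_mul_genusSer_singleton (a : ℕ) : 2 * (yOfSer s α Z * genusSer s u v 0 {a}) =
    -(C (a : ℂ) * X * shiftSer a (yOfSer s α Z)) := by
  have h := ySer_mul_genusSer s u v 0 (n := 1) (by norm_num) (fun _ => a)
  have h1 : (Finset.univ.val.map fun _ : Fin 1 => a) = {a} := rfl
  have h2 : ∀ I : Finset (Fin 1), I = ∅ ∨ I = Finset.univ := by decide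
  have h3 : ((({0}ᶜ : Finset (Fin 1)).val.map fun _ => a) : Multiset ℕ) = 0 := rfl
  simp only [h1, if_true, Fin.sum_univ_one, h3] at h
  rw [Finset.sum_eq_zero (fun k _ => Finset.sum_eq_zero fun I _ => if_pos ((h2 I).imp
    (fun h => ⟨by omega, h⟩) fun h => ⟨by omega, h⟩)), add_zero, add_zero, hY] at h
  rw [h]
  rcases Nat.eq_zero_or_pos a with rfl | ha
  · simp
  · have h4 : shiftSer a (yOfSer s α Z) = -(C (2 * s) * shiftSer a (genusSer s u v 0 0)) := by
      rw [← hY, ySer, shiftSer_sub, shiftSer_C_mul, sub_eq_neg_self]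
      ext k
      rcases k with _ | k
      · rw [coeff_zero_shiftSer, map_zero]
      · rw [coeff_succ_shiftSer, map_sub, coeff_one, coeff_C_mul, coeff_X, if_neg (by omega),
          if_neg (by omega)]
        simp
    have hn : ((a : ℕ) : ℂ⟦X⟧) = C (a : ℂ) := by simp
    rw [h4, nsmul_eq_mul, hn, map_mul, map_ofNat]
    ring

include hs hαβ hZ

theorem genusSer_eq_kerSer_mul (g : ℕ) {n : ℕ} (hgn : 0 < g + n) (a : Fin n → ℕ) :
    genusSer s u v g (Finset.univ.val.map a) = kerSer s α β Z *
      (X * ∑ j, a j • shiftSer (a j) (genusSer s u v g (({j}ᶜ : Finset (Fin n)).val.map a)) +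
      (if g = 0 then 0 else diagSer fun j => genusSer s u v (g - 1) (j ::ₘ Finset.univ.val.map a)) +
      ∑ h : Fin (g + 1), ∑ I : Finset (Fin n),
        if (h.val = 0 ∧ I = ∅) ∨ (h.val = g ∧ I = Finset.univ) then 0 else
          genusSer s u v h.val (I.val.map a) * genusSer s u v (g - h.val) (Iᶜ.val.map a)) := by
  have h := ySer_mul_genusSer s u v g hgn a
  have h2 := kerSer_mul hs hαβ hZ
  rw [hY] at h
  rw [← yOfSer] at h2
  have hu : IsUnit (C s : ℂ⟦X⟧) := (isUnit_iff_ne_zero.mpr hs).map C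
  refine hu.mul_left_cancel ?_
  linear_combination kerSer s α β Z * h - genusSer s u v g (Finset.univ.val.map a) * h2

theorem matches_genusSer_zero_three (h0 : constantCoeff (Z : ℂ⟦X⟧) = 1) : Matches s α β Z (n := 2)
    (fun a => genusSer s u v 0 (Finset.univ.val.map a))
    (fun z q => eoOmega (curveX s α β) (curveY s α β) 0 3 (Fin.cons q z)) := by
  have hI : (Finset.univ : Finset (Finset (Fin 2))) = {∅, {0}, {1}, Finset.univ} := by decide
  have hsum : ∀ {M : Type} [AddCommMonoid M] (f : Finset (Fin 2) → M),
      (∑ h : Fin 1, ∑ I : Finset (Fin 2),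
        if (h.val = 0 ∧ I = ∅) ∨ (h.val = 0 ∧ I = Finset.univ) then 0 else f I) = f {0} + f {1} := by
    intro M _ f
    rw [Fin.sum_univ_one, hI, Finset.sum_insert (by decide), Finset.sum_insert (by decide),
      Finset.sum_insert (by decide), Finset.sum_singleton, if_pos (by decide), if_neg (by decide),
      if_neg (by decide), if_pos (by decide), zero_add, add_zero]
  refine (((matches_mono (0, fun _ => 0)).smul (-α / (α - β) ^ 2)).add
    ((matches_mono (-1, fun _ => -1)).smul (β / (α - β) ^ 2))).congr (fun a => ?_)
    (fun z w hz hw => (HasTotalRes.eoOmega_eq (by norm_num) ?_).symm)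
  · have h := genusSer_eq_kerSer_mul hs hαβ hZ hY 0 (n := 2) (by norm_num) a
    have h2 := kerSer_mul_threePoint hs hαβ hZ (yOfSer_mul_genusSer_singleton hY) h0 (a 0) (a 1)
    have e0 : (({0}ᶜ : Finset (Fin 2)).val.map a) = {a 1} := rfl
    have e1 : (({1}ᶜ : Finset (Fin 2)).val.map a) = {a 0} := rfl
    have e2 : (({0} : Finset (Fin 2)).val.map a) = {a 0} := rfl
    have e3 : (({1} : Finset (Fin 2)).val.map a) = {a 1} := rfl
    have hn : ∀ a : ℕ, ((a : ℕ) : ℂ⟦X⟧) = C (a : ℂ) := fun a => by simp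
    have h3 := hsum fun I => genusSer s u v 0 (I.val.map a) * genusSer s u v 0 (Iᶜ.val.map a)
    rw [e0, e1, e2, e3] at h3
    rw [h, if_pos rfl, Fin.sum_univ_two, e0, e1]
    refine Eq.trans ?_ (congrArg _ (congrArg _ h3.symm))
    rw [nsmul_eq_mul, nsmul_eq_mul, hn, hn]
    refine Eq.trans ?_ (h2.symm.trans (by ring))
    simp only [monoSer, Fin.prod_univ_two, smul_smul]
  · have h2 : ∀ q, (∑ h : Fin 1, ∑ I : Finset (Fin 2),
        if (h.val = 0 ∧ I = ∅) ∨ (h.val = 0 ∧ I = Finset.univ) then 0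
        else eoTerm (curveX s α β) (curveY s α β) 0 z q h I) = bergmanPair (z 0) (z 1) q := by
      intro q
      have h0 : ∀ (h : Fin 1) (I : Finset (Fin 2)),
          eoTerm (curveX s α β) (curveY s α β) 0 z q h I =
          eoTerm (curveX s α β) (curveY s α β) 0 z q 0 I := fun h I => by rw [Subsingleton.elim h 0]
      simp only [h0]
      rw [hsum]
      have e0 : ({0}ᶜ : Finset (Fin 2)) = {1} := by decide
      have e1 : ({1}ᶜ : Finset (Fin 2)) = {0} := by decide
      simp only [eoTerm]
      exact congrArg₂ (· + ·)
        (congrArg₂ (· * ·) (eoOmega_singleton _ _ _ _ rfl rfl) (eoOmega_singleton _ _ _ _ e0 rfl))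
        (congrArg₂ (· * ·) (eoOmega_singleton _ _ _ _ rfl rfl) (eoOmega_singleton _ _ _ _ e1 rfl))
    -- Of the four powers in the kernel only the lowest has a residue at 0 and only the highest has
    -- one at ∞. They produce the two monomials of the three-point function.
    have t0 := (hasTotalRes_bergmanPair hw (hz 0) (hz 1) (m := -1) (g := fun _ => 1)
      (g' := fun t => t ^ 6) (by fun_prop) (by fun_prop)
      (fun q hq => by rw [mul_neg, zpow_neg, mul_one]; norm_cast; field_simp)
      (fun q hq => by rw [mul_neg, zpow_neg, mul_one]; norm_cast; field_simp)).const_mul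
        (kerCoeff α β 0)
    have t1 := (hasTotalRes_bergmanPair hw (hz 0) (hz 1) (m := 0) (g := fun q => q ^ 2)
      (g' := fun t => t ^ 4) (by fun_prop) (by fun_prop)
      (fun q hq => by rw [mul_zero, zpow_zero]; field_simp)
      (fun q hq => by rw [mul_zero, zpow_zero]; field_simp)).const_mul (kerCoeff α β 1)
    have t2 := (hasTotalRes_bergmanPair hw (hz 0) (hz 1) (m := 1) (g := fun q => q ^ 4)
      (g' := fun t => t ^ 2) (by fun_prop) (by fun_prop)
      (fun q hq => by rw [mul_one, zpow_ofNat]; field_simp)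
      (fun q hq => by rw [mul_one, zpow_ofNat]; field_simp)).const_mul (kerCoeff α β 2)
    have t3 := (hasTotalRes_bergmanPair hw (hz 0) (hz 1) (m := 2) (g := fun q => q ^ 6)
      (g' := fun _ => 1) (by fun_prop) (by fun_prop)
      (fun q hq => by rw [show (2 * 2 : ℤ) = (4 : ℕ) by norm_num, zpow_natCast]; field_simp)
      (fun q hq => by rw [show (2 * 2 : ℤ) = (4 : ℕ) by norm_num, zpow_natCast]; field_simp)).const_mul
        (kerCoeff α β 3)
    have t := ((t0.add t1).add t2).add t3
    simp only [kerCoeff] at t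
    convert t.congr ?_ using 1
    · have := hz 0
      have := hz 1
      simp only [monoFun, Fin.prod_univ_two, mul_zero, mul_neg, mul_one, zpow_neg, zpow_ofNat]
      field_simp
      ring
    · filter_upwards [eoKernel_eq hs hαβ w] with q hq
      rw [if_pos rfl, zero_add, h2, show ∀ a b : ℂ, a * -b = -a * b by intros; ring, hq]
      simp only [Finset.sum_range_succ, Finset.sum_range_zero, kerCoeff]
      push_cast
      norm_num
      ring

/-- Only ω_{0,2}(q, -q) = 1/(4q²) contributes. It corresponds to the exponents 0 and -1 with
coefficient 1/4, which is the diagonal series of `diagSer_eq`. -/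
theorem matches_genusSer_one_one (h0 : constantCoeff (Z : ℂ⟦X⟧) = 1) : Matches s α β Z (n := 0)
    (fun a => genusSer s u v 1 (Finset.univ.val.map a))
    (fun z q => eoOmega (curveX s α β) (curveY s α β) 1 1 (Fin.cons q z)) := by
  have hI : ∀ I : Finset (Fin 0), I = ∅ := by decide
  have hh : ∀ h : Fin 2, h.val = 0 ∨ h.val = 1 := by decide
  have hsum : ∀ {M : Type} [AddCommMonoid M] (f : Fin 2 → Finset (Fin 0) → M),
      (∑ h : Fin 2, ∑ I : Finset (Fin 0),
        if (h.val = 0 ∧ I = ∅) ∨ (h.val = 1 ∧ I = Finset.univ) then 0 else f h I) = 0 :=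
    fun f => Finset.sum_eq_zero fun h _ => Finset.sum_eq_zero fun I _ =>
      if_pos ((hh h).imp (fun h => ⟨h, hI I⟩) fun h => ⟨h, by rw [hI I]; rfl⟩)
  obtain ⟨G, h1, h2⟩ := (resMatches_kernel_mono (Z := Z) hs hαβ 0 (-1) (Fin.elim0 : Fin 0 → ℤ)).smul
    (1 / 4)
  refine h1.congr (fun a => ?_) (fun z w hz hw => (HasTotalRes.eoOmega_eq (by norm_num)
    ((h2 z w hz hw).congr ?_)).symm)
  · have h := genusSer_eq_kerSer_mul hs hαβ hZ hY 1 (n := 0) (by norm_num) a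
    rw [h, hsum, if_neg one_ne_zero]
    have h3 := diagSer_eq hs hαβ hZ (yOfSer_mul_genusSer_singleton hY) h0
    have h4 : (fun j => genusSer s u v (1 - 1) (j ::ₘ Finset.univ.val.map a)) =
        fun j => genusSer s u v 0 {j} := rfl
    rw [h4, h3]
    simp [smul_eq_C_mul]
    ring
  · filter_upwards [eventually_ramification_ne 0] with q hq
    rw [hsum, if_neg one_ne_zero]
    have h3 : eoOmega (curveX s α β) (curveY s α β) (1 - 1) (0 + 2)
        (Fin.cons q (Fin.cons (-q) z)) = 1 / (q - -q) ^ 2 := eoOmega_zero_two _ _ _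
    rw [h3]
    simp
    field_simp
    ring

/-- Strong induction on 2g + n. Beyond the two initial cases the recursion splits into the term of
genus g - 1, the products of two stable factors, and the products with ω_{0,2}; each kind has its
own matching lemma. -/
theorem matches_genusSer (h0 : constantCoeff (Z : ℂ⟦X⟧) = 1) {g n : ℕ} (hgn : 2 < 2 * g + (n + 1)) :
    Matches s α β Z (n := n) (fun a => genusSer s u v g (Finset.univ.val.map a))
      (fun z q => eoOmega (curveX s α β) (curveY s α β) g (n + 1) (Fin.cons q z)) := by
  obtain ⟨N, hN⟩ : ∃ N, N = 2 * g + n := ⟨_, rfl⟩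
  induction N using Nat.strong_induction_on generalizing g n with
  | _ N ih =>
  subst hN
  have ih' : ∀ {g' n' : ℕ}, 2 < 2 * g' + (n' + 1) → 2 * g' + n' < 2 * g + n →
      Matches s α β Z (n := n') (fun a => genusSer s u v g' (Finset.univ.val.map a))
        (fun z q => eoOmega (curveX s α β) (curveY s α β) g' (n' + 1) (Fin.cons q z)) :=
    fun h1 h2 => ih _ h2 h1 rfl
  rcases (by omega : (g = 0 ∧ n = 2) ∨ (g = 1 ∧ n = 0) ∨ 2 < 2 * g + n) with
    ⟨rfl, rfl⟩ | ⟨rfl, rfl⟩ | hlt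
  · exact matches_genusSer_zero_three hs hαβ hZ hY h0
  · exact matches_genusSer_one_one hs hαβ hZ hY h0
  set x := curveX s α β with hx
  set y := curveY s α β with hy
  have hdiag : ResMatches s α β Z (n := n)
      (fun a => kerSer s α β Z * if g = 0 then 0 else
        diagSer fun j => genusSer s u v (g - 1) (j ::ₘ Finset.univ.val.map a))
      (fun z z₀ q => eoKernel x y z₀ q *
        -(if g = 0 then 0 else eoOmega x y (g - 1) (n + 2) (Fin.cons q (Fin.cons (-q) z)))) := by
    by_cases hg : g = 0
    · simp only [hg, if_true, mul_zero, neg_zero]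
      simpa using ResMatches.sum (s := s) (α := α) (β := β) (Z := Z) (n := n) (∅ : Finset ℕ)
        (F := fun _ _ => 0) (I := fun _ _ _ _ => 0) (by simp)
    · refine ((ih' (g' := g - 1) (n' := n + 1) (by omega) (by omega)).resMatches_diag
        hs hαβ hZ).congr (fun a => ?_) fun z z₀ _ _ => Eventually.of_forall fun q => ?_
      · simp only [if_neg hg, map_univ_cons]
      · simp only [if_neg hg]
        rfl
  have hstable : ∀ (h : Fin (g + 1)) (I : Finset (Fin n)), ResMatches s α β Z (n := n)
      (fun a => kerSer s α β Z * if ((h.val = 0 ∧ I = ∅) ∨ (h.val = g ∧ I = Finset.univ)) ∨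
          ((h.val = 0 ∧ I.card = 1) ∨ (h.val = g ∧ Iᶜ.card = 1)) then 0 else
        genusSer s u v h.val (I.val.map a) * genusSer s u v (g - h.val) (Iᶜ.val.map a))
      (fun z z₀ q => eoKernel x y z₀ q *
        -(if ((h.val = 0 ∧ I = ∅) ∨ (h.val = g ∧ I = Finset.univ)) ∨
          ((h.val = 0 ∧ I.card = 1) ∨ (h.val = g ∧ Iᶜ.card = 1)) then 0 else
        eoTerm x y g z q h I)) := by
    intro h I
    split_ifs with hc
    · simp only [mul_zero, neg_zero]
      simpa using ResMatches.sum (s := s) (α := α) (β := β) (Z := Z) (n := n) (∅ : Finset ℕ)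
        (F := fun _ _ => 0) (I := fun _ _ _ _ => 0) (by simp)
    · have e3 : I = ∅ ↔ I.card = 0 := Finset.card_eq_zero.symm
      have e4 : I = Finset.univ ↔ I.card = n := by
        rw [← Finset.card_eq_iff_eq_univ, Fintype.card_fin]
      have e5 : I.card + Iᶜ.card = n := by rw [Finset.card_add_card_compl, Fintype.card_fin]
      have hh := h.isLt
      rw [e3, e4] at hc
      refine ((ih' (g' := h.val) (n' := I.card) (by omega) (by omega)).resMatches_mul hs hαβ
        (ih' (g' := g - h.val) (n' := Iᶜ.card) (by omega) (by omega))
        (finSumEquivOfFinset (rfl : I.card = I.card) rfl)).congr (fun a => ?_)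
        fun z z₀ _ _ => Eventually.of_forall fun q => ?_
      · simp only [finSumEquivOfFinset_inl, finSumEquivOfFinset_inr, map_univ_orderEmbOfFin]
      · simp only [finSumEquivOfFinset_inl, finSumEquivOfFinset_inr]
        rfl
  -- The shift term of the j-th point is grouped with the two products that contain the two-point
  -- series of that point.
  have htwo : ∀ j : Fin n, ResMatches s α β Z (n := n)
      (fun a => kerSer s α β Z * (2 * genusSer s u v 0 {a j} *
          genusSer s u v g (({j}ᶜ : Finset (Fin n)).val.map a) +
        a j • (X * shiftSer (a j) (genusSer s u v g (({j}ᶜ : Finset (Fin n)).val.map a)))))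
      (fun z z₀ q => eoKernel x y z₀ q *
        -(eoTerm x y g z q 0 {j} + eoTerm x y g z q (Fin.last g) {j}ᶜ)) := by
    intro j
    have hcard : ({j}ᶜ : Finset (Fin n)).card + 1 = n := by
      have : ({j} : Finset (Fin n)).card + ({j}ᶜ : Finset (Fin n)).card = n := by
        rw [Finset.card_add_card_compl, Fintype.card_fin]
      rw [Finset.card_singleton] at this
      omega
    refine ((ih' (g' := g) (n' := ({j}ᶜ : Finset (Fin n)).card) (by omega)
      (by omega)).resMatches_insert hs hαβ hZ (yOfSer_mul_genusSer_singleton hY)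
      (finSumEquivOfFinset (Finset.card_singleton j) rfl)).congr (fun a => ?_)
      fun z z₀ _ _ => Eventually.of_forall fun q => ?_
    · simp only [finSumEquivOfFinset_inl, finSumEquivOfFinset_inr, map_univ_orderEmbOfFin,
        Finset.orderEmbOfFin_singleton]
    · simp only [finSumEquivOfFinset_inl, finSumEquivOfFinset_inr, Finset.orderEmbOfFin_singleton]
      refine congrArg (fun c => eoKernel x y z₀ q * -c) (congrArg₂ (· + ·) ?_ ?_)
      · exact congrArg₂ (· * ·) (eoOmega_singleton _ _ _ _ rfl rfl).symm rfl
      · exact congrArg₂ (· * ·) rfl (eoOmega_singleton _ _ _ _ (compl_compl _)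
          (Nat.sub_self g)).symm
  obtain ⟨G, h1, h2⟩ := (hdiag.add (ResMatches.sum Finset.univ fun h _ =>
    ResMatches.sum Finset.univ fun I _ => hstable h I)).add
      (ResMatches.sum Finset.univ fun j _ => htwo j)
  refine h1.congr (fun a => ?_) fun z w hz hw => (HasTotalRes.eoOmega_eq hgn
    ((h2 z w hz hw).congr (Eventually.of_forall fun q => ?_))).symm
  · rw [genusSer_eq_kerSer_mul hs hαβ hZ hY g (by omega) a, sum_eq_sum_add_two_point hlt
      fun h I => genusSer s u v h.val (I.val.map a) * genusSer s u v (g - h.val) (Iᶜ.val.map a)]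
    have h3 : ∀ j : Fin n, genusSer s u v (0 : Fin (g + 1)).val
          (({j} : Finset (Fin n)).val.map a) *
          genusSer s u v (g - (0 : Fin (g + 1)).val) (({j}ᶜ : Finset (Fin n)).val.map a) +
        genusSer s u v (Fin.last g).val (({j}ᶜ : Finset (Fin n)).val.map a) *
          genusSer s u v (g - (Fin.last g).val) (({j}ᶜᶜ : Finset (Fin n)).val.map a) =
        2 * genusSer s u v 0 {a j} * genusSer s u v g (({j}ᶜ : Finset (Fin n)).val.map a) := by
      intro j
      rw [compl_compl, Fin.val_last, Nat.sub_self, Fin.val_zero, Nat.sub_zero,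
        Finset.singleton_val, Multiset.map_singleton]
      ring
    simp only [h3, ← mul_smul_comm, ← Finset.mul_sum, Finset.sum_add_distrib]
    ring
  · rw [sum_eq_sum_add_two_point hlt fun h I => eoTerm x y g z q h I]
    simp only [← Finset.mul_sum, Finset.sum_neg_distrib]
    ring

end Recursion

/-! ### Convergence and values of power series -/

section Evaluation

open PowerSeries

/-- The power series `F` converges at `t`, with value `c`. -/
def HasSumAt (t : ℂ) (F : ℂ⟦X⟧) (c : ℂ) : Prop := HasSum (fun k => coeff k F * t ^ k) c

variable {t c d : ℂ} {F G : ℂ⟦X⟧}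

theorem HasSumAt.mul (hF : HasSumAt t F c) (hG : HasSumAt t G d) : HasSumAt t (F * G) (c * d) := by
  have h1 := summable_norm_sum_mul_antidiagonal_of_summable_norm hF.summable.norm hG.summable.norm
  have h2 := tsum_mul_tsum_eq_tsum_sum_antidiagonal_of_summable_norm hF.summable.norm
    hG.summable.norm
  rw [hF.tsum_eq, hG.tsum_eq] at h2
  rw [HasSumAt, h2]
  refine HasSum.congr_fun h1.of_norm.hasSum fun k => ?_
  rw [coeff_mul, Finset.sum_mul]
  refine Finset.sum_congr rfl fun p hp => ?_
  rw [← Finset.HasAntidiagonal.mem_antidiagonal.mp hp, pow_add]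
  ring

theorem HasSumAt.sub (hF : HasSumAt t F c) (hG : HasSumAt t G d) : HasSumAt t (F - G) (c - d) := by
  refine (HasSum.sub hF hG).congr_fun ?_
  intro k
  simp [sub_mul]

theorem hasSumAt_C (t c : ℂ) : HasSumAt t (C c) c := by
  have : HasSum (fun k => coeff k (C c) * t ^ k) (coeff 0 (C c) * t ^ 0) :=
    hasSum_single 0 fun k hk => by rw [coeff_C, if_neg hk, zero_mul]
  simpa [HasSumAt] using this

theorem hasSumAt_one (t : ℂ) : HasSumAt t 1 1 := by
  simpa using hasSumAt_C t 1

theorem hasSumAt_X (t : ℂ) : HasSumAt t X t := by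
  have : HasSum (fun k => coeff k (X : ℂ⟦X⟧) * t ^ k) (coeff 1 (X : ℂ⟦X⟧) * t ^ 1) :=
    hasSum_single 1 fun k hk => by rw [coeff_X, if_neg hk, zero_mul]
  simpa [HasSumAt] using this

theorem HasSumAt.pow (hF : HasSumAt t F c) (k : ℕ) : HasSumAt t (F ^ k) (c ^ k) := by
  induction k with
  | zero => simpa using hasSumAt_one t
  | succ k ih => rw [pow_succ, pow_succ]; exact ih.mul hF

theorem hasSumAt_one_sub (t c : ℂ) : HasSumAt t (1 - C c * X) (1 - c * t) :=
  (hasSumAt_one t).sub ((hasSumAt_C t c).mul (hasSumAt_X t))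

/-- The geometric series. -/
noncomputable def geomSer (c : ℂ) : ℂ⟦X⟧ := mk fun k => c ^ k

theorem geomSer_mul (c : ℂ) : geomSer c * (1 - C c * X) = 1 := by
  rw [mul_sub, mul_one, mul_left_comm]
  ext k
  rcases k with _ | k
  · simp [geomSer]
  · simp [geomSer, coeff_succ_mul_X, coeff_one, pow_succ']

theorem hasSumAt_geomSer {t c : ℂ} (h : ‖c * t‖ < 1) : HasSumAt t (geomSer c) (1 - c * t)⁻¹ := by
  have := hasSum_geometric_of_norm_lt_one h
  simpa only [HasSumAt, geomSer, coeff_mk, ← mul_pow] using this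

theorem HasSumAt.units_zpow {Z : ℂ⟦X⟧ˣ} (h : HasSumAt t (Z : ℂ⟦X⟧) c)
    (h' : HasSumAt t ((Z⁻¹ : ℂ⟦X⟧ˣ) : ℂ⟦X⟧) c⁻¹) (m : ℤ) :
    HasSumAt t ((Z ^ m : ℂ⟦X⟧ˣ) : ℂ⟦X⟧) (c ^ m) := by
  rcases m.eq_nat_or_neg with ⟨k, rfl | rfl⟩
  · rw [zpow_natCast, zpow_natCast, Units.val_pow_eq_pow_val]
    exact h.pow k
  · rw [← inv_zpow', ← inv_zpow', zpow_natCast, zpow_natCast, Units.val_pow_eq_pow_val]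
    exact h'.pow k

open Topology in
-- Uniqueness of power series expansions. It carries the algebraic equation of z over to the formal
-- series.
theorem eq_zero_of_hasSumAt_zero {r : ℝ} (hr : 0 < r)
    (h : ∀ t ∈ Metric.ball (0 : ℂ) r, HasSumAt t F 0) : F = 0 := by
  have h1 : HasFPowerSeriesAt (0 : ℂ → ℂ)
      (FormalMultilinearSeries.ofScalars ℂ fun k => coeff k F) 0 := by
    rw [hasFPowerSeriesAt_iff]
    filter_upwards [Metric.ball_mem_nhds 0 hr] with t ht
    simpa [HasSumAt, FormalMultilinearSeries.coeff_ofScalars, mul_comm] using h t ht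
  have h2 := h1.eq_zero
  ext k
  have h3 : (FormalMultilinearSeries.ofScalars ℂ fun k => coeff k F).coeff k = 0 := by
    rw [h2]; rfl
  rwa [FormalMultilinearSeries.coeff_ofScalars] at h3

theorem HasSum.mul_complex {ι κ : Type*} {f : ι → ℂ} {g : κ → ℂ} {c d : ℂ} (hf : HasSum f c)
    (hg : HasSum g d) : HasSum (fun p : ι × κ => f p.1 * g p.2) (c * d) :=
  hf.mul hg (summable_mul_of_summable_norm hf.summable.norm hg.summable.norm)

theorem hasSum_fin_prod {n : ℕ} {f : Fin n → ℕ → ℂ} {c : Fin n → ℂ}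
    (h : ∀ i, HasSum (f i) (c i)) :
    HasSum (fun a : Fin n → ℕ => ∏ i, f i (a i)) (∏ i, c i) := by
  induction n with
  | zero =>
    simp
  | succ n ih =>
    have h1 := ih (f := fun i => f i.succ) (c := fun i => c i.succ) fun i => h i.succ
    have h2 := (h 0).mul_complex h1
    rw [Fin.prod_univ_succ, ← Equiv.hasSum_iff (Fin.consEquiv fun _ : Fin (n + 1) => ℕ)]
    refine h2.congr_fun fun p => ?_
    simp only [Function.comp_apply, Fin.prod_univ_succ]
    rfl

end Evaluation

/-! ### Expansion of the coordinate z at x = ∞ -/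

section Curve

open PowerSeries

variable {s α β : ℂ}

/-- Numerator and denominator have positive real part, so their quotient cannot be a non-positive
real number. Hence the principal root is holomorphic here. -/
theorem div_one_sub_mem_slitPlane {a b : ℂ} (ha : ‖a‖ < 1) (hb : ‖b‖ < 1) :
    (1 - b) / (1 - a) ∈ Complex.slitPlane := by
  have h1 : ∀ {c : ℂ}, ‖c‖ < 1 → 0 < (1 - c).re := fun {c} hc => by
    have := (Complex.re_le_norm c).trans_lt hc
    simp only [Complex.sub_re, Complex.one_re]
    linarith
  have h0 : 1 - a ≠ 0 := fun h => by have := h1 ha; simp [h] at this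
  rw [Complex.mem_slitPlane_iff_not_le_zero]
  intro h
  obtain ⟨r, hr, e⟩ : ∃ r : ℝ, r ≤ 0 ∧ (1 - b) / (1 - a) = r := by
    rw [Complex.le_def] at h
    exact ⟨_, h.1, Complex.ext rfl h.2⟩
  rw [div_eq_iff h0] at e
  have h2 := h1 hb
  rw [e, Complex.re_ofReal_mul] at h2
  nlinarith [h1 ha]

theorem curveZ_inv (s α β t : ℂ) :
    curveZ s α β t⁻¹ = ((1 - s * β * t) / (1 - s * α * t)) ^ (2⁻¹ : ℂ) := by
  rw [curveZ, Complex.sqrt, div_inv_eq_mul, div_inv_eq_mul]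

theorem curveZ_inv_sq (s α β t : ℂ) :
    curveZ s α β t⁻¹ ^ 2 = (1 - s * β * t) / (1 - s * α * t) := by
  rw [curveZ_inv]
  exact Complex.cpow_nat_inv_pow _ two_ne_zero

theorem norm_mul_lt_one_of_mem_ball {c t : ℂ} {ρ : ℝ} (hρ : 0 < ρ) (hc : ‖c‖ ≤ ρ)
    (ht : t ∈ Metric.ball (0 : ℂ) ρ⁻¹) : ‖c * t‖ < 1 := by
  rw [mem_ball_zero_iff] at ht
  rw [norm_mul]
  calc ‖c‖ * ‖t‖ ≤ ρ * ‖t‖ := by gcongr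
    _ < ρ * ρ⁻¹ := by gcongr
    _ = 1 := mul_inv_cancel₀ hρ.ne'

theorem one_sub_ne_zero_of_norm_lt {c : ℂ} (h : ‖c‖ < 1) : 1 - c ≠ 0 := fun e => by
  rw [← sub_eq_zero.mp e, norm_one] at h
  exact lt_irrefl _ h

/-- `T` is the Taylor series at X = 0. It converges on the whole disc because the chosen root is
holomorphic there. -/
theorem exists_hasSumAt_curveZ {ρ : ℝ} (hρ : 0 < ρ) (h1 : ‖s * α‖ ≤ ρ) (h2 : ‖s * β‖ ≤ ρ) :
    ∃ T : ℂ⟦X⟧, constantCoeff T = 1 ∧ (1 - C (s * α) * X) * T ^ 2 = 1 - C (s * β) * X ∧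
      ∀ t ∈ Metric.ball (0 : ℂ) ρ⁻¹, HasSumAt t T (curveZ s α β t⁻¹) := by
  have hd : DifferentiableOn ℂ (fun t => curveZ s α β t⁻¹) (Metric.ball 0 ρ⁻¹) := by
    intro t ht
    have ha := norm_mul_lt_one_of_mem_ball hρ h1 ht
    have hb := norm_mul_lt_one_of_mem_ball hρ h2 ht
    simp only [curveZ_inv]
    have h : DifferentiableAt ℂ (fun t => (1 - s * β * t) / (1 - s * α * t)) t :=
      DifferentiableAt.div (by fun_prop) (by fun_prop) (one_sub_ne_zero_of_norm_lt ha)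
    exact (h.cpow_const (div_one_sub_mem_slitPlane ha hb)).differentiableWithinAt
  have hT : ∀ t ∈ Metric.ball (0 : ℂ) ρ⁻¹, HasSumAt t
      (mk fun k => (k.factorial : ℂ)⁻¹ * iteratedDeriv k (fun t => curveZ s α β t⁻¹) 0)
      (curveZ s α β t⁻¹) := by
    intro t ht
    have := Complex.hasSum_taylorSeries_on_ball hd ht
    refine HasSum.congr_fun this fun k => ?_
    simp only [coeff_mk, sub_zero, smul_eq_mul]
    ring
  refine ⟨_, ?_, ?_, hT⟩
  · rw [← coeff_zero_eq_constantCoeff_apply, coeff_mk, iteratedDeriv_zero, curveZ_inv]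
    simp
  · refine sub_eq_zero.mp (eq_zero_of_hasSumAt_zero (inv_pos.mpr hρ) fun t ht => ?_)
    have := ((hasSumAt_one_sub t (s * α)).mul ((hT t ht).pow 2)).sub (hasSumAt_one_sub t (s * β))
    convert this using 1
    have ha := one_sub_ne_zero_of_norm_lt (norm_mul_lt_one_of_mem_ball hρ h1 ht)
    rw [curveZ_inv_sq, mul_div_cancel₀ _ ha, sub_self]

theorem PowerSeries.eq_of_sq_eq_sq {F G : ℂ⟦X⟧} (hF : constantCoeff F = 1)
    (hG : constantCoeff G = 1) (h : F ^ 2 = G ^ 2) : F = G := by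
  rcases sq_eq_sq_iff_eq_or_eq_neg.mp h with h | h
  · exact h
  · have := congrArg constantCoeff h
    rw [map_neg, hF, hG] at this
    norm_num at this

/-- The expansion of the coordinate `z` at `x = ∞`. -/
theorem exists_coordinate_series {u v a b : ℂ} (hs : s ≠ 0) (hαβ : α - β ≠ 0) (ha : a ^ 2 = u)
    (hb : b ^ 2 = v) (hα : α = (a - b) ^ 2) (hβ : β = (a + b) ^ 2) :
    ∃ Z : ℂ⟦X⟧ˣ, (1 - C (s * α) * X) * (Z : ℂ⟦X⟧) ^ 2 = 1 - C (s * β) * X ∧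
      ySer s u v = yOfSer s α Z ∧ constantCoeff (Z : ℂ⟦X⟧) = 1 ∧
      ∀ x : ℂ, ‖s * α‖ < ‖x‖ ∧ ‖s * β‖ < ‖x‖ → ∀ k : ℤ,
        HasSumAt x⁻¹ ((Z ^ k : ℂ⟦X⟧ˣ) : ℂ⟦X⟧) (curveZ s α β x ^ k) := by
  -- The radius of the disc is the inverse of this maximum, which is non-zero because s ≠ 0 and α ≠
  -- β.
  have hρ : 0 < max ‖s * α‖ ‖s * β‖ := by
    by_contra h
    have h1 : s * α = 0 := norm_le_zero_iff.mp ((le_max_left _ _).trans (not_lt.mp h))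
    have h2 : s * β = 0 := norm_le_zero_iff.mp ((le_max_right _ _).trans (not_lt.mp h))
    exact mul_ne_zero hs hαβ (by rw [mul_sub, h1, h2, sub_zero])
  obtain ⟨T, hT1, hT2, hT3⟩ := exists_hasSumAt_curveZ hρ (le_max_left _ _) (le_max_right _ _)
  -- The inverse of z is z (1 - sαX)/(1 - sβX), whose series also converges on the disc.
  have hinv : T * (T * ((1 - C (s * α) * X) * geomSer (s * β))) = 1 := by
    linear_combination geomSer (s * β) * hT2 + geomSer_mul (s * β)
  have hval : (T * ((1 - C (s * α) * X) * geomSer (s * β))) * T = 1 := by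
    rw [mul_comm]; exact hinv
  obtain ⟨Z, hZT, hZi⟩ : ∃ Z : ℂ⟦X⟧ˣ, (Z : ℂ⟦X⟧) = T ∧
      ((Z⁻¹ : ℂ⟦X⟧ˣ) : ℂ⟦X⟧) = T * ((1 - C (s * α) * X) * geomSer (s * β)) :=
    ⟨⟨T, _, hinv, hval⟩, rfl, rfl⟩
  rw [← hZT] at hT1 hT2
  refine ⟨Z, hT2, ?_, hT1, fun x hx => ?_⟩
  -- The combinatorial and the geometric y have the same square, and the constant term 1 fixes the
  -- sign.
  · refine PowerSeries.eq_of_sq_eq_sq (constantCoeff_ySer s u v) (by simp [yOfSer, hT1]) ?_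
    rw [ySer_sq, yOfSer_sq hT2]
    subst ha hb hα hβ
    simp only [map_mul, map_add, map_sub, map_pow, map_ofNat]
    ring
  · have hx0 : 0 < ‖x‖ := (norm_nonneg _).trans_lt hx.1
    have ht : x⁻¹ ∈ Metric.ball (0 : ℂ) (max ‖s * α‖ ‖s * β‖)⁻¹ := by
      rw [mem_ball_zero_iff, norm_inv]
      exact inv_strictAnti₀ hρ (max_lt hx.1 hx.2)
    have h3 := hT3 _ ht
    have h4 := norm_mul_lt_one_of_mem_ball hρ (le_max_left _ _) ht
    have h5 := norm_mul_lt_one_of_mem_ball hρ (le_max_right _ _) ht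
    have h6 := one_sub_ne_zero_of_norm_lt h4
    have h7 := one_sub_ne_zero_of_norm_lt h5
    have hsq := curveZ_inv_sq s α β x⁻¹
    rw [inv_inv] at h3 hsq
    refine HasSumAt.units_zpow (hZT ▸ h3) ?_
    rw [hZi]
    have := h3.mul ((hasSumAt_one_sub x⁻¹ (s * α)).mul (hasSumAt_geomSer h5))
    convert this using 1
    have h8 : curveZ s α β x ^ 2 ≠ 0 := by rw [hsq]; exact div_ne_zero h7 h6
    have h9 : curveZ s α β x ≠ 0 := fun h => h8 (by rw [h]; ring)
    rw [eq_div_iff h6] at hsq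
    refine inv_eq_of_mul_eq_one_right ?_
    rw [show ∀ c p q : ℂ, c * (c * (p * q)) = c ^ 2 * p * q by intros; ring, hsq,
      mul_inv_cancel₀ h7]

theorem curveZ_ne {x : ℂ} (hs : s ≠ 0) (hαβ : α - β ≠ 0) (hx : ‖s * α‖ < ‖x‖ ∧ ‖s * β‖ < ‖x‖) :
    curveZ s α β x ≠ 0 ∧ curveZ s α β x ^ 2 - 1 ≠ 0 := by
  have hx0 : x ≠ 0 := norm_pos_iff.mp ((norm_nonneg _).trans_lt hx.1)
  have h1 : ∀ {c : ℂ}, ‖c‖ < ‖x‖ → 1 - c * x⁻¹ ≠ 0 := fun {c} hc =>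
    one_sub_ne_zero_of_norm_lt (by
      rw [norm_mul, norm_inv]
      rw [← div_eq_mul_inv, div_lt_one (norm_pos_iff.mpr hx0)]
      exact hc)
  have hsq := curveZ_inv_sq s α β x⁻¹
  rw [inv_inv] at hsq
  refine ⟨fun h => ?_, fun h => ?_⟩
  · rw [h, zero_pow two_ne_zero, eq_comm, div_eq_zero_iff] at hsq
    exact hsq.elim (h1 hx.2) (h1 hx.1)
  · rw [sub_eq_zero.mp h, eq_div_iff (h1 hx.1)] at hsq
    refine mul_ne_zero (mul_ne_zero hs hαβ) (inv_ne_zero hx0) ?_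
    linear_combination -hsq

theorem hasSum_eCoeff {Z : ℂ⟦X⟧ˣ} {x : ℂ} (hs : s ≠ 0) (hαβ : α - β ≠ 0)
    (hZ : (1 - C (s * α) * X) * (Z : ℂ⟦X⟧) ^ 2 = 1 - C (s * β) * X)
    (hx : ‖s * α‖ < ‖x‖ ∧ ‖s * β‖ < ‖x‖) (h : ∀ k : ℤ,
      HasSumAt x⁻¹ ((Z ^ k : ℂ⟦X⟧ˣ) : ℂ⟦X⟧) (curveZ s α β x ^ k)) (k : ℤ) :
    HasSum (fun a : ℕ => eCoeff s α β Z k a * (x ^ (a + 1))⁻¹)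
      (curveZ s α β x ^ (2 * k) / deriv (curveX s α β) (curveZ s α β x)) := by
  obtain ⟨h0, h1⟩ := curveZ_ne hs hαβ hx
  have h2 := h 1
  rw [zpow_one, zpow_one] at h2
  have h3 := ((hasSumAt_C x⁻¹ (-1 / (2 * s * (α - β)))).mul
    (((h2.pow 2).sub (hasSumAt_one _)).pow 2)).mul (h (2 * k - 1))
  rw [← eSer] at h3
  -- The index of `eCoeff` is one less than the power of 1/x; the constant term of `eSer` is 0.
  have h4 := (hasSum_nat_add_iff' 1).mpr h3
  rw [Finset.sum_range_one, coeff_zero_eSer hs hαβ hZ, zero_mul, sub_zero] at h4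
  have h5 : curveZ s α β x ^ (2 * k) / deriv (curveX s α β) (curveZ s α β x) =
      -1 / (2 * s * (α - β)) * (curveZ s α β x ^ 2 - 1) ^ 2 * curveZ s α β x ^ (2 * k - 1) := by
    rw [deriv_curveX h1, zpow_sub₀ h0, zpow_one]
    field_simp
  rw [h5]
  exact HasSum.congr_fun h4 fun a => by rw [eCoeff, inv_pow]

theorem deriv_curveX_inv {z : ℂ} (h0 : z ≠ 0) (h1 : z ^ 2 - 1 ≠ 0) :
    deriv (fun t => curveX s α β t⁻¹) z⁻¹ = deriv (curveX s α β) z * -z ^ 2 := by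
  have hd : DifferentiableAt ℂ (curveX s α β) (z⁻¹)⁻¹ := by
    rw [inv_inv]
    exact DifferentiableAt.div (by fun_prop) (by fun_prop) h1
  have h := hd.hasDerivAt.comp z⁻¹ (hasDerivAt_inv (inv_ne_zero h0))
  have h2 : deriv (fun t => curveX s α β t⁻¹) z⁻¹ = _ := h.deriv
  rw [h2]
  simp

theorem deriv_curveX_ne {z : ℂ} (hs : s ≠ 0) (hαβ : α - β ≠ 0) (h0 : z ≠ 0) (h1 : z ^ 2 - 1 ≠ 0) :
    deriv (curveX s α β) z ≠ 0 := by
  rw [deriv_curveX h1]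
  exact div_ne_zero (neg_ne_zero.mpr (mul_ne_zero (mul_ne_zero (mul_ne_zero two_ne_zero hs) hαβ) h0))
    (pow_ne_zero _ h1)

end Curve

theorem LaurentPoly.eval_mapDomain {ι : Type*} {n : ℕ} (w : ι →₀ ℂ) (f : ι → Fin n → ℤ)
    (z : Fin n → ℂ) : LaurentPoly.eval (w.mapDomain f) z = w.sum fun k c => c * ∏ i, z i ^ f k i :=
  Finsupp.sum_mapDomain_index (by simp) fun _ _ _ => add_mul _ _ _

theorem LaurentPoly.evenDegrees_mapDomain {ι : Type*} {n : ℕ} {w : ι →₀ ℂ} {f : ι → Fin n → ℤ}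
    (h : ∀ k ∈ w.support, ∀ i, Even (f k i)) :
    LaurentPoly.EvenDegrees (w.mapDomain f) := fun k hk => by
  classical
  obtain ⟨k', hk', rfl⟩ := Finset.mem_image.mp (Finsupp.mapDomain_support hk)
  exact h k' hk'

/-! ### Proof of the theorem -/

section Main

open PowerSeries

theorem map_univ_eq_cons_tail {n : ℕ} (a : Fin (n + 1) → ℕ) :
    Finset.univ.val.map a = a 0 ::ₘ Finset.univ.val.map (Fin.tail a) := by
  conv_lhs => rw [← Fin.cons_self_tail a, map_univ_cons]

theorem theorem1 (s u v a b α β : ℂ) (hs : s ≠ 0) (hu : u ≠ 0) (hv : v ≠ 0)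
    (ha : a ^ 2 = u) (hb : b ^ 2 = v) (hα : α = (a - b) ^ 2) (hβ : β = (a + b) ^ 2)
    (g n : ℕ) (hn : 0 < n) (hgn : 2 < 2 * g + n) :
    ∃ w w' : LaurentPoly n, w.EvenDegrees ∧ w'.EvenDegrees ∧
      (∀ x : Fin n → ℂ, (∀ i, ‖s * α‖ < ‖x i‖ ∧ ‖s * β‖ < ‖x i‖) →
        Summable (dessinGTerm s u v g x) ∧
        dessinG s u v g x * ∏ i, deriv (curveX s α β) (curveZ s α β (x i)) =
          w.eval (fun i => curveZ s α β (x i)) ∧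
        dessinG s u v g x *
            ∏ i, deriv (fun t => curveX s α β t⁻¹) (curveZ s α β (x i))⁻¹ =
          w'.eval (fun i => (curveZ s α β (x i))⁻¹)) ∧
      (∀ z : Fin n → ℂ, (∀ i, z i ≠ 0) →
        eoOmega (curveX s α β) (curveY s α β) g n z = w.eval z) := by
  obtain ⟨n, rfl⟩ : ∃ m, n = m + 1 := ⟨n - 1, by omega⟩
  have hαβ : α - β ≠ 0 := by
    have ha0 : a ≠ 0 := fun h => hu (by rw [← ha, h]; ring)
    have hb0 : b ≠ 0 := fun h => hv (by rw [← hb, h]; ring)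
    -- The branch points are distinct: α - β = -4√u√v.
    rw [hα, hβ, show (a - b) ^ 2 - (a + b) ^ 2 = -4 * a * b by ring]
    exact mul_ne_zero (mul_ne_zero (by norm_num) ha0) hb0
  obtain ⟨Z, hZ, hY, h0, hsum⟩ := exists_coordinate_series hs hαβ ha hb hα hβ
  obtain ⟨w, hw1, hw2⟩ := matches_genusSer hs hαβ hZ hY h0 hgn
  let κ : ℤ × (Fin n → ℤ) → Fin (n + 1) → ℤ := fun k => Fin.cons k.1 k.2
  have hterm : ∀ (x : Fin (n + 1) → ℂ) (a : Fin (n + 1) → ℕ), dessinGTerm s u v g x a =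
      ∑ k ∈ w.support, w k * ∏ i, (eCoeff s α β Z (κ k i) (a i) * (x i ^ (a i + 1))⁻¹) := by
    intro x a
    -- The first degree is recovered as a coefficient of the generating series; the other degrees
    -- are its parameters.
    have h := congrArg (coeff (a 0 + 1)) (hw1 (Fin.tail a))
    rw [coeff_succ_genusSer, Finsupp.sum, map_sum] at h
    rw [dessinGTerm, dessinCorrelator_eq s u v g hn, map_univ_eq_cons_tail, h, Finset.sum_mul]
    refine Finset.sum_congr rfl fun k _ => ?_
    rw [Finset.prod_mul_distrib, ← mul_assoc]
    congr 1
    rw [monoSer, Fin.prod_univ_succ]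
    simp only [map_smul, smul_eq_mul, κ, Fin.cons_zero, Fin.cons_succ, eCoeff, Fin.tail]
    ring
  have hG : ∀ x : Fin (n + 1) → ℂ, (∀ i, ‖s * α‖ < ‖x i‖ ∧ ‖s * β‖ < ‖x i‖) →
      HasSum (dessinGTerm s u v g x) (∑ k ∈ w.support, w k * ∏ i,
        (curveZ s α β (x i) ^ (2 * κ k i) / deriv (curveX s α β) (curveZ s α β (x i)))) := by
    intro x hx
    refine HasSum.congr_fun (hasSum_sum fun k _ => HasSum.mul_left (w k) (hasSum_fin_prod fun i =>
      hasSum_eCoeff hs hαβ hZ (hx i) (hsum _ (hx i)) (κ k i))) fun a => hterm x a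
  have heval : ∀ x : Fin (n + 1) → ℂ, (∀ i, ‖s * α‖ < ‖x i‖ ∧ ‖s * β‖ < ‖x i‖) →
      dessinG s u v g x * ∏ i, deriv (curveX s α β) (curveZ s α β (x i)) =
        w.sum fun k c => c * ∏ i, curveZ s α β (x i) ^ (2 * κ k i) := by
    intro x hx
    rw [dessinG, (hG x hx).tsum_eq, Finset.sum_mul]
    refine Finset.sum_congr rfl fun k _ => ?_
    rw [mul_assoc, ← Finset.prod_mul_distrib]
    congr 1
    refine Finset.prod_congr rfl fun i _ => ?_
    obtain ⟨h1, h2⟩ := curveZ_ne hs hαβ (hx i)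
    exact div_mul_cancel₀ _ (deriv_curveX_ne hs hαβ h1 h2)
  -- In the coordinate z̃ = 1/z one has z^(2k) dz = -z̃^(-2(k+1)) dz̃, which gives the second
  -- Laurent polynomial and one sign for each variable.
  refine ⟨w.mapDomain fun k i => 2 * κ k i,
    ((-1 : ℂ) ^ (n + 1) • w).mapDomain fun k i => -(2 * (κ k i + 1)),
    LaurentPoly.evenDegrees_mapDomain fun k _ i => even_two_mul _,
    LaurentPoly.evenDegrees_mapDomain fun k _ i => (even_two_mul _).neg,
    fun x hx => ⟨(hG x hx).summable, ?_, ?_⟩, fun z hz => ?_⟩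
  · rw [LaurentPoly.eval_mapDomain, heval x hx]
  · rw [LaurentPoly.eval_mapDomain, Finsupp.sum_smul_index' (by simp)]
    have h1 : ∀ i, deriv (fun t => curveX s α β t⁻¹) (curveZ s α β (x i))⁻¹ =
        deriv (curveX s α β) (curveZ s α β (x i)) * -curveZ s α β (x i) ^ 2 := fun i =>
      deriv_curveX_inv (curveZ_ne hs hαβ (hx i)).1 (curveZ_ne hs hαβ (hx i)).2
    simp only [h1]
    rw [Finset.prod_mul_distrib, ← mul_assoc, heval x hx, Finsupp.sum_mul]
    refine Finset.sum_congr rfl fun k _ => ?_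
    beta_reduce
    rw [mul_assoc, ← Finset.prod_mul_distrib, smul_eq_mul, mul_comm ((-1 : ℂ) ^ (n + 1)), mul_assoc]
    congr 1
    have h2 : (-1 : ℂ) ^ (n + 1) = ∏ _i : Fin (n + 1), (-1 : ℂ) := by simp
    rw [h2, ← Finset.prod_mul_distrib]
    refine Finset.prod_congr rfl fun i _ => ?_
    rw [inv_zpow, ← zpow_neg, neg_neg, mul_add, mul_one, zpow_add₀ (curveZ_ne hs hαβ (hx i)).1,
      zpow_ofNat]
    ring
  · rw [LaurentPoly.eval_mapDomain, ← Fin.cons_self_tail z]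
    refine (hw2 (Fin.tail z) (z 0) (fun i => hz _) (hz 0)).trans ?_
    refine Finset.sum_congr rfl fun k _ => ?_
    beta_reduce
    rw [monoFun, Fin.prod_univ_succ]
    rfl

end Main
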